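/- **Setting.** Let $\mathcal G=(\mathcal V,E)$ be a finite simple graph with $\mathcal V=\{1,\dots,N\}$ in which every vertex has degree at most $\mathfrak d_0$, where $\mathfrak d_0\ge 1$. Write $\mathcal N_i$ for the set of neighbours of $i$. For every edge $e=(i,j)$ let $|\phi_0\rangle_e\in\mathbb C^D\otimes\mathbb C^D$ be a unit vector and complete it by $|\phi_\alpha\rangle_e$, $\alpha=1,\dots,D^2-1$, to an orthonormal basis. For every vertex $i$ let $A_i:(\mathbb C^D)^{\otimes|\mathcal N_i|}\to\mathbb C^d$ be an injective linear map, with image $S_i$ and pseudo-inverse $A_i^{-1}=(A_i^\dagger A_i)^{-1}A_i^\dagger$; let $P_{S_i}$ be the orthogonal projector onto $S_i$ and $P_{S_i}^\perp=I-P_{S_i}$. Let $|\psi\rangle\in(\mathbb C^d)^{\otimes N}$ be the normalization of the injective PEPS $\big(\bigotimes_{i}A_i\big)\bigotimes_{e\in E}|\phi_0\rangle_e$. The parent Lindbladian is $\mathcal L=\sum_{e\in E}\mathcal L_e+\sum_{i\in\mathcal V}\mathcal L_i$, where $$\mathcal L_i(X)=\frac{1}{\dim S_i}\,P_{S_i}\otimes\mathrm{Tr}_i\big(P_{S_i}^\perp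 X\big)-\tfrac12\{P_{S_i}^\perp,X\},$$ $$\mathcal L_e(X)=\sum_{\alpha=1}^{D^2-1}\Big(L_{\alpha,e}XL_{\alpha,e}^\dagger-\tfrac12\{L_{\alpha,e}^\dagger L_{\alpha,e},X\}\Big),\qquad L_{\alpha,(i,j)}=(A_i\otimes A_j)\,|\phi_0\rangle\langle\phi_\alpha|_{(i,j)}\,(A_i^{-1}\otimes A_j^{-1}),$$ and $|\phi_0\rangle\langle\phi_\alpha|_{(i,j)}$ acts as the identity on the virtual qudits at $i$ and $j$ that do not belong to the edge $(i,j)$. Let $\|\cdot\|$ be the operator norm, $\|\cdot\|_1$ the trace norm, and $\|\mathcal E\|_{1\to1}=\sup_{\|X\|_1=1}\|\mathcal E(X)\|_1$. **Theorem.** There are a threshold $\delta_{\mathrm{th}}=\delta_{\mathrm{th}}(\mathfrak d_0)>0$, depending only on $\mathfrak d_0$, with $\delta_{\mathrm{th}}(\mathfrak d_0)=\Theta(1/\mathfrak d_0)$ as $\mathfrak d_0\to\infty$, and universal constants $C,\kappa>0$ such that the following holds for all $\mathfrak d_0\ge1$, $N$, $d$, $D$, all graphs and all injective PEPS as above. If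 $\|A_i^\dagger A_i-I\|\le\delta$ for every vertex $i$, with $\delta\le\delta_{\mathrm{th}}(\mathfrak d_0)$, then for all $t\ge0$ $$\big\|e^{\mathcal Lt}-\mathrm{Tr}(\cdot)\,|\psi\rangle\langle\psi|\big\|_{1\to1}\le C\,N\,\mathfrak d_0\,e^{-\kappa t}.$$ (That is, the norm is at most $N\mathfrak d_0\exp(-\Theta(t))$.) -/

import Mathlib

noncomputable section

namespace ParentLindblad

open Matrix
open scoped Kronecker ComplexOrder

/-- Operator norm (largest singular value) of a square complex matrix. -/
def opNorm {n : Type*} [Fintype n] [DecidableEq n] (M : Matrix n n ℂ) : ℝ :=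
  ‖Matrix.toEuclideanCLM (n := n) (𝕜 := ℂ) M‖

/-- Trace norm `‖X‖₁ = Tr √(X† X)`: the sum of the square roots of the eigenvalues of `X† X`. -/
def traceNorm {n : Type*} [Fintype n] [DecidableEq n] (X : Matrix n n ℂ) : ℝ :=
  ∑ k, Real.sqrt ((Matrix.isHermitian_conjTranspose_mul_self X).eigenvalues k)

/-- Superoperators: linear maps on the operators on `ℂⁿ`. -/
abbrev Superop (n : Type*) := Matrix n n ℂ →ₗ[ℂ] Matrix n n ℂ

/-- Induced trace norm `‖E‖_{1→1} = sup {‖E(X)‖₁ : ‖X‖₁ = 1}`. -/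
def oneOneNorm {n : Type*} [Fintype n] [DecidableEq n] (E : Superop n) : ENNReal :=
  ⨆ (X : Matrix n n ℂ) (_ : traceNorm X = 1), ENNReal.ofReal (traceNorm (E X))

/-- The semigroup `e^{t L}` generated by a superoperator `L`: the matrix exponential, computed in
the basis of matrix units. -/
def expSuperop {n : Type*} [Fintype n] [DecidableEq n] (L : Superop n) (t : ℝ) : Superop n :=
  Matrix.toLin (Matrix.stdBasis ℂ n n) (Matrix.stdBasis ℂ n n)
    (NormedSpace.exp ((t : ℂ) •
      LinearMap.toMatrix (Matrix.stdBasis ℂ n n) (Matrix.stdBasis ℂ n n) L))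

/-- Half an anticommutator, `X ↦ ½ (M X + X M)`. -/
def halfAnticomm {n : Type*} [Fintype n] (M : Matrix n n ℂ) : Superop n where
  toFun X := (1 / 2 : ℂ) • (M * X + X * M)
  map_add' X Y := by
    rw [← smul_add, Matrix.mul_add, Matrix.add_mul]
    congr 1
    abel
  map_smul' c X := by
    simp [smul_add, smul_smul, mul_comm]

/-- Dissipator of a jump operator, `X ↦ L X L† - ½ {L† L, X}`. -/
def dissipator {n : Type*} [Fintype n] (L : Matrix n n ℂ) : Superop n :=
  { toFun := fun X => L * X * Lᴴ
    map_add' := fun X Y => by rw [Matrix.mul_add, Matrix.add_mul]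
    map_smul' := fun c X => by simp } - halfAnticomm (Lᴴ * L)

section Network

variable {N d D : ℕ} (G : SimpleGraph (Fin N)) [DecidableRel G.Adj]

/-- Edges `(i, j)` of the graph; every edge is listed once, with `i < j`. -/
abbrev Edge := {e : Fin N × Fin N // e.1 < e.2 ∧ G.Adj e.1 e.2}

variable {G}

/-- The end `j` of `e = (i, j)` as a neighbour of `i`. -/
def Edge.legFst (e : Edge G) : G.neighborSet e.1.1 := ⟨e.1.2, e.2.2⟩

/-- The end `i` of `e = (i, j)` as a neighbour of `j`. -/
def Edge.legSnd (e : Edge G) : G.neighborSet e.1.2 := ⟨e.1.1, e.2.2.symm⟩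

variable (D G) in
/-- Computational basis of the virtual space `(ℂᴰ)^{⊗ |𝒩 i|}` at the vertex `i`: one qudit for
each neighbour of `i`. -/
abbrev Legs (i : Fin N) := G.neighborSet i → Fin D

variable (N d) in
/-- Computational basis of the physical space `(ℂᵈ)^{⊗ N}`. -/
abbrev Config := Fin N → Fin d

variable (d D G) in
/-- The data of an injective PEPS and of its parent Lindbladian on the graph `G`. -/
structure InjectivePEPS where
  /-- the state `|φ₀⟩ ∈ ℂᴰ ⊗ ℂᴰ` placed on each edge `(i, j)`; the first factor sits at `i` -/
  phi₀ : Edge G → EuclideanSpace ℂ (Fin D × Fin D)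
  /-- the states `|φ_α⟩`, `α = 1, …, D² - 1`, which complete `|φ₀⟩` to an orthonormal basis -/
  phi : Edge G → Fin (D ^ 2 - 1) → EuclideanSpace ℂ (Fin D × Fin D)
  /-- the tensors `A_i : (ℂᴰ)^{⊗ |𝒩 i|} → ℂᵈ` -/
  A : ∀ i, Matrix (Fin d) (Legs D G i) ℂ
  phi₀_norm : ∀ e, ‖phi₀ e‖ = 1
  phi_orthonormal : ∀ e, Orthonormal ℂ (phi e)
  phi_orthogonal : ∀ e α, inner ℂ (phi₀ e) (phi e α) = 0
  A_injective : ∀ i, Function.Injective (A i).mulVec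

/-- `M` acting on site `i`, identity on the other sites. -/
def siteOp (i : Fin N) (M : Matrix (Fin d) (Fin d) ℂ) : Matrix (Config N d) (Config N d) ℂ :=
  Matrix.of fun s t => if ∀ k, k ≠ i → s k = t k then M (s i) (t i) else 0

/-- `M` acting on the sites `i ≠ j`, identity on the other sites. -/
def pairOp (i j : Fin N) (M : Matrix (Fin d × Fin d) (Fin d × Fin d) ℂ) :
    Matrix (Config N d) (Config N d) ℂ :=
  Matrix.of fun s t =>
    if ∀ k, k ≠ i → k ≠ j → s k = t k then M (s i, s j) (t i, t j) else 0

/-- The superoperator `X ↦ P ⊗ Tr_i (X)`, where `P` acts on the site `i`. -/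
def replaceSite (i : Fin N) (P : Matrix (Fin d) (Fin d) ℂ) : Superop (Config N d) where
  toFun X := Matrix.of fun s t =>
    P (s i) (t i) * ∑ k : Fin d, X (Function.update s i k) (Function.update t i k)
  map_add' X Y := by
    ext s t
    simp [Finset.sum_add_distrib, mul_add]
  map_smul' c X := by
    ext s t
    simp only [Matrix.of_apply, Matrix.smul_apply, smul_eq_mul, RingHom.id_apply,
      ← Finset.mul_sum]
    ring

namespace InjectivePEPS

variable (P : InjectivePEPS d D G)

/-- The pseudo-inverse `A_i⁻¹ = (A_i† A_i)⁻¹ A_i†` of the injective map `A_i`: it is a left inverse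
of `A_i` and vanishes on the orthogonal complement of the image of `A_i`. -/
def pinv (i : Fin N) : Matrix (Legs D G i) (Fin d) ℂ := ((P.A i)ᴴ * P.A i)⁻¹ * (P.A i)ᴴ

/-- Orthogonal projector `P_{S_i} = A_i A_i⁻¹` onto the image `S_i` of `A_i`. -/
def proj (i : Fin N) : Matrix (Fin d) (Fin d) ℂ := P.A i * P.pinv i

/-- The (not necessarily normalized) vector `(⊗_i A_i) ⊗_e |φ₀⟩_e`. -/
def psi : Config N d → ℂ := fun s =>
  ∑ x : (∀ i, Legs D G i),
    (∏ i, P.A i (s i) (x i)) * ∏ e : Edge G, P.phi₀ e (x e.1.1 e.legFst, x e.1.2 e.legSnd)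

/-- The target state: the projector onto the normalized PEPS, `|ψ⟩⟨ψ| / ⟨ψ|ψ⟩`. -/
def target : Matrix (Config N d) (Config N d) ℂ :=
  (star P.psi ⬝ᵥ P.psi)⁻¹ • Matrix.vecMulVec P.psi (star P.psi)

/-- `|φ₀⟩⟨φ_α|` on the two qudits of the edge `e = (i, j)`, identity on the remaining virtual
qudits at `i` and `j`. -/
def bondOp (e : Edge G) (α : Fin (D ^ 2 - 1)) :
    Matrix (Legs D G e.1.1 × Legs D G e.1.2) (Legs D G e.1.1 × Legs D G e.1.2) ℂ :=
  Matrix.of fun x y =>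
    if (∀ k, k ≠ e.legFst → x.1 k = y.1 k) ∧ (∀ k, k ≠ e.legSnd → x.2 k = y.2 k) then
      P.phi₀ e (x.1 e.legFst, x.2 e.legSnd) * star (P.phi e α (y.1 e.legFst, y.2 e.legSnd))
    else 0

/-- Jump operator `L_{α,e} = (A_i ⊗ A_j) |φ₀⟩⟨φ_α|_e (A_i⁻¹ ⊗ A_j⁻¹)` on the sites of
`e = (i, j)`. -/
def jump (e : Edge G) (α : Fin (D ^ 2 - 1)) : Matrix (Config N d) (Config N d) ℂ :=
  pairOp e.1.1 e.1.2
    ((P.A e.1.1 ⊗ₖ P.A e.1.2) * P.bondOp e α * (P.pinv e.1.1 ⊗ₖ P.pinv e.1.2))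

/-- `𝓛_e = ∑_α (L_{α,e} · L_{α,e}† - ½ {L_{α,e}† L_{α,e}, ·})`. -/
def edgeLindbladian (e : Edge G) : Superop (Config N d) :=
  ∑ α, dissipator (P.jump e α)

/-- `𝓛_i = dim(S_i)⁻¹ P_{S_i} Tr_i (P_{S_i}^⊥ ·) - ½ {P_{S_i}^⊥, ·}`; the dimension of the image of
`A_i` is the rank of `A_i`. -/
def siteLindbladian (i : Fin N) : Superop (Config N d) :=
  ((P.A i).rank : ℂ)⁻¹ •
      (replaceSite i (P.proj i) ∘ₗ LinearMap.mulLeft ℂ (siteOp i (1 - P.proj i)))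
    - halfAnticomm (siteOp i (1 - P.proj i))

/-- The parent Lindbladian `𝓛 = ∑_e 𝓛_e + ∑_i 𝓛_i`. -/
def lindbladian : Superop (Config N d) :=
  ∑ e, P.edgeLindbladian e + ∑ i, P.siteLindbladian i

/-- The superoperator `X ↦ Tr(X) |ψ⟩⟨ψ|`, with `ψ` normalized. -/
def resetToTarget : Superop (Config N d) :=
  (Matrix.traceLinearMap (Config N d) ℂ ℂ).smulRight P.target

end InjectivePEPS

end Network

end ParentLindblad

end

/-!
The proof is an energy argument in the Heisenberg picture.

Let `J k` be the jump operators of a Lindbladian `𝓛` with dual `𝓛†`, and let `K = ∑ k, (J k)† J k`.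
Suppose that an operator `H ≥ K` satisfies `𝓛† H ≤ -γ H` and `H ≤ M`, and that its kernel is spanned
by `ψ`. By Grönwall's inequality, `Tr (H e^{t𝓛} ρ) ≤ M e^{-γ t}` for every state `ρ`
(`re_trace_mul_expSuperop_le`). The decay also yields a spectral gap: an eigenvalue `μ ≠ 0` of `H`
satisfies `γ μ ≤ ⟨K⟩ μ ≤ μ²`, so `γ (1 - e) ≤ H` for the projection `e` onto `ψ`
(`smul_one_sub_le_of_decay`). Therefore `e^{t𝓛} ρ` has weight at most `(M / γ) e^{-γ t}`
outside `ψ`, which bounds its trace distance from the target by the square root of that weight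
(`norm_trace_sub_le`). Arbitrary operators reduce to states by the singular value decomposition and
polarization. This is convergence in the norm `‖·‖_{1→1}` with prefactor `√(M / γ)` and rate `γ / 2`
(`traceNorm_expSuperop_sub_le`).

For the parent Lindbladian, a polar decomposition `A_i = U_i s_i` turns the jumps of an edge into
`g |φ₀⟩⟨φ_α| g⁻¹`, where `g` is the product of the `s_i` at the two ends, moved to the range of
`U_i` and extended by the identity, so that `g² - 1` and `g⁻² - 1` have norm `O(δ)`. Without the
dressing `g`, the energy `h_e = ∑ α, L_{α,e}† L_{α,e}` of an edge is a projection with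
`𝓛_e† h_e = -h_e`, and it is not changed by the dissipators of other edges. With the dressing,
`𝓛_e† h_e ≤ -(1 - O(δ)) h_e`, and `𝓛_f† h_e ≤ O(δ) (h_e + h_f)` for two edges that meet
(`smul_dressedEnergy_le_sq`, `krausDual_dressed_sub_le`). An edge meets at most `2 𝔡₀` edges, so
for small `δ 𝔡₀` the sum of the `h_e` decays at a constant rate under the edge dissipators. The
dissipator of a vertex empties the complement of the range of `A_i` at unit rate and deposits
energy at most `2` on each of the at most `𝔡₀` adjacent edges, whereas the edge dissipators do not
see that complement. Hence `H = ∑ e, h_e + 4 𝔡₀ ∑ i, P_{S_i}^⊥` decays at rate `1 / 2`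
(`DressedNetwork.dualGenerator_energy_le`), and `H = O(N 𝔡₀)`.

A vector in the kernel of `H` is of the form `(⨂ A_i) x`, where `x` is orthogonal to every `φ_α` on
every edge, and is hence proportional to `⨂ φ₀` (`InjectivePEPS.exists_eq_smul_psi`).
-/

noncomputable section

namespace ParentLindblad


/-! ### Kraus sums in a C*-algebra -/

section CStar

variable {𝒜 ι κ : Type*} [CStarAlgebra 𝒜] [Fintype ι] [Fintype κ]

/-- The Heisenberg-picture Kraus sum `x ↦ ∑ α, w α† x w α`. -/
def krausDual (w : ι → 𝒜) (x : 𝒜) : 𝒜 := ∑ α, star (w α) * x * w α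

lemma krausDual_add (w : ι → 𝒜) (x y : 𝒜) :
    krausDual w (x + y) = krausDual w x + krausDual w y := by
  simp [krausDual, mul_add, add_mul, Finset.sum_add_distrib]

lemma krausDual_sub (w : ι → 𝒜) (x y : 𝒜) :
    krausDual w (x - y) = krausDual w x - krausDual w y := by
  simp [krausDual, mul_sub, sub_mul, Finset.sum_sub_distrib]

lemma krausDual_smul (w : ι → 𝒜) (r : ℝ) (x : 𝒜) :
    krausDual w (r • x) = r • krausDual w x := by
  simp [krausDual, Finset.smul_sum]

lemma krausDual_sum {σ : Type*} (w : ι → 𝒜) (s : Finset σ) (x : σ → 𝒜) :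
    krausDual w (∑ i ∈ s, x i) = ∑ i ∈ s, krausDual w (x i) := by
  simp only [krausDual, Finset.mul_sum, Finset.sum_mul]
  exact Finset.sum_comm

lemma star_krausDual (w : ι → 𝒜) (x : 𝒜) : star (krausDual w x) = krausDual w (star x) := by
  simp [krausDual, mul_assoc]

lemma krausDual_mul_of_commute (w : ι → 𝒜) {x y : 𝒜} (h : ∀ α, Commute y (w α)) :
    krausDual w (x * y) = krausDual w x * y := by
  simp only [krausDual, Finset.sum_mul]
  refine Finset.sum_congr rfl fun α _ => ?_
  simp only [mul_assoc, (h α).eq]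

lemma krausDual_mul_of_commute_left (w : ι → 𝒜) {x y : 𝒜} (h : ∀ α, Commute y (star (w α))) :
    krausDual w (y * x) = y * krausDual w x := by
  simp only [krausDual, Finset.mul_sum]
  refine Finset.sum_congr rfl fun α _ => ?_
  simp only [← mul_assoc, (h α).eq]

variable [PartialOrder 𝒜] [StarOrderedRing 𝒜]

lemma krausDual_mono (w : ι → 𝒜) {x y : 𝒜} (h : x ≤ y) : krausDual w x ≤ krausDual w y :=
  Finset.sum_le_sum fun α _ => star_left_conjugate_le_conjugate h (w α)

lemma krausDual_nonneg (w : ι → 𝒜) {x : 𝒜} (h : 0 ≤ x) : 0 ≤ krausDual w x :=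
  Finset.sum_nonneg fun α _ => star_left_conjugate_nonneg h (w α)

lemma krausDual_one_isSelfAdjoint (w : ι → 𝒜) : IsSelfAdjoint (krausDual w 1) :=
  (krausDual_nonneg w zero_le_one).isSelfAdjoint

lemma norm_le_of_neg_le_of_le {y : 𝒜} {r : ℝ}
    (h1 : -algebraMap ℝ 𝒜 r ≤ y) (h2 : y ≤ algebraMap ℝ 𝒜 r) (hr : 0 ≤ r) : ‖y‖ ≤ r := by
  rcases subsingleton_or_nontrivial 𝒜 with h | h
  · rw [Subsingleton.elim y 0]; simpa using hr
  have hy : IsSelfAdjoint y := by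
    have : IsSelfAdjoint (algebraMap ℝ 𝒜 r - y) := (sub_nonneg.2 h2).isSelfAdjoint
    have h3 : IsSelfAdjoint (algebraMap ℝ 𝒜 r) :=
      IsSelfAdjoint.algebraMap 𝒜 (by simp [IsSelfAdjoint])
    simpa using h3.sub this
  rw [← map_neg] at h1
  rw [algebraMap_le_iff_le_spectrum hy] at h1
  rw [le_algebraMap_iff_spectrum_le hy] at h2
  rcases CStarAlgebra.norm_or_neg_norm_mem_spectrum hy with h | h
  · exact h2 _ h
  · linarith [h1 _ h]

/-- A subunital completely positive map is a contraction on selfadjoint elements. -/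
lemma norm_krausDual_le (w : ι → 𝒜) (hw : krausDual w 1 ≤ 1) {x : 𝒜} (hx : IsSelfAdjoint x) :
    ‖krausDual w x‖ ≤ ‖x‖ := by
  have key : krausDual w (algebraMap ℝ 𝒜 ‖x‖) ≤ algebraMap ℝ 𝒜 ‖x‖ := by
    rw [Algebra.algebraMap_eq_smul_one, krausDual_smul]
    exact smul_le_smul_of_nonneg_left hw (norm_nonneg x)
  refine norm_le_of_neg_le_of_le ?_ ?_ (norm_nonneg _)
  · refine (neg_le_neg key).trans ?_
    have := krausDual_mono w hx.neg_algebraMap_norm_le_self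
    simpa [krausDual] using this
  · exact (krausDual_mono w hx.le_algebraMap_norm_self).trans key

/-- Operator version of `2 |⟨x, m y⟩| ≤ r (‖x‖² + ‖y‖²)` for `‖m‖ ≤ r`. -/
lemma star_mul_mul_add_le {p q m : 𝒜} {r : ℝ} (hr : 0 < r) (hm : ‖m‖ ≤ r) :
    star p * m * q + star q * star m * p ≤ r • (star p * p + star q * q) := by
  have h1 : 0 ≤ star (r • p - m * q) * (r • p - m * q) := star_mul_self_nonneg _
  have h2 : 0 ≤ star q * ((r ^ 2) • (1 : 𝒜) - star m * m) * q := by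
    refine star_left_conjugate_nonneg (sub_nonneg.2 ?_) q
    refine CStarAlgebra.star_mul_le_algebraMap_norm_sq.trans ?_
    rw [← Algebra.algebraMap_eq_smul_one]
    exact algebraMap_mono 𝒜 (by gcongr)
  have h3 := smul_nonneg (inv_nonneg.2 hr.le) (add_nonneg h1 h2)
  rw [← sub_nonneg]
  convert h3 using 1
  have : r⁻¹ * r = 1 := inv_mul_cancel₀ hr.ne'
  have h4 : r⁻¹ * r ^ 2 = r := by field_simp
  simp only [star_sub, star_mul, star_smul, star_trivial, mul_sub, sub_mul, smul_add, smul_sub,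
    smul_mul_assoc, mul_smul_comm, smul_smul, mul_one, this, one_smul, ← mul_assoc, ← pow_two, h4]
  abel

lemma le_norm_smul_one {x : 𝒜} (hx : IsSelfAdjoint x) {r : ℝ} (h : ‖x‖ ≤ r) :
    x ≤ r • (1 : 𝒜) := by
  rw [← Algebra.algebraMap_eq_smul_one]
  exact hx.le_algebraMap_norm_self.trans (algebraMap_mono 𝒜 h)

/-! ### Dressed jump operators -/

/-- The algebraic properties of the family `|φ₀⟩⟨φ_α|`, `α ≠ 0`: products vanish because
`⟨φ_α|φ₀⟩ = 0`, and `∑ α, w α† w α` acts as a right unit. -/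
structure IsBondKraus (w : ι → 𝒜) : Prop where
  mul_eq_zero : ∀ α β, w α * w β = 0
  mul_proj : ∀ α, w α * krausDual w 1 = w α

namespace IsBondKraus

variable {w : ι → 𝒜} (hw : IsBondKraus w)
include hw

omit [PartialOrder 𝒜] [StarOrderedRing 𝒜] in
lemma krausDual_mul_proj (x : 𝒜) : krausDual w x * krausDual w 1 = krausDual w x := by
  conv_lhs => rw [krausDual]
  rw [Finset.sum_mul]
  exact Finset.sum_congr rfl fun α _ => by rw [mul_assoc, hw.mul_proj]

omit [PartialOrder 𝒜] [StarOrderedRing 𝒜] in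
lemma proj_mul_krausDual (x : 𝒜) : krausDual w 1 * krausDual w x = krausDual w x := by
  have h := congrArg star (hw.krausDual_mul_proj (star x))
  rw [star_mul, star_krausDual, star_krausDual, star_star, star_one] at h
  exact h

lemma proj_le_one : krausDual w 1 ≤ 1 := by
  have h : 0 ≤ star (1 - krausDual w 1) * (1 - krausDual w 1) := star_mul_self_nonneg _
  rw [star_sub, star_one, (krausDual_one_isSelfAdjoint w).star_eq] at h
  simp only [mul_sub, sub_mul, one_mul, mul_one, hw.krausDual_mul_proj, sub_self, sub_zero] at h
  exact sub_nonneg.1 h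

lemma norm_proj_le : ‖krausDual w 1‖ ≤ 1 :=
  (CStarAlgebra.norm_le_one_iff_of_nonneg _ (krausDual_nonneg w zero_le_one)).2 hw.proj_le_one

lemma norm_krausDual_sub_le {x : 𝒜} (hx : IsSelfAdjoint x) :
    ‖krausDual w x - krausDual w 1‖ ≤ ‖x - 1‖ := by
  rw [← krausDual_sub]
  exact norm_krausDual_le w hw.proj_le_one (hx.sub (.one 𝒜))

lemma norm_krausDual_le' {x : 𝒜} (hx : IsSelfAdjoint x) {ε : ℝ} (h : ‖x - 1‖ ≤ ε) :
    ‖krausDual w x‖ ≤ 1 + ε := by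
  have h1 := hw.norm_krausDual_sub_le hx
  have h2 := hw.norm_proj_le
  calc ‖krausDual w x‖ = ‖krausDual w 1 + (krausDual w x - krausDual w 1)‖ := by congr 1; abel
    _ ≤ _ := (norm_add_le _ _).trans (by linarith)

/-- Compression by the projection `n = ∑ α, w α† w α` turns a norm bound into an order bound. -/
lemma le_smul_proj {x : 𝒜} (hx : IsSelfAdjoint x) {r : ℝ} (h : ‖x‖ ≤ r)
    (hn : krausDual w 1 * x * krausDual w 1 = x) : x ≤ r • krausDual w 1 := by
  have := star_left_conjugate_le_conjugate (le_norm_smul_one hx h) (krausDual w 1)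
  rw [(krausDual_one_isSelfAdjoint w).star_eq, hn] at this
  simpa [hw.krausDual_mul_proj] using this

lemma neg_smul_proj_le {x : 𝒜} (hx : IsSelfAdjoint x) {r : ℝ} (h : ‖x‖ ≤ r)
    (hn : krausDual w 1 * x * krausDual w 1 = x) : -(r • krausDual w 1) ≤ x :=
  neg_le.1 (hw.le_smul_proj hx.neg (by simpa using h) (by simpa using hn))

end IsBondKraus

/-- A selfadjoint invertible element `g` with inverse `z`, such that the squares of both are
within `ε` of `1`. -/
structure IsDressing (g z : 𝒜) (ε : ℝ) : Prop where
  isSelfAdjoint_fst : IsSelfAdjoint g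
  isSelfAdjoint_snd : IsSelfAdjoint z
  mul_eq_one : g * z = 1
  mul_eq_one' : z * g = 1
  norm_fst : ‖g * g - 1‖ ≤ ε
  norm_snd : ‖z * z - 1‖ ≤ ε

/-- The energy `∑ α, L α† L α` of the dressed jump operators `L α = g (w α) z`. -/
def dressedEnergy (g z : 𝒜) (w : ι → 𝒜) : 𝒜 := krausDual (fun α => g * w α * z) 1

variable {g z : 𝒜} {ε : ℝ} (hg : IsDressing g z ε) {w : ι → 𝒜} (hw : IsBondKraus w)

omit [PartialOrder 𝒜] [StarOrderedRing 𝒜] in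
include hg in
lemma krausDual_dressed (w : ι → 𝒜) (x : 𝒜) :
    krausDual (fun α => g * w α * z) x = z * krausDual w (g * x * g) * z := by
  simp only [krausDual, star_mul, hg.isSelfAdjoint_fst.star_eq, hg.isSelfAdjoint_snd.star_eq,
    Finset.mul_sum, Finset.sum_mul, mul_assoc]

omit [PartialOrder 𝒜] [StarOrderedRing 𝒜] in
include hg in
lemma dressedEnergy_eq (w : ι → 𝒜) : dressedEnergy g z w = z * krausDual w (g * g) * z := by
  rw [dressedEnergy, krausDual_dressed hg, mul_one]

omit [PartialOrder 𝒜] [StarOrderedRing 𝒜] in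
include hg in
lemma IsDressing.isSelfAdjoint_sq : IsSelfAdjoint (g * g) := by
  simp [IsSelfAdjoint, hg.isSelfAdjoint_fst.star_eq]

include hg in
lemma IsDressing.conj_mono {x y : 𝒜} (h : x ≤ y) : z * x * z ≤ z * y * z := by
  have := star_left_conjugate_le_conjugate h z
  rwa [hg.isSelfAdjoint_snd.star_eq] at this

omit [PartialOrder 𝒜] [StarOrderedRing 𝒜] in
include hg in
lemma IsDressing.norm_sq_le : ‖z * z‖ ≤ 1 + ε := by
  rcases subsingleton_or_nontrivial 𝒜 with h | h
  · rw [Subsingleton.elim (z * z) 0, norm_zero]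
    linarith [(norm_nonneg _).trans hg.norm_fst]
  calc ‖z * z‖ = ‖1 + (z * z - 1)‖ := by congr 1; abel
    _ ≤ ‖(1 : 𝒜)‖ + ‖z * z - 1‖ := norm_add_le _ _
    _ ≤ 1 + ε := by rw [norm_one]; linarith [hg.norm_snd]

include hg hw

lemma smul_conj_proj_le_dressedEnergy :
    (1 - ε) • (z * krausDual w 1 * z) ≤ dressedEnergy g z w := by
  have h := hw.neg_smul_proj_le (x := krausDual w (g * g) - krausDual w 1) (r := ε)
    (by
      rw [← krausDual_sub, IsSelfAdjoint, star_krausDual, star_sub, star_one,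
        hg.isSelfAdjoint_sq.star_eq])
    ((hw.norm_krausDual_sub_le hg.isSelfAdjoint_sq).trans hg.norm_fst)
    (by rw [← krausDual_sub, hw.proj_mul_krausDual, hw.krausDual_mul_proj])
  rw [dressedEnergy_eq hg]
  have h2 : (1 - ε) • krausDual w 1 ≤ krausDual w (g * g) := by
    rw [sub_smul, one_smul]
    calc krausDual w 1 - ε • krausDual w 1
        = krausDual w 1 + -(ε • krausDual w 1) := sub_eq_add_neg _ _
      _ ≤ krausDual w 1 + (krausDual w (g * g) - krausDual w 1) := by gcongr
      _ = _ := by abel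
  simpa using hg.conj_mono h2

lemma dressedEnergy_le_smul_conj_proj :
    dressedEnergy g z w ≤ (1 + ε) • (z * krausDual w 1 * z) := by
  have h := hw.le_smul_proj (x := krausDual w (g * g) - krausDual w 1) (r := ε)
    (by
      rw [← krausDual_sub, IsSelfAdjoint, star_krausDual, star_sub, star_one,
        hg.isSelfAdjoint_sq.star_eq])
    ((hw.norm_krausDual_sub_le hg.isSelfAdjoint_sq).trans hg.norm_fst)
    (by rw [← krausDual_sub, hw.proj_mul_krausDual, hw.krausDual_mul_proj])
  rw [dressedEnergy_eq hg]
  have h2 : krausDual w (g * g) ≤ (1 + ε) • krausDual w 1 := by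
    rw [add_smul, one_smul]
    exact sub_le_iff_le_add'.1 h
  simpa using hg.conj_mono h2

lemma dressedEnergy_le_two (hε : ε ≤ 1 / 4) : dressedEnergy g z w ≤ (2 : ℝ) • (1 : 𝒜) := by
  have hε0 : 0 ≤ ε := (norm_nonneg _).trans hg.norm_fst
  calc dressedEnergy g z w ≤ (1 + ε) • (z * krausDual w 1 * z) :=
        dressedEnergy_le_smul_conj_proj hg hw
    _ ≤ (1 + ε) • (z * 1 * z) :=
        smul_le_smul_of_nonneg_left (hg.conj_mono hw.proj_le_one) (by linarith)
    _ ≤ (1 + ε) • ((1 + ε) • (1 : 𝒜)) := by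
        refine smul_le_smul_of_nonneg_left ?_ (by linarith)
        rw [mul_one]
        refine le_norm_smul_one ?_ hg.norm_sq_le
        simp [IsSelfAdjoint, hg.isSelfAdjoint_snd.star_eq]
    _ = ((1 + ε) * (1 + ε)) • (1 : 𝒜) := smul_smul _ _ _
    _ ≤ (2 : ℝ) • (1 : 𝒜) := smul_le_smul_of_nonneg_right (by nlinarith) zero_le_one

lemma norm_mul_sq_mul_sub_le {v : κ → 𝒜} (hv : IsBondKraus v) (hε : ε ≤ 1 / 8) :
    ‖krausDual w (g * g) * (z * z) * krausDual v (g * g) - krausDual w 1 * krausDual v 1‖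
      ≤ (7 / 2) * ε := by
  have hε0 : 0 ≤ ε := (norm_nonneg _).trans hg.norm_fst
  have e : krausDual w (g * g) * (z * z) * krausDual v (g * g) - krausDual w 1 * krausDual v 1
      = (krausDual w (g * g) - krausDual w 1) * (z * z) * krausDual v (g * g)
        + krausDual w 1 * (z * z - 1) * krausDual v (g * g)
        + krausDual w 1 * (krausDual v (g * g) - krausDual v 1) := by
    noncomm_ring
  have b1 := (hw.norm_krausDual_sub_le hg.isSelfAdjoint_sq).trans hg.norm_fst
  have b2 := (hv.norm_krausDual_sub_le hg.isSelfAdjoint_sq).trans hg.norm_fst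
  have b3 := hv.norm_krausDual_le' hg.isSelfAdjoint_sq hg.norm_fst
  have c1 : ‖(krausDual w (g * g) - krausDual w 1) * (z * z) * krausDual v (g * g)‖
      ≤ ε * (1 + ε) * (1 + ε) := by
    refine (norm_mul_le _ _).trans
      (mul_le_mul ((norm_mul_le _ _).trans ?_) b3 (norm_nonneg _) (by positivity))
    exact mul_le_mul b1 hg.norm_sq_le (norm_nonneg _) hε0
  have c2 : ‖krausDual w 1 * (z * z - 1) * krausDual v (g * g)‖ ≤ 1 * ε * (1 + ε) := by
    refine (norm_mul_le _ _).trans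
      (mul_le_mul ((norm_mul_le _ _).trans ?_) b3 (norm_nonneg _) (by positivity))
    exact mul_le_mul hw.norm_proj_le hg.norm_snd (norm_nonneg _) zero_le_one
  have c3 : ‖krausDual w 1 * (krausDual v (g * g) - krausDual v 1)‖ ≤ 1 * ε :=
    (norm_mul_le _ _).trans (mul_le_mul hw.norm_proj_le b2 (norm_nonneg _) zero_le_one)
  rw [e]
  refine (norm_add₃_le).trans ?_
  nlinarith [mul_nonneg hε0 hε0, mul_nonneg hε0 (mul_nonneg hε0 hε0)]

/-- The square of a dressed energy dominates almost the energy itself: without dressing it is a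
projection. -/
lemma smul_dressedEnergy_le_sq (hε : ε ≤ 1 / 8) :
    (1 - 5 * ε) • dressedEnergy g z w ≤ dressedEnergy g z w * dressedEnergy g z w := by
  have hε0 : 0 ≤ ε := (norm_nonneg _).trans hg.norm_fst
  have hh : dressedEnergy g z w * dressedEnergy g z w
      = z * (krausDual w (g * g) * (z * z) * krausDual w (g * g)) * z := by
    rw [dressedEnergy_eq hg]; noncomm_ring
  have hX : star (krausDual w (g * g)) = krausDual w (g * g) := by
    rw [star_krausDual, hg.isSelfAdjoint_sq.star_eq]
  have hn : krausDual w 1 * krausDual w 1 = krausDual w 1 := hw.krausDual_mul_proj 1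
  have h := hw.neg_smul_proj_le
    (x := krausDual w (g * g) * (z * z) * krausDual w (g * g) - krausDual w 1 * krausDual w 1)
    (r := (7 / 2) * ε)
    (by
      rw [hn]
      refine IsSelfAdjoint.sub ?_ (krausDual_one_isSelfAdjoint w)
      simp only [IsSelfAdjoint, star_mul, hX, hg.isSelfAdjoint_snd.star_eq, mul_assoc])
    (norm_mul_sq_mul_sub_le hg hw hw hε)
    (by
      rw [hn, mul_sub, sub_mul, hn, hn, ← mul_assoc, ← mul_assoc, hw.proj_mul_krausDual,
        mul_assoc _ _ (krausDual w 1), hw.krausDual_mul_proj])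
  rw [hn] at h
  have h2 : (1 - (7 / 2) * ε) • krausDual w 1
      ≤ krausDual w (g * g) * (z * z) * krausDual w (g * g) := by
    rw [sub_smul, one_smul]
    exact sub_le_iff_le_add.2 ((neg_le_sub_iff_le_add.1 h))
  have h3 := hg.conj_mono h2
  rw [← hh] at h3
  rcases le_or_gt (1 - 5 * ε) 0 with h0 | h0
  · refine le_trans (b := 0) ?_ (le_trans ?_ h3)
    · exact smul_nonpos_of_nonpos_of_nonneg h0 (krausDual_nonneg _ zero_le_one)
    · have := hg.conj_mono (krausDual_nonneg w zero_le_one)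
      simp only [mul_zero, zero_mul] at this
      rw [mul_smul_comm, smul_mul_assoc]
      exact smul_nonneg (by linarith) this
  · calc (1 - 5 * ε) • dressedEnergy g z w
        ≤ (1 - 5 * ε) • ((1 + ε) • (z * krausDual w 1 * z)) :=
          smul_le_smul_of_nonneg_left (dressedEnergy_le_smul_conj_proj hg hw) h0.le
      _ = ((1 - 5 * ε) * (1 + ε)) • (z * krausDual w 1 * z) := smul_smul _ _ _
      _ ≤ (1 - (7 / 2) * ε) • (z * krausDual w 1 * z) := by
          refine smul_le_smul_of_nonneg_right (by nlinarith [mul_nonneg hε0 hε0]) ?_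
          simpa using hg.conj_mono (krausDual_nonneg w zero_le_one)
      _ ≤ _ := by simpa using h3

omit [PartialOrder 𝒜] [StarOrderedRing 𝒜] in
lemma krausDual_dressed_self : krausDual (fun α => g * w α * z) (dressedEnergy g z w) = 0 := by
  rw [krausDual_dressed hg, dressedEnergy_eq hg]
  have : g * (z * krausDual w (g * g) * z) * g = krausDual w (g * g) := by
    calc g * (z * krausDual w (g * g) * z) * g = (g * z) * krausDual w (g * g) * (z * g) := by
          noncomm_ring
      _ = _ := by rw [hg.mul_eq_one, hg.mul_eq_one', one_mul, mul_one]
  rw [this]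
  have h0 : krausDual w (krausDual w (g * g)) = 0 := by
    rw [krausDual]
    refine Finset.sum_eq_zero fun β _ => ?_
    rw [krausDual, mul_assoc, Finset.sum_mul]
    rw [Finset.sum_eq_zero, mul_zero]
    intro α _
    rw [mul_assoc, hw.mul_eq_zero, mul_zero]
  rw [h0, mul_zero, zero_mul]

/-- Two families of dressed jumps whose bare jumps commute: the action of one dissipator on the
energy of the other is of the order of the dressing.  Without dressing it vanishes, since then
the energies are commuting projections. -/
lemma krausDual_dressed_sub_le {v : κ → 𝒜} (hv : IsBondKraus v)
    (hc : ∀ α β, Commute (w α) (v β)) (hc' : ∀ α β, Commute (w α) (star (v β)))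
    (hε : ε ≤ 1 / 8) :
    krausDual (fun β => g * v β * z) (dressedEnergy g z w)
      - (1 / 2 : ℝ) • (dressedEnergy g z v * dressedEnergy g z w
          + dressedEnergy g z w * dressedEnergy g z v)
      ≤ (4 * ε) • (dressedEnergy g z w + dressedEnergy g z v) := by
  have hε0 : 0 ≤ ε := (norm_nonneg _).trans hg.norm_fst
  have hnc : ∀ β, Commute (krausDual w 1) (v β) := fun β => by
    refine Commute.sum_left _ _ _ fun α _ => ?_
    refine Commute.mul_left (Commute.mul_left ?_ (.one_left _)) (hc α β)
    simpa using (hc' α β).star_star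
  have hnc' : ∀ β, Commute (krausDual w 1) (star (v β)) := fun β => by
    simpa [(krausDual_one_isSelfAdjoint w).star_eq] using (hnc β).star_star
  set X := krausDual w (g * g) with hXdef
  set Y := krausDual v (g * g) with hYdef
  set n := krausDual w 1 with hn
  set m := krausDual v 1 with hm
  have hns : star n = n := (krausDual_one_isSelfAdjoint w).star_eq
  have hms : star m = m := (krausDual_one_isSelfAdjoint v).star_eq
  have hXs : star X = X := by rw [star_krausDual, hg.isSelfAdjoint_sq.star_eq]
  have hYs : star Y = Y := by rw [star_krausDual, hg.isSelfAdjoint_sq.star_eq]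
  have hZs : star (krausDual v X) = krausDual v X := by rw [star_krausDual, hXs]
  have e1 : krausDual (fun β => g * v β * z) (dressedEnergy g z w) = z * krausDual v X * z := by
    rw [krausDual_dressed hg, dressedEnergy_eq hg]
    congr 3
    calc g * (z * X * z) * g = (g * z) * X * (z * g) := by noncomm_ring
      _ = _ := by rw [hg.mul_eq_one, hg.mul_eq_one', one_mul, mul_one]
  have hnm : krausDual v n = n * m := by
    have := krausDual_mul_of_commute_left v (x := 1) hnc'
    rwa [mul_one] at this
  -- The deviation `R` from commuting projections.
  set R := krausDual v X - X * (z * z) * Y with hR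
  have hRn : ‖R‖ ≤ 5 * ε := by
    have : R = krausDual v (X - n) - (X * (z * z) * Y - n * m) := by
      rw [krausDual_sub, hnm]; simp only [hR]; abel
    rw [this]
    have b1 : ‖krausDual v (X - n)‖ ≤ ε := by
      refine (norm_krausDual_le v hv.proj_le_one ?_).trans ?_
      · simp [IsSelfAdjoint, hXs, hns]
      · exact (hw.norm_krausDual_sub_le hg.isSelfAdjoint_sq).trans hg.norm_fst
    have b2 := norm_mul_sq_mul_sub_le hg hw hv hε
    exact (norm_sub_le _ _).trans (by linarith)
  have hRc : n * R * m = R := by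
    simp only [hR, mul_sub, sub_mul]
    congr 1
    · rw [← krausDual_mul_of_commute_left v hnc', hw.proj_mul_krausDual, hv.krausDual_mul_proj]
    · rw [← mul_assoc, ← mul_assoc, hw.proj_mul_krausDual, mul_assoc _ Y, hv.krausDual_mul_proj]
  have hmain : R + star R ≤ (5 * ε) • (n + m) := by
    rcases hε0.eq_or_lt with h0 | h0
    · have : R = 0 := norm_le_zero_iff.1 (by simpa [← h0] using hRn)
      simp [this, ← h0]
    · have := star_mul_mul_add_le (p := n) (q := m) (by linarith : 0 < 5 * ε) hRn
      rw [hns, hms, hRc] at this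
      have h2 : m * star R * n = star R := by
        conv_rhs => rw [← hRc]
        simp [hns, hms, mul_assoc]
      rw [h2] at this
      have hnn : n * n = n := hw.krausDual_mul_proj 1
      have hmm : m * m = m := hv.krausDual_mul_proj 1
      rwa [hnn, hmm] at this
  have hconj := hg.conj_mono hmain
  have bw := smul_conj_proj_le_dressedEnergy hg hw
  have bv := smul_conj_proj_le_dressedEnergy hg hv
  have lhs : krausDual (fun β => g * v β * z) (dressedEnergy g z w)
      - (1 / 2 : ℝ) • (dressedEnergy g z v * dressedEnergy g z w
          + dressedEnergy g z w * dressedEnergy g z v)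
      = (1 / 2 : ℝ) • (z * (R + star R) * z) := by
    have hRs : star R = krausDual v X - Y * (z * z) * X := by
      simp [hR, hZs, hXs, hYs, hg.isSelfAdjoint_snd.star_eq, mul_assoc]
    rw [e1, dressedEnergy_eq hg, dressedEnergy_eq hg, hRs, hR, ← hXdef, ← hYdef]
    have : z * (krausDual v X - X * (z * z) * Y + (krausDual v X - Y * (z * z) * X)) * z
        = (2 : ℝ) • (z * krausDual v X * z)
          - (z * Y * z * (z * X * z) + z * X * z * (z * Y * z)) := by
      rw [two_smul]; noncomm_ring
    rw [this, smul_sub, smul_smul]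
    norm_num
  rw [lhs]
  have hs : ∀ {r s : ℝ} {a b : 𝒜}, 0 ≤ a → (7 / 8 : ℝ) • a ≤ b → r * (8 / 7) ≤ s → 0 ≤ r →
      r • a ≤ s • b := by
    intro r s a b ha hab hrs hr
    calc r • a = (r * (8 / 7)) • ((7 / 8 : ℝ) • a) := by rw [smul_smul]; congr 1; ring
      _ ≤ (r * (8 / 7)) • b := smul_le_smul_of_nonneg_left hab (by positivity)
      _ ≤ s • b := by
        refine smul_le_smul_of_nonneg_right hrs (le_trans ?_ hab)
        exact smul_nonneg (by norm_num) ha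
  have hzn : 0 ≤ z * n * z := by simpa using hg.conj_mono (krausDual_nonneg w zero_le_one)
  have hzm : 0 ≤ z * m * z := by simpa using hg.conj_mono (krausDual_nonneg v zero_le_one)
  calc (1 / 2 : ℝ) • (z * (R + star R) * z)
      ≤ (1 / 2 : ℝ) • (z * ((5 * ε) • (n + m)) * z) := by gcongr
    _ = (5 / 2 * ε) • (z * n * z) + (5 / 2 * ε) • (z * m * z) := by
        rw [mul_smul_comm, smul_mul_assoc, smul_smul, mul_add, add_mul, smul_add]
        congr 2 <;> ring
    _ ≤ (4 * ε) • dressedEnergy g z w + (4 * ε) • dressedEnergy g z v := by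
        refine add_le_add (hs hzn (le_trans ?_ bw) (by linarith) (by positivity))
          (hs hzm (le_trans ?_ bv) (by linarith) (by positivity))
        · exact smul_le_smul_of_nonneg_right (by linarith) hzn
        · exact smul_le_smul_of_nonneg_right (by linarith) hzm
    _ = _ := (smul_add _ _ _).symm

end CStar

open Filter Topology

/-! ### A product formula for the exponential -/

section Exponential

lemma norm_pow_sub_pow_le_of_norm_le {𝔸 : Type*} [NormedRing 𝔸] {a b : 𝔸} {K : ℝ} (hK : 1 ≤ K)
    (ha : ‖a‖ ≤ K) (hb : ‖b‖ ≤ K) (n : ℕ) : ‖a ^ n - b ^ n‖ ≤ n * K ^ n * ‖a - b‖ := by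
  have hK0 : 0 ≤ K := zero_le_one.trans hK
  induction n with
  | zero => simp
  | succ n ih =>
    rcases n.eq_zero_or_pos with rfl | hn
    · simpa using le_mul_of_one_le_left (norm_nonneg _) hK
    have e : a ^ (n + 1) - b ^ (n + 1) = a ^ n * (a - b) + (a ^ n - b ^ n) * b := by
      rw [pow_succ, pow_succ]; noncomm_ring
    have h1 : ‖a ^ n * (a - b)‖ ≤ K ^ (n + 1) * ‖a - b‖ := by
      refine (norm_mul_le _ _).trans (mul_le_mul_of_nonneg_right ?_ (norm_nonneg _))
      refine ((norm_pow_le' a hn).trans (pow_le_pow_left₀ (norm_nonneg _) ha n)).trans ?_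
      exact pow_le_pow_right₀ hK n.le_succ
    have h2 : ‖(a ^ n - b ^ n) * b‖ ≤ n * K ^ (n + 1) * ‖a - b‖ := by
      refine (norm_mul_le _ _).trans ((mul_le_mul ih hb (norm_nonneg _) (by positivity)).trans
        (le_of_eq ?_))
      rw [pow_succ]; ring
    rw [e]
    refine (norm_add_le _ _).trans ((add_le_add h1 h2).trans (le_of_eq ?_))
    push_cast; ring

/-- Euler's product formula, with a second-order error in each factor. -/
lemma tendsto_one_add_pow_exp {𝔸 : Type*} [NormedRing 𝔸] [NormOneClass 𝔸] [NormedAlgebra ℝ 𝔸]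
    [CompleteSpace 𝔸] (x y : 𝔸) :
    Tendsto (fun n : ℕ => (1 + (n : ℝ)⁻¹ • x + ((n : ℝ)⁻¹) ^ 2 • y) ^ n) atTop
      (𝓝 (NormedSpace.exp x)) := by
  set g : ℝ → 𝔸 := fun s => (1 + s • x + s ^ 2 • y) - NormedSpace.exp (s • x) with hg
  have hd : HasDerivAt g 0 0 := by
    have h1 : HasDerivAt (fun s : ℝ => NormedSpace.exp (s • x)) x 0 := by
      simpa using hasDerivAt_exp_smul_const x (0 : ℝ)
    have h2 : HasDerivAt (fun s : ℝ => 1 + s • x + s ^ 2 • y) x 0 := by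
      have := (((hasDerivAt_id (0 : ℝ)).smul_const x).const_add 1).add
        (((hasDerivAt_id (0 : ℝ)).pow 2).smul_const y)
      simp only [id, one_smul, Nat.cast_ofNat, Nat.add_one_sub_one, pow_one, mul_zero, zero_mul,
        zero_smul, add_zero] at this
      exact this
    have h3 := h2.sub h1
    rw [sub_self] at h3
    exact h3
  have hslope : Tendsto (fun n : ℕ => (n : ℝ) • g ((n : ℝ)⁻¹)) atTop (𝓝 0) := by
    have h := hasDerivAt_iff_tendsto_slope_zero.1 hd
    have h2 : Tendsto (fun n : ℕ => ((n : ℝ)⁻¹)) atTop (𝓝[≠] 0) := by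
      refine tendsto_nhdsWithin_iff.2 ⟨tendsto_inv_atTop_nhds_zero_nat, ?_⟩
      filter_upwards [eventually_gt_atTop 0] with n hn
      simp [hn.ne']
    have h3 := h.comp h2
    refine h3.congr fun n => ?_
    simp [hg]
  rw [tendsto_iff_norm_sub_tendsto_zero]
  set c := ‖x‖ + ‖y‖ + 1 with hc
  have hb : Tendsto (fun n : ℕ => Real.exp c * ‖(n : ℝ) • g ((n : ℝ)⁻¹)‖) atTop (𝓝 0) := by
    simpa using hslope.norm.const_mul (Real.exp c)
  refine squeeze_zero' (Eventually.of_forall fun _ => norm_nonneg _) ?_ hb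
  have hs1 : ∀ᶠ n : ℕ in atTop, ‖(n : ℝ) • g ((n : ℝ)⁻¹)‖ < 1 := by
    refine hslope.norm.eventually_lt_const ?_
    simp
  filter_upwards [eventually_gt_atTop 0, hs1] with n hn hgn
  have hn' : (0 : ℝ) < n := by exact_mod_cast hn
  have hn1 : (n : ℝ)⁻¹ ≤ 1 := inv_le_one_of_one_le₀ (by exact_mod_cast hn)
  have hpow : NormedSpace.exp x = NormedSpace.exp ((n : ℝ)⁻¹ • x) ^ n := by
    let _ := NormedAlgebra.restrictScalars ℚ ℝ 𝔸
    rw [← NormedSpace.exp_nsmul, ← Nat.cast_smul_eq_nsmul ℝ, smul_smul, mul_inv_cancel₀ hn'.ne',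
      one_smul]
  have hKn : Real.exp (c * (n : ℝ)⁻¹) ^ n = Real.exp c := by
    rw [← Real.exp_nat_mul]; congr 1; field_simp
  have ha' : ‖1 + (n : ℝ)⁻¹ • x + ((n : ℝ)⁻¹) ^ 2 • y‖ ≤ 1 + (‖x‖ + ‖y‖) * (n : ℝ)⁻¹ := by
    refine (norm_add₃_le).trans ?_
    rw [norm_one, norm_smul, norm_smul, Real.norm_of_nonneg (by positivity),
      Real.norm_of_nonneg (by positivity)]
    have : ((n : ℝ)⁻¹) ^ 2 * ‖y‖ ≤ (n : ℝ)⁻¹ * ‖y‖ := by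
      refine mul_le_mul_of_nonneg_right ?_ (norm_nonneg _)
      rw [pow_two]
      exact mul_le_of_le_one_left (by positivity) hn1
    linarith
  have hcn : 1 + c * (n : ℝ)⁻¹ ≤ Real.exp (c * (n : ℝ)⁻¹) := by
    linarith [Real.add_one_le_exp (c * (n : ℝ)⁻¹)]
  have ha : ‖1 + (n : ℝ)⁻¹ • x + ((n : ℝ)⁻¹) ^ 2 • y‖ ≤ Real.exp (c * (n : ℝ)⁻¹) := by
    refine ha'.trans (le_trans ?_ hcn)
    have : 0 ≤ (n : ℝ)⁻¹ := by positivity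
    rw [hc]; linarith
  have hb' : ‖NormedSpace.exp ((n : ℝ)⁻¹ • x)‖ ≤ Real.exp (c * (n : ℝ)⁻¹) := by
    have hg' : ‖g ((n : ℝ)⁻¹)‖ ≤ (n : ℝ)⁻¹ := by
      rw [norm_smul, Real.norm_of_nonneg hn'.le] at hgn
      exact (le_inv_mul_iff₀ hn').2 hgn.le |>.trans_eq (mul_one _)
    refine le_trans ?_ hcn
    calc ‖NormedSpace.exp ((n : ℝ)⁻¹ • x)‖
        = ‖(1 + (n : ℝ)⁻¹ • x + ((n : ℝ)⁻¹) ^ 2 • y) - g ((n : ℝ)⁻¹)‖ := by simp [hg]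
      _ ≤ _ := (norm_sub_le _ _).trans (add_le_add ha' hg')
      _ = _ := by rw [hc]; ring
  rw [hpow]
  refine (norm_pow_sub_pow_le_of_norm_le (Real.one_le_exp (by positivity)) ha hb' n).trans ?_
  rw [hKn, norm_smul, Real.norm_of_nonneg hn'.le]
  exact le_of_eq (by simp only [hg]; ring)

end Exponential

/-! ### The semigroup generated by a Lindbladian -/

section Semigroup
open Matrix
open scoped Matrix.Norms.L2Operator MatrixOrder ComplexOrder

variable {n : Type*} [Fintype n] [DecidableEq n]

lemma expSuperop_zero (L : Superop n) : expSuperop L 0 = LinearMap.id := by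
  simp [expSuperop]

lemma hasDerivAt_expSuperop (L : Superop n) (X : Matrix n n ℂ) (φ : Matrix n n ℂ →ₗ[ℂ] ℂ) (t : ℝ) :
    HasDerivAt (fun s : ℝ => φ (expSuperop L s X)) (φ (L (expSuperop L t X))) t := by
  set b := Matrix.stdBasis ℂ n n
  set A := LinearMap.toMatrix b b L with hA
  let Λ : Matrix (n × n) (n × n) ℂ →ₗ[ℂ] ℂ :=
    φ ∘ₗ (LinearMap.applyₗ X) ∘ₗ (Matrix.toLin b b).toLinearMap
  have h1 := hasDerivAt_exp_smul_const' (𝕂 := ℂ) A (t : ℂ)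
  have h2 := (LinearMap.toContinuousLinearMap Λ).hasFDerivAt.comp_hasDerivAt (t : ℂ) h1
  have h3 := h2.comp_ofReal
  have e : φ (L (expSuperop L t X)) = Λ (A * NormedSpace.exp ((t : ℂ) • A)) := by
    change _ = φ (Matrix.toLin b b (A * NormedSpace.exp ((t : ℂ) • A)) X)
    rw [Matrix.toLin_mul b b b, LinearMap.comp_apply, hA, Matrix.toLin_toMatrix]
    rfl
  rw [e]
  exact h3

variable {κ : Type*} [Fintype κ]

lemma sum_dissipator_apply (J : κ → Matrix n n ℂ) (X : Matrix n n ℂ) :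
    (∑ k, dissipator (J k)) X = krausDual (fun k => star (J k)) X
      - (1 / 2 : ℂ) • (krausDual J 1 * X + X * krausDual J 1) := by
  simp only [LinearMap.sum_apply, krausDual, star_star, mul_one, Finset.sum_mul, Finset.mul_sum,
    ← Finset.sum_add_distrib, Finset.smul_sum, ← Finset.sum_sub_distrib]
  rfl

lemma trace_mul_sum_dissipator (J : κ → Matrix n n ℂ) (H X : Matrix n n ℂ) :
    (H * (∑ k, dissipator (J k)) X).trace =
      ((krausDual J H - (1 / 2 : ℝ) • (krausDual J 1 * H + H * krausDual J 1)) * X).trace := by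
  have h1 : (H * krausDual (fun k => star (J k)) X).trace = (krausDual J H * X).trace := by
    simp only [krausDual, star_star, Finset.mul_sum, Finset.sum_mul, Matrix.trace_sum]
    refine Finset.sum_congr rfl fun k _ => ?_
    rw [← mul_assoc, Matrix.trace_mul_comm]
    simp only [mul_assoc]
  have h2 : (H * (X * krausDual J 1)).trace = (krausDual J 1 * H * X).trace := by
    rw [← mul_assoc, Matrix.trace_mul_comm, mul_assoc]
  have h3 : ((1 / 2 : ℝ) • (krausDual J 1 * H + H * krausDual J 1) : Matrix n n ℂ)
      = (1 / 2 : ℂ) • (krausDual J 1 * H + H * krausDual J 1) := by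
    rw [← Complex.coe_smul]; norm_num
  rw [sum_dissipator_apply, h3, mul_sub, sub_mul, Matrix.trace_sub, Matrix.trace_sub, h1,
    Matrix.mul_smul, Matrix.smul_mul, Matrix.trace_smul, Matrix.trace_smul, mul_add, add_mul,
    Matrix.trace_add, Matrix.trace_add, h2, mul_assoc, mul_assoc, add_comm]

/-- The Euler step `X ↦ (1 - sK/2) X (1 - sK/2) + s ∑ k, J k X (J k)†`, `K = ∑ k, (J k)† J k`,
agrees with `1 + s L` up to second order and preserves positivity. -/
lemma eulerStep_nonneg (J : κ → Matrix n n ℂ) {X : Matrix n n ℂ} (hX : 0 ≤ X) {s : ℝ}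
    (hs : 0 ≤ s) :
    0 ≤ X + (s : ℂ) • (∑ k, dissipator (J k)) X
      + (s : ℂ) ^ 2 • ((1 / 4 : ℂ) • (krausDual J 1 * X * krausDual J 1)) := by
  set K := krausDual J 1 with hK
  have hKs : star K = K := (krausDual_one_isSelfAdjoint J).star_eq
  set M : Matrix n n ℂ := 1 - ((s / 2 : ℝ) : ℂ) • K with hM
  have hMs : star M = M := by
    rw [hM, star_sub, star_one, star_smul, hKs]; simp
  have h1 : 0 ≤ star M * X * M := star_left_conjugate_nonneg hX M
  have h2 : 0 ≤ s • krausDual (fun k => star (J k)) X := smul_nonneg hs (krausDual_nonneg _ hX)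
  convert add_nonneg h1 h2 using 1
  rw [sum_dissipator_apply, ← hK, hMs, hM, ← Complex.coe_smul]
  simp only [mul_sub, sub_mul, one_mul, mul_one, smul_sub, smul_add, smul_mul_assoc,
    mul_smul_comm, smul_smul]
  push_cast
  module

/-- Semigroups generated by sums of dissipators preserve positivity, since they are limits of
iterated Euler steps. -/
lemma expSuperop_nonneg (J : κ → Matrix n n ℂ) {X : Matrix n n ℂ} (hX : 0 ≤ X) {t : ℝ}
    (ht : 0 ≤ t) : 0 ≤ expSuperop (∑ k, dissipator (J k)) t X := by
  rcases isEmpty_or_nonempty n with hn | hn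
  · exact le_of_eq (Subsingleton.elim _ _)
  set b := Matrix.stdBasis ℂ n n with hb
  let S : Superop n := (1 / 4 : ℂ) •
    (LinearMap.mulRight ℂ (krausDual J 1) ∘ₗ LinearMap.mulLeft ℂ (krausDual J 1))
  set L : Superop n := ∑ k, dissipator (J k) with hL
  set x := (t : ℂ) • LinearMap.toMatrix b b L with hx
  set y := (t : ℂ) ^ 2 • LinearMap.toMatrix b b S with hy
  have hlim := tendsto_one_add_pow_exp x y
  let Λ : Matrix (n × n) (n × n) ℂ →ₗ[ℂ] Matrix n n ℂ :=
    (LinearMap.applyₗ X) ∘ₗ (Matrix.toLin b b).toLinearMap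
  have hlim2 := ((LinearMap.continuous_of_finiteDimensional Λ).tendsto _).comp hlim
  refine ge_of_tendsto hlim2 (Eventually.of_forall fun m => ?_)
  change 0 ≤ Matrix.toLin b b _ X
  have hstep : ∀ Y : Matrix n n ℂ, 0 ≤ Y →
      0 ≤ Matrix.toLin b b (1 + (m : ℝ)⁻¹ • x + ((m : ℝ)⁻¹) ^ 2 • y) Y := by
    intro Y hY
    have h := eulerStep_nonneg J hY (s := (m : ℝ)⁻¹ * t) (by positivity)
    convert h using 1
    rw [← Complex.coe_smul, ← Complex.coe_smul, hx, hy, smul_smul, smul_smul]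
    simp only [map_add, map_smul, LinearMap.add_apply, LinearMap.smul_apply,
      Matrix.toLin_toMatrix, Matrix.toLin_one, LinearMap.id_apply]
    congr 1
    · simp only [Complex.ofReal_mul]
      rfl
    · simp only [Complex.ofReal_mul, Complex.ofReal_pow, mul_pow]
      rfl
  have hpow : ∀ k : ℕ, ∀ Y : Matrix n n ℂ, 0 ≤ Y →
      0 ≤ Matrix.toLin b b ((1 + (m : ℝ)⁻¹ • x + ((m : ℝ)⁻¹) ^ 2 • y) ^ k) Y := by
    intro k
    induction k with
    | zero => intro Y hY; simpa [Matrix.toLin_one] using hY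
    | succ k ih =>
      intro Y hY
      rw [pow_succ, Matrix.toLin_mul b b b]
      exact ih _ (hstep Y hY)
  exact hpow m X hX

lemma trace_expSuperop (J : κ → Matrix n n ℂ) (X : Matrix n n ℂ) (t : ℝ) :
    (expSuperop (∑ k, dissipator (J k)) t X).trace = X.trace := by
  have hd : ∀ s, HasDerivAt (fun s : ℝ => (expSuperop (∑ k, dissipator (J k)) s X).trace) 0 s := by
    intro s
    have h := hasDerivAt_expSuperop (∑ k, dissipator (J k)) X (Matrix.traceLinearMap n ℂ ℂ) s
    have h0 : ∀ Y : Matrix n n ℂ, ((∑ k, dissipator (J k)) Y).trace = 0 := by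
      intro Y
      have := trace_mul_sum_dissipator J 1 Y
      rw [one_mul] at this
      rw [this, mul_one, one_mul, ← two_smul ℝ, smul_smul]
      norm_num
    rw [Matrix.traceLinearMap_apply, h0] at h
    exact h
  have := is_const_of_deriv_eq_zero (fun s => (hd s).differentiableAt) (fun s => (hd s).deriv) t 0
  simpa [expSuperop_zero] using this

lemma re_trace_mul_nonneg {A B : Matrix n n ℂ} (hA : 0 ≤ A) (hB : 0 ≤ B) :
    0 ≤ (A * B).trace.re := by
  obtain ⟨C, rfl⟩ := CStarAlgebra.nonneg_iff_eq_star_mul_self.1 hB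
  rw [← mul_assoc, Matrix.trace_mul_comm, ← mul_assoc]
  have h := star_left_conjugate_nonneg hA (star C)
  rw [star_star] at h
  have := (Matrix.nonneg_iff_posSemidef.1 h).trace_nonneg
  exact (Complex.le_def.1 this).1

lemma re_trace_mul_le {A A' B : Matrix n n ℂ} (hA : A ≤ A') (hB : 0 ≤ B) :
    (A * B).trace.re ≤ (A' * B).trace.re := by
  have := re_trace_mul_nonneg (sub_nonneg.2 hA) hB
  rw [sub_mul, Matrix.trace_sub, Complex.sub_re] at this
  linarith

/-- Grönwall's inequality for the energy of a state under a Lindblad semigroup. -/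
lemma re_trace_mul_expSuperop_le (J : κ → Matrix n n ℂ) {H : Matrix n n ℂ} {γ : ℝ}
    (hdecay : krausDual J H - (1 / 2 : ℝ) • (krausDual J 1 * H + H * krausDual J 1) ≤ -(γ • H))
    {X : Matrix n n ℂ} (hX : 0 ≤ X) {t : ℝ} (ht : 0 ≤ t) :
    (H * expSuperop (∑ k, dissipator (J k)) t X).trace.re
      ≤ Real.exp (-(γ * t)) * (H * X).trace.re := by
  set L : Superop n := ∑ k, dissipator (J k)
  let φ : Matrix n n ℂ →ₗ[ℂ] ℂ := Matrix.traceLinearMap n ℂ ℂ ∘ₗ LinearMap.mulLeft ℂ H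
  have hφ : ∀ Y, φ Y = (H * Y).trace := fun Y => rfl
  have hd : ∀ s, HasDerivAt (fun s : ℝ => (φ (expSuperop L s X)).re)
      (φ (L (expSuperop L s X))).re s := fun s =>
    Complex.reCLM.hasFDerivAt.comp_hasDerivAt s (hasDerivAt_expSuperop L X φ s)
  have he : ∀ s, HasDerivAt (fun s : ℝ => Real.exp (γ * s)) (Real.exp (γ * s) * γ) s := fun s => by
    simpa using ((hasDerivAt_id s).const_mul γ).exp
  have hf : ∀ s, HasDerivAt (fun s : ℝ => Real.exp (γ * s) * (φ (expSuperop L s X)).re)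
      (Real.exp (γ * s) * γ * (φ (expSuperop L s X)).re
        + Real.exp (γ * s) * (φ (L (expSuperop L s X))).re) s := fun s => (he s).mul (hd s)
  have hanti : AntitoneOn (fun s : ℝ => Real.exp (γ * s) * (φ (expSuperop L s X)).re)
      (Set.Ici 0) := by
    refine antitoneOn_of_deriv_nonpos (convex_Ici 0)
      (fun s _ => (hf s).continuousAt.continuousWithinAt)
      (fun s _ => (hf s).differentiableAt.differentiableWithinAt) fun s hs => ?_
    rw [interior_Ici] at hs
    have h1 : (φ (L (expSuperop L s X))).re ≤ -(γ * (φ (expSuperop L s X)).re) := by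
      rw [hφ, hφ, trace_mul_sum_dissipator]
      refine (re_trace_mul_le hdecay (expSuperop_nonneg J hX (le_of_lt hs))).trans (le_of_eq ?_)
      rw [neg_mul, Matrix.trace_neg, smul_mul_assoc, Matrix.trace_smul, ← Complex.coe_smul,
        Complex.neg_re, smul_eq_mul, Complex.re_ofReal_mul]
    rw [(hf s).deriv]
    nlinarith [Real.exp_pos (γ * s)]
  have h := hanti (Set.mem_Ici.2 le_rfl) (Set.mem_Ici.2 ht) ht
  simp only [mul_zero, Real.exp_zero, one_mul, expSuperop_zero, LinearMap.id_apply, hφ] at h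
  rw [Real.exp_neg, ← div_eq_inv_mul, le_div_iff₀ (Real.exp_pos _), mul_comm]
  exact h

end Semigroup


/-! ### Trace norm and duality -/

section TraceNorm
open Matrix
open scoped Matrix.Norms.L2Operator MatrixOrder ComplexOrder

variable {n : Type*} [Fintype n] [DecidableEq n]

lemma eigenvectorBasis_star_dotProduct {A : Matrix n n ℂ} (hA : A.IsHermitian) (k l : n) :
    star (hA.eigenvectorBasis k).ofLp ⬝ᵥ (hA.eigenvectorBasis l).ofLp = if k = l then 1 else 0 := by
  have h := orthonormal_iff_ite.1 hA.eigenvectorBasis.orthonormal k l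
  rw [EuclideanSpace.inner_eq_star_dotProduct, dotProduct_comm] at h
  exact h

lemma sum_vecMulVec_eigenvectorBasis {A : Matrix n n ℂ} (hA : A.IsHermitian) :
    ∑ k, vecMulVec (hA.eigenvectorBasis k).ofLp (star (hA.eigenvectorBasis k).ofLp) = 1 := by
  have h := Unitary.coe_mul_star_self hA.eigenvectorUnitary
  rw [← h]
  ext i j
  simp [Matrix.sum_apply, Matrix.mul_apply, vecMulVec_apply, Matrix.star_apply]

/-- Singular value decomposition. The left vectors `u k` belonging to zero singular values are
zero, so that the `u k` are only a partial orthonormal system. -/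
lemma exists_singularValue (X : Matrix n n ℂ) :
    ∃ (s : n → ℝ) (u v : n → n → ℂ), (∀ k, 0 ≤ s k) ∧ traceNorm X = ∑ k, s k ∧
      X = ∑ k, (s k : ℂ) • vecMulVec (u k) (star (v k)) ∧
      (∀ k l, k ≠ l → star (u k) ⬝ᵥ u l = 0) ∧
      (∀ k, star (u k) ⬝ᵥ u k = if s k = 0 then 0 else 1) ∧
      (∀ k, star (v k) ⬝ᵥ v k = 1) ∧ ∑ k, vecMulVec (v k) (star (v k)) = 1 := by
  set hX := Matrix.isHermitian_conjTranspose_mul_self X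
  set v : n → n → ℂ := fun k => (hX.eigenvectorBasis k).ofLp with hv
  set s : n → ℝ := fun k => Real.sqrt (hX.eigenvalues k) with hs
  have hnn : ∀ k, 0 ≤ hX.eigenvalues k :=
    (Matrix.posSemidef_conjTranspose_mul_self X).eigenvalues_nonneg
  have hXv : ∀ k l, star (X *ᵥ v k) ⬝ᵥ (X *ᵥ v l) = if k = l then (s k : ℂ) ^ 2 else 0 := by
    intro k l
    rw [star_mulVec, ← dotProduct_mulVec, mulVec_mulVec, hX.mulVec_eigenvectorBasis,
      dotProduct_smul, eigenvectorBasis_star_dotProduct]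
    split_ifs with h
    · subst h
      rw [← Complex.ofReal_pow, hs, Real.sq_sqrt (hnn k)]
      simp
    · simp
  have hX0 : ∀ k, s k = 0 → X *ᵥ v k = 0 := by
    intro k hk
    have := hXv k k
    rw [if_pos rfl, hk] at this
    exact dotProduct_star_self_eq_zero.1 (by rw [dotProduct_comm]; simpa using this)
  refine ⟨s, fun k => ((s k : ℂ)⁻¹) • (X *ᵥ v k), v, fun k => Real.sqrt_nonneg _, rfl, ?_, ?_, ?_,
    ?_, sum_vecMulVec_eigenvectorBasis hX⟩
  · calc X = X * ∑ k, vecMulVec (v k) (star (v k)) := by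
          rw [sum_vecMulVec_eigenvectorBasis hX, mul_one]
      _ = _ := by
          rw [Finset.mul_sum]
          refine Finset.sum_congr rfl fun k _ => ?_
          rw [mul_vecMulVec, smul_vecMulVec, smul_smul]
          by_cases hk : s k = 0
          · rw [hX0 k hk]; simp
          · rw [mul_inv_cancel₀ (by exact_mod_cast hk), one_smul]
  · intro k l hkl
    simp [star_smul, hXv, hkl]
  · intro k
    simp only [star_smul, smul_dotProduct, dotProduct_smul, hXv, if_true]
    split_ifs with hk
    · simp [hk]
    · have : (s k : ℂ) ≠ 0 := by exact_mod_cast hk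
      simp only [star_inv₀, smul_eq_mul, Complex.star_def, Complex.conj_ofReal]
      field_simp
  · intro k
    rw [hv, eigenvectorBasis_star_dotProduct, if_pos rfl]

/-- The trace norm is attained by duality at a contraction. -/
lemma exists_traceNorm_eq (X : Matrix n n ℂ) :
    ∃ U : Matrix n n ℂ, ‖U‖ ≤ 1 ∧ (traceNorm X : ℂ) = (U * X).trace := by
  obtain ⟨s, u, v, hs, hX, rfl, huv, hu, hv, hv1⟩ := exists_singularValue X
  refine ⟨∑ k, vecMulVec (v k) (star (u k)), ?_, ?_⟩
  · set U : Matrix n n ℂ := ∑ k, vecMulVec (v k) (star (u k)) with hU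
    have h1 : U * star U ≤ 1 := by
      have e : U * star U = ∑ k, (star (u k) ⬝ᵥ u k) • vecMulVec (v k) (star (v k)) := by
        rw [hU, star_sum, Finset.sum_mul_sum]
        refine Finset.sum_congr rfl fun k _ => ?_
        rw [Finset.sum_eq_single k]
        · rw [star_eq_conjTranspose, conjTranspose_vecMulVec, star_star, vecMulVec_mul_vecMulVec,
            vecMulVec_smul]
        · intro l _ hl
          rw [star_eq_conjTranspose, conjTranspose_vecMulVec, star_star, vecMulVec_mul_vecMulVec,
            huv k l hl.symm, zero_smul, vecMulVec_zero]
        · simp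
      rw [e, ← hv1]
      refine Finset.sum_le_sum fun k _ => ?_
      have hp : 0 ≤ vecMulVec (v k) (star (v k)) :=
        Matrix.nonneg_iff_posSemidef.2 (posSemidef_vecMulVec_self_star _)
      rw [hu]
      split_ifs
      · simpa using hp
      · simp
    have h2 : ‖U * star U‖ ≤ 1 :=
      (CStarAlgebra.norm_le_one_iff_of_nonneg _ (mul_star_self_nonneg U)).2 h1
    rw [CStarRing.norm_self_mul_star] at h2
    nlinarith [norm_nonneg U]
  · rw [hX, Finset.sum_mul_sum, Matrix.trace_sum]
    push_cast
    refine Finset.sum_congr rfl fun k _ => ?_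
    rw [Matrix.trace_sum, Finset.sum_eq_single k]
    · rw [Matrix.mul_smul, vecMulVec_mul_vecMulVec, Matrix.trace_smul, hu]
      by_cases hk : s k = 0
      · simp [hk]
      · have := hv k
        rw [dotProduct_comm] at this
        simp [hk, trace_vecMulVec, this]
    · intro l _ hl
      rw [Matrix.mul_smul, vecMulVec_mul_vecMulVec, huv k l hl.symm]
      simp
    · simp

omit [Fintype n] [DecidableEq n] in
lemma polarization_vecMulVec (u v : n → ℂ) :
    vecMulVec u (star v) = (1 / 4 : ℂ) • ∑ m : Fin 4, (Complex.I ^ (m : ℕ)) •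
      vecMulVec (u + Complex.I ^ (m : ℕ) • v) (star (u + Complex.I ^ (m : ℕ) • v)) := by
  ext i j
  simp only [vecMulVec_apply, Fin.sum_univ_four, Matrix.smul_apply, Matrix.add_apply,
    Pi.star_apply, Pi.add_apply, Pi.smul_apply, smul_eq_mul, star_add, star_mul', Fin.val_zero,
    Fin.val_one, Fin.val_two, pow_zero, pow_one, Complex.I_sq, Complex.star_def, Complex.conj_I,
    map_neg, map_one, Fin.isValue,
    show ((3 : Fin 4) : ℕ) = 3 from rfl, Complex.I_pow_three, one_mul]
  have hI := Complex.I_mul_I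
  ring_nf
  simp [Complex.I_sq]
  ring

/-- A linear map whose trace norm is controlled on rank-one positive matrices is controlled on
all matrices, by polarization of the singular value decomposition. -/
lemma traceNorm_le_of_rankOne (F : Superop n) {B : ℝ}
    (hF : ∀ (U : Matrix n n ℂ) (w : n → ℂ), ‖U‖ ≤ 1 →
      ‖(U * F (vecMulVec w (star w))).trace‖ ≤ B * (star w ⬝ᵥ w).re) (hB : 0 ≤ B)
    (X : Matrix n n ℂ) : traceNorm (F X) ≤ 4 * B * traceNorm X := by
  obtain ⟨U, hU, hUF⟩ := exists_traceNorm_eq (F X)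
  obtain ⟨s, u, v, hs, hX, hXe, -, hu, hv, -⟩ := exists_singularValue X
  have h1 : traceNorm (F X) ≤ ‖(U * F X).trace‖ := by
    rw [← hUF, Complex.norm_real]; exact le_abs_self _
  refine h1.trans ?_
  have hterm : ∀ k, ‖(U * F (vecMulVec (u k) (star (v k)))).trace‖ ≤ 4 * B := by
    intro k
    rw [polarization_vecMulVec, map_smul, map_sum, Matrix.mul_smul, Matrix.trace_smul,
      Finset.mul_sum, Matrix.trace_sum, norm_smul]
    have hm : ∀ m : Fin 4, ‖(U * F (Complex.I ^ (m : ℕ) •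
        vecMulVec (u k + Complex.I ^ (m : ℕ) • v k)
          (star (u k + Complex.I ^ (m : ℕ) • v k)))).trace‖ ≤ B * 4 := by
      intro m
      rw [map_smul, Matrix.mul_smul, Matrix.trace_smul, norm_smul, norm_pow, Complex.norm_I,
        one_pow, one_mul]
      refine (hF U _ hU).trans (mul_le_mul_of_nonneg_left ?_ hB)
      set ω := Complex.I ^ (m : ℕ)
      have hω : star ω * ω = 1 := by
        simp only [ω, star_pow, ← mul_pow, Complex.star_def, Complex.conj_I]
        simp
      have hpar : star (u k + ω • v k) ⬝ᵥ (u k + ω • v k)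
          + star (u k - ω • v k) ⬝ᵥ (u k - ω • v k)
          = 2 * (star (u k) ⬝ᵥ u k) + 2 * (star (v k) ⬝ᵥ v k) := by
        simp only [star_add, star_sub, star_smul, add_dotProduct, sub_dotProduct, dotProduct_add,
          dotProduct_sub, smul_dotProduct, dotProduct_smul, smul_eq_mul]
        linear_combination (2 * (star (v k) ⬝ᵥ v k)) * hω
      have hpos : 0 ≤ (star (u k - ω • v k) ⬝ᵥ (u k - ω • v k)).re :=
        (Complex.le_def.1 (dotProduct_star_self_nonneg _)).1.trans_eq (by rw [dotProduct_comm])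
      have hre := congrArg Complex.re hpar
      have hu1 : (star (u k) ⬝ᵥ u k).re ≤ 1 := by
        rw [hu]; split_ifs <;> norm_num
      have h2u : (2 * (star (u k) ⬝ᵥ u k)).re = 2 * (star (u k) ⬝ᵥ u k).re := by
        rw [two_mul, Complex.add_re, two_mul]
      rw [hv, Complex.add_re, Complex.add_re, mul_one, h2u, Complex.re_ofNat] at hre
      linarith
    refine (mul_le_mul_of_nonneg_left ((norm_sum_le _ _).trans (Finset.sum_le_sum fun m _ => hm m))
      (norm_nonneg _)).trans (le_of_eq ?_)
    simp
    ring
  conv_lhs => rw [hXe]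
  rw [map_sum, Finset.mul_sum, Matrix.trace_sum, hX, Finset.mul_sum]
  refine (norm_sum_le _ _).trans (Finset.sum_le_sum fun k _ => ?_)
  rw [map_smul, Matrix.mul_smul, Matrix.trace_smul, norm_smul, Complex.norm_real,
    Real.norm_of_nonneg (hs k), mul_comm]
  exact mul_le_mul_of_nonneg_right (hterm k) (hs k)

/-- The Frobenius norm. -/
def frob (A : Matrix n n ℂ) : ℝ := Real.sqrt (star A * A).trace.re

omit [DecidableEq n] in
lemma norm_trace_star_mul_le (A C : Matrix n n ℂ) :
    ‖(star A * C).trace‖ ≤ frob A * frob C := by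
  let f : Matrix n n ℂ → EuclideanSpace ℂ (n × n) := fun A => WithLp.toLp 2 fun p => A p.2 p.1
  have hf : ∀ A C : Matrix n n ℂ, inner ℂ (f A) (f C) = (star A * C).trace := by
    intro A C
    rw [EuclideanSpace.inner_eq_star_dotProduct, dotProduct_comm]
    simp [dotProduct, f, Matrix.trace, Matrix.mul_apply, Matrix.star_apply, Fintype.sum_prod_type]
  have hn : ∀ A, frob A = ‖f A‖ := by
    intro A
    rw [frob, ← hf, norm_eq_sqrt_re_inner (𝕜 := ℂ)]
    rfl
  rw [← hf, hn, hn]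
  exact norm_inner_le_norm _ _

lemma frob_mul_le {U : Matrix n n ℂ} (hU : ‖U‖ ≤ 1) (A : Matrix n n ℂ) :
    frob (U * A) ≤ frob A := by
  refine Real.sqrt_le_sqrt ?_
  have h1 : star U * U ≤ 1 := by
    refine CStarAlgebra.star_mul_le_algebraMap_norm_sq.trans ?_
    rw [← map_one (algebraMap ℝ (Matrix n n ℂ))]
    exact algebraMap_mono _ (pow_le_one₀ (norm_nonneg _) hU)
  have h2 := star_left_conjugate_le_conjugate h1 A
  have h3 := (Complex.le_def.1 (Matrix.nonneg_iff_posSemidef.1 (sub_nonneg.2 h2)).trace_nonneg).1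
  rw [Matrix.trace_sub, Complex.sub_re, Complex.zero_re, sub_nonneg, mul_one] at h3
  rw [star_mul]
  simpa only [mul_assoc] using h3

lemma norm_le_one_of_isProj {e : Matrix n n ℂ} (hs : star e = e) (he : e * e = e) : ‖e‖ ≤ 1 := by
  have h := CStarRing.norm_star_mul_self (x := e)
  rw [hs, he] at h
  nlinarith [norm_nonneg e]

/-- Quantitative "gentle measurement": a state that has little weight outside the range of a
rank-one projection `e` is close in trace norm to its multiple of `e`. -/
lemma norm_trace_sub_le {e U ρ : Matrix n n ℂ} {c : ℂ} (hs : star e = e) (he : e * e = e)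
    (hc : e * U * e = c • e) (hc1 : ‖c‖ ≤ 1) (hU : ‖U‖ ≤ 1) (hρ : 0 ≤ ρ) :
    ‖(U * ρ).trace - c * ρ.trace‖
      ≤ 4 * (Real.sqrt ρ.trace.re * Real.sqrt ((1 - e) * ρ).trace.re) := by
  obtain ⟨C, rfl⟩ := CStarAlgebra.nonneg_iff_eq_star_mul_self.1 hρ
  set b := star C with hb
  have hCb : C = star b := by simp [hb]
  rw [hCb]
  have hs' : star (1 - e) = 1 - e := by rw [star_sub, star_one, hs]
  have he' : (1 - e) * (1 - e) = 1 - e := by simp [mul_sub, sub_mul, he]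
  set p := e * b with hp
  set y := (1 - e) * b with hy
  have hbpy : b = p + y := by rw [hp, hy]; noncomm_ring
  have hpy : star p * y = 0 := by
    rw [hp, hy, star_mul, hs]
    calc star b * e * ((1 - e) * b) = star b * (e - e * e) * b := by noncomm_ring
      _ = 0 := by rw [he]; simp
  have hyp : star y * p = 0 := by
    have := congrArg star hpy
    simpa using this
  have hUp : star p * (U * p) = c • (star p * p) := by
    rw [hp, star_mul, hs]
    calc star b * e * (U * (e * b)) = star b * (e * U * e) * b := by noncomm_ring
      _ = c • (star b * (e * e) * b) := by rw [hc, he]; simp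
      _ = _ := by congr 1; noncomm_ring
  have hfb : Real.sqrt (b * star b).trace.re = frob b := by rw [frob, Matrix.trace_mul_comm]
  have hfy : Real.sqrt ((1 - e) * (b * star b)).trace.re = frob y := by
    rw [frob, hy, star_mul, hs']
    congr 2
    calc ((1 - e) * (b * star b)).trace = (((1 - e) * b) * star b).trace := by rw [mul_assoc]
      _ = (star b * ((1 - e) * b)).trace := Matrix.trace_mul_comm _ _
      _ = (star b * ((1 - e) * (1 - e) * b)).trace := by rw [he']
      _ = _ := by simp only [mul_assoc]
  have hfpb : frob p ≤ frob b := frob_mul_le (norm_le_one_of_isProj hs he) b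
  have hfyb : frob y ≤ frob b := frob_mul_le (norm_le_one_of_isProj hs' he') b
  have e1 : (U * (b * star b)).trace = (star b * (U * b)).trace := by
    rw [← mul_assoc, Matrix.trace_mul_comm]
  have e2 : (b * star b).trace = (star b * b).trace := Matrix.trace_mul_comm _ _
  have e3 : (U * (b * star b)).trace - c * (b * star b).trace
      = (star p * (U * y)).trace + (star y * (U * p)).trace + (star y * (U * y)).trace
        - c * (star y * y).trace := by
    rw [e1, e2, hbpy]
    simp only [star_add, add_mul, mul_add, hpy, hyp, hUp, Matrix.trace_add, Matrix.trace_smul,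
      smul_eq_mul, Matrix.trace_zero]
    ring
  have f0 : ∀ A : Matrix n n ℂ, 0 ≤ frob A := fun A => Real.sqrt_nonneg _
  have b1 : ‖(star p * (U * y)).trace‖ ≤ frob b * frob y :=
    (norm_trace_star_mul_le _ _).trans (mul_le_mul hfpb (frob_mul_le hU y) (f0 _) (f0 _))
  have b2 : ‖(star y * (U * p)).trace‖ ≤ frob b * frob y :=
    (norm_trace_star_mul_le _ _).trans ((mul_le_mul_of_nonneg_left
      ((frob_mul_le hU p).trans hfpb) (f0 _)).trans_eq (mul_comm _ _))
  have b3 : ‖(star y * (U * y)).trace‖ ≤ frob b * frob y :=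
    (norm_trace_star_mul_le _ _).trans (mul_le_mul hfyb (frob_mul_le hU y) (f0 _) (f0 _))
  have b4 : ‖c * (star y * y).trace‖ ≤ frob b * frob y := by
    rw [norm_mul]
    have := (norm_trace_star_mul_le y y).trans (mul_le_mul_of_nonneg_right hfyb (f0 y))
    calc ‖c‖ * ‖(star y * y).trace‖ ≤ 1 * ‖(star y * y).trace‖ := by gcongr
      _ ≤ _ := by rwa [one_mul]
  rw [e3, hfb, hfy]
  refine (norm_sub_le _ _).trans ?_
  have := norm_add₃_le (a := (star p * (U * y)).trace) (b := (star y * (U * p)).trace)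
    (c := (star y * (U * y)).trace)
  linarith

end TraceNorm

/-! ### Mixing from an energy that decays -/

section Mixing
open Matrix
open scoped Matrix.Norms.L2Operator MatrixOrder ComplexOrder

variable {n κ : Type*} [Fintype n] [DecidableEq n] [Fintype κ]

/-- The spectral gap comes for free from the decay of the energy: on an eigenvector of `H` with
eigenvalue `μ`, the decay inequality reads `γ μ ≤ ⟨K⟩ μ ≤ μ²`, as `∑ k, (J k)† H (J k) ≥ 0`. -/
lemma smul_one_sub_le_of_decay (J : κ → Matrix n n ℂ) {H e : Matrix n n ℂ} {γ : ℝ}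
    (hK : krausDual J 1 ≤ H)
    (hdecay : krausDual J H - (1 / 2 : ℝ) • (krausDual J 1 * H + H * krausDual J 1) ≤ -(γ • H))
    (hs : star e = e) (he : e * e = e) (hker : ∀ v, H *ᵥ v = 0 → e *ᵥ v = v) :
    γ • (1 - e) ≤ H := by
  have hK0 : 0 ≤ krausDual J 1 := krausDual_nonneg J zero_le_one
  have hH0 : 0 ≤ H := hK0.trans hK
  have hHp := Matrix.nonneg_iff_posSemidef.1 hH0
  set hH := hHp.isHermitian
  set v : n → n → ℂ := fun k => (hH.eigenvectorBasis k).ofLp with hv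
  set μ : n → ℝ := hH.eigenvalues with hμ
  have hμ0 : ∀ k, 0 ≤ μ k := hHp.eigenvalues_nonneg
  have hHv : ∀ k, H *ᵥ v k = (μ k : ℂ) • v k := fun k => by
    rw [hv, Complex.coe_smul]; exact hH.mulVec_eigenvectorBasis k
  have hvv : ∀ k l, star (v k) ⬝ᵥ v l = if k = l then 1 else 0 :=
    eigenvectorBasis_star_dotProduct hH
  have hgap : ∀ k, μ k ≠ 0 → γ ≤ μ k := by
    intro k hk
    have hq : ∀ A B : Matrix n n ℂ, A ≤ B →
        (star (v k) ⬝ᵥ (A *ᵥ v k)).re ≤ (star (v k) ⬝ᵥ (B *ᵥ v k)).re := by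
      intro A B hAB
      have h := (Complex.le_def.1 ((Matrix.le_iff.1 hAB).dotProduct_mulVec_nonneg (v k))).1
      rw [sub_mulVec, dotProduct_sub, Complex.sub_re] at h
      simpa using h
    have h1 := hq _ _ (krausDual_nonneg J hH0)
    have h2 := hq _ _ hK
    have h3 := hq _ _ hdecay
    have hHstar : star (v k) ᵥ* H = (μ k : ℂ) • star (v k) := by
      have := congrArg star (hHv k)
      rw [star_mulVec, hH.eq, star_smul] at this
      simpa using this
    have e1 : star (v k) ⬝ᵥ ((krausDual J 1 * H) *ᵥ v k)
        = (μ k : ℂ) * (star (v k) ⬝ᵥ (krausDual J 1 *ᵥ v k)) := by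
      rw [← mulVec_mulVec, hHv, mulVec_smul, dotProduct_smul, smul_eq_mul]
    have e2 : star (v k) ⬝ᵥ ((H * krausDual J 1) *ᵥ v k)
        = (μ k : ℂ) * (star (v k) ⬝ᵥ (krausDual J 1 *ᵥ v k)) := by
      rw [← mulVec_mulVec, dotProduct_mulVec, hHstar, smul_dotProduct, smul_eq_mul]
    have e3 : star (v k) ⬝ᵥ (H *ᵥ v k) = (μ k : ℂ) := by
      rw [hHv, dotProduct_smul, hvv]; simp
    rw [← Complex.coe_smul, ← Complex.coe_smul] at h3
    simp only [sub_mulVec, smul_mulVec, add_mulVec, neg_mulVec, dotProduct_sub, dotProduct_smul,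
      dotProduct_add, dotProduct_neg, e1, e2, e3, smul_eq_mul, Complex.sub_re,
      Complex.re_ofReal_mul, Complex.add_re, Complex.neg_re, Complex.ofReal_re] at h3
    simp only [zero_mulVec, dotProduct_zero, Complex.zero_re] at h1
    rw [e3, Complex.ofReal_re] at h2
    have hpos : 0 < μ k := lt_of_le_of_ne (hμ0 k) (Ne.symm hk)
    have h4 : γ * μ k ≤ μ k * μ k := by nlinarith
    exact le_of_mul_le_mul_right h4 hpos
  have hone : ∑ k, vecMulVec (v k) (star (v k)) = 1 := sum_vecMulVec_eigenvectorBasis hH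
  have hHsum : H = ∑ k, (μ k : ℂ) • vecMulVec (v k) (star (v k)) := by
    conv_lhs => rw [← mul_one H, ← hone, Finset.mul_sum]
    refine Finset.sum_congr rfl fun k _ => ?_
    rw [mul_vecMulVec, hHv, smul_vecMulVec]
  -- The projection onto the kernel of `H`.
  set N : Matrix n n ℂ := ∑ k, (if μ k = 0 then (1 : ℂ) else 0) • vecMulVec (v k) (star (v k))
    with hN
  have hNs : star N = N := by
    rw [hN, star_sum]
    refine Finset.sum_congr rfl fun k _ => ?_
    rw [star_smul, star_eq_conjTranspose, conjTranspose_vecMulVec, star_star]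
    split_ifs <;> simp
  have hNN : N * N = N := by
    rw [hN, Finset.sum_mul_sum]
    refine Finset.sum_congr rfl fun k _ => ?_
    rw [Finset.sum_eq_single k]
    · rw [smul_mul_smul_comm, vecMulVec_mul_vecMulVec, hvv, if_pos rfl]
      split_ifs <;> simp
    · intro l _ hl
      rw [smul_mul_smul_comm, vecMulVec_mul_vecMulVec, hvv, if_neg hl.symm]
      simp
    · simp
  have heN : e * N = N := by
    rw [hN, Finset.mul_sum]
    refine Finset.sum_congr rfl fun k _ => ?_
    rw [Matrix.mul_smul, mul_vecMulVec]
    split_ifs with h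
    · rw [hker (v k) (by rw [hHv, h]; simp)]
    · simp
  have hNe : N * e = N := by
    have := congrArg star heN
    rwa [star_mul, hs, hNs] at this
  have h1 : 1 - e ≤ 1 - N := by
    rw [← sub_nonneg]
    have : 1 - N - (1 - e) = star (e - N) * (e - N) := by
      rw [star_sub, hs, hNs, mul_sub, sub_mul, sub_mul, he, heN, hNe, hNN]
      abel
    rw [this]
    exact star_mul_self_nonneg _
  have h2 : γ • (1 - N) ≤ H := by
    rw [← sub_nonneg]
    have : H - γ • (1 - N)
        = ∑ k, (μ k - γ * (if μ k = 0 then 0 else 1)) • vecMulVec (v k) (star (v k)) := by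
      have h1N : (1 : Matrix n n ℂ) - N
          = ∑ k, (if μ k = 0 then (0 : ℝ) else 1) • vecMulVec (v k) (star (v k)) := by
        conv_lhs => rw [← hone, hN, ← Finset.sum_sub_distrib]
        refine Finset.sum_congr rfl fun k _ => ?_
        split_ifs <;> simp
      rw [h1N, Finset.smul_sum]
      conv_lhs => rw [hHsum]
      rw [← Finset.sum_sub_distrib]
      refine Finset.sum_congr rfl fun k _ => ?_
      rw [sub_smul, mul_smul, Complex.coe_smul]
    rw [this]
    refine Finset.sum_nonneg fun k _ => smul_nonneg ?_
      (Matrix.nonneg_iff_posSemidef.2 (posSemidef_vecMulVec_self_star _))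
    split_ifs with h
    · simp [h]
    · linarith [hgap k h]
  rcases le_or_gt 0 γ with hγ | hγ
  · exact (smul_le_smul_of_nonneg_left h1 hγ).trans h2
  · refine le_trans (smul_nonpos_of_nonpos_of_nonneg hγ.le ?_) hH0
    have : (1 : Matrix n n ℂ) - e = star (1 - e) * (1 - e) := by
      rw [star_sub, star_one, hs, mul_sub, sub_mul, sub_mul, he]; simp
    rw [this]
    exact star_mul_self_nonneg _

/-- Rapid mixing from an energy `H` that dominates the decay rates `∑ k, (J k)† J k`, decays at
rate `γ` and has `ψ` as its only ground state. -/
theorem traceNorm_expSuperop_sub_le (J : κ → Matrix n n ℂ) {H : Matrix n n ℂ} {γ M : ℝ}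
    (hγ : 0 < γ) (hK : krausDual J 1 ≤ H)
    (hdecay : krausDual J H - (1 / 2 : ℝ) • (krausDual J 1 * H + H * krausDual J 1) ≤ -(γ • H))
    (hM : H ≤ M • 1) (ψ : n → ℂ) (hker : ∀ v, H *ᵥ v = 0 → ∃ c : ℂ, v = c • ψ)
    {t : ℝ} (ht : 0 ≤ t) (X : Matrix n n ℂ) :
    traceNorm ((expSuperop (∑ k, dissipator (J k)) t
        - (Matrix.traceLinearMap n ℂ ℂ).smulRight
            ((star ψ ⬝ᵥ ψ)⁻¹ • vecMulVec ψ (star ψ))) X)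
      ≤ 16 * (Real.sqrt (M / γ) * Real.exp (-(γ / 2 * t))) * traceNorm X := by
  set a := star ψ ⬝ᵥ ψ with ha
  have has : star a = a := by rw [ha, ← star_dotProduct_star, star_star]
  set e : Matrix n n ℂ := a⁻¹ • vecMulVec ψ (star ψ) with he_def
  have hs : star e = e := by
    rw [he_def, star_smul, star_inv₀, has, star_eq_conjTranspose, conjTranspose_vecMulVec,
      star_star]
  have haa : a⁻¹ * a⁻¹ * a = a⁻¹ := by
    by_cases h : a = 0
    · simp [h]
    · field_simp
  have he : e * e = e := by
    rw [he_def, smul_mul_smul_comm, vecMulVec_mul_vecMulVec, vecMulVec_smul, smul_smul, ← ha, haa]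
  have heψ : e *ᵥ ψ = ψ := by
    by_cases h : a = 0
    · have : ψ = 0 := dotProduct_star_self_eq_zero.1 h
      simp [this]
    · rw [he_def, smul_mulVec, vecMulVec_mulVec, ← ha]
      ext i
      simp only [Pi.smul_apply, MulOpposite.smul_eq_mul_unop, MulOpposite.unop_op, smul_eq_mul]
      field_simp
  have hker' : ∀ v, H *ᵥ v = 0 → e *ᵥ v = v := by
    intro v hv
    obtain ⟨c, rfl⟩ := hker v hv
    rw [mulVec_smul, heψ]
  have hgap := smul_one_sub_le_of_decay J hK hdecay hs he hker'
  have hH0 : 0 ≤ H := (krausDual_nonneg J zero_le_one).trans hK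
  have hes : ∀ U : Matrix n n ℂ, e * U * e = (U * e).trace • e := by
    intro U
    rw [he_def, Matrix.smul_mul, Matrix.smul_mul, Matrix.mul_smul, Matrix.mul_smul,
      vecMulVec_mul, vecMulVec_mul_vecMulVec, vecMulVec_smul, mul_vecMulVec, Matrix.trace_smul,
      trace_vecMulVec, dotProduct_comm (U *ᵥ ψ), dotProduct_mulVec]
    simp only [smul_smul, smul_eq_mul]
    congr 1
    ring
  have htr : e.trace.re ≤ 1 := by
    rw [he_def, Matrix.trace_smul, trace_vecMulVec, dotProduct_comm, ← ha, smul_eq_mul]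
    by_cases h : a = 0
    · simp [h]
    · rw [inv_mul_cancel₀ h]; simp
  have hc1 : ∀ U : Matrix n n ℂ, ‖U‖ ≤ 1 → ‖(U * e).trace‖ ≤ 1 := by
    intro U hU
    have h1 : (U * e).trace = (star e * (U * e)).trace := by
      rw [hs, Matrix.trace_mul_comm e, mul_assoc, he]
    rw [h1]
    refine (norm_trace_star_mul_le _ _).trans ?_
    have h2 : frob e ≤ 1 := by
      rw [frob, hs, he]
      exact Real.sqrt_le_one.2 htr
    have h3 := (frob_mul_le hU e).trans h2
    exact mul_le_one₀ h2 (Real.sqrt_nonneg _) h3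
  have hmain := traceNorm_le_of_rankOne
    (expSuperop (∑ k, dissipator (J k)) t - (Matrix.traceLinearMap n ℂ ℂ).smulRight e)
    (B := 4 * (Real.sqrt (M / γ) * Real.exp (-(γ / 2 * t)))) ?_ (by positivity) X
  · refine hmain.trans (le_of_eq ?_)
    ring
  intro U w hU
  set σ := vecMulVec w (star w) with hσ
  have hσ0 : 0 ≤ σ := Matrix.nonneg_iff_posSemidef.2 (posSemidef_vecMulVec_self_star _)
  have hσtr : σ.trace = star w ⬝ᵥ w := by rw [hσ, trace_vecMulVec, dotProduct_comm]
  set ρ := expSuperop (∑ k, dissipator (J k)) t σ with hρ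
  have hρ0 : 0 ≤ ρ := expSuperop_nonneg J hσ0 ht
  have hρtr : ρ.trace = star w ⬝ᵥ w := by rw [hρ, trace_expSuperop, hσtr]
  have hτ : 0 ≤ (star w ⬝ᵥ w).re := by
    rw [← hσtr]
    exact (Complex.le_def.1 (Matrix.nonneg_iff_posSemidef.1 hσ0).trace_nonneg).1
  have hQ : ((1 - e) * ρ).trace.re ≤ (star w ⬝ᵥ w).re * (M / γ * Real.exp (-(γ * t))) := by
    have h1 := re_trace_mul_le hgap hρ0
    have h2 := re_trace_mul_expSuperop_le J hdecay hσ0 ht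
    have h3 := re_trace_mul_le hM hσ0
    rw [smul_mul_assoc, Matrix.trace_smul, Complex.smul_re, smul_eq_mul] at h1 h3
    rw [one_mul, hσtr] at h3
    have h4 : γ * ((1 - e) * ρ).trace.re ≤ Real.exp (-(γ * t)) * (M * (star w ⬝ᵥ w).re) :=
      h1.trans (h2.trans (mul_le_mul_of_nonneg_left h3 (Real.exp_pos _).le))
    have h5 : (star w ⬝ᵥ w).re * (M / γ * Real.exp (-(γ * t)))
        = Real.exp (-(γ * t)) * (M * (star w ⬝ᵥ w).re) / γ := by ring
    rw [h5, le_div_iff₀ hγ, mul_comm]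
    exact h4
  have hb := norm_trace_sub_le hs he (hes U) (hc1 U hU) hU hρ0
  have hF : (U * (expSuperop (∑ k, dissipator (J k)) t
      - (Matrix.traceLinearMap n ℂ ℂ).smulRight e) σ).trace
      = (U * ρ).trace - (U * e).trace * ρ.trace := by
    rw [LinearMap.sub_apply, LinearMap.smulRight_apply, Matrix.traceLinearMap_apply, mul_sub,
      Matrix.trace_sub, Matrix.mul_smul, Matrix.trace_smul, hσtr, hρtr, smul_eq_mul, mul_comm]
  rw [hF]
  refine hb.trans ?_
  rw [hρtr, mul_assoc 4]
  refine mul_le_mul_of_nonneg_left ?_ (by norm_num)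
  calc Real.sqrt (star w ⬝ᵥ w).re * Real.sqrt ((1 - e) * ρ).trace.re
      ≤ Real.sqrt (star w ⬝ᵥ w).re
          * Real.sqrt ((star w ⬝ᵥ w).re * (M / γ * Real.exp (-(γ * t)))) := by gcongr
    _ = Real.sqrt (M / γ) * Real.exp (-(γ / 2 * t)) * (star w ⬝ᵥ w).re := by
        rw [Real.sqrt_mul hτ, ← mul_assoc, Real.mul_self_sqrt hτ, mul_comm,
          Real.sqrt_mul' _ (Real.exp_pos _).le]
        congr 2
        rw [Real.sqrt_eq_iff_mul_self_eq (Real.exp_pos _).le (Real.exp_pos _).le, ← Real.exp_add]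
        congr 1
        ring

end Mixing


/-! ### Energy decay on a network of dressed jumps -/

section Network

section Generator

variable {𝒜 ι κ : Type*} [CStarAlgebra 𝒜] [Fintype ι] [Fintype κ]

/-- The generator with jumps `w`, in the Heisenberg picture. -/
def dualGenerator (w : ι → 𝒜) (x : 𝒜) : 𝒜 :=
  krausDual w x - (1 / 2 : ℝ) • (krausDual w 1 * x + x * krausDual w 1)

lemma dualGenerator_add (w : ι → 𝒜) (x y : 𝒜) :
    dualGenerator w (x + y) = dualGenerator w x + dualGenerator w y := by
  simp only [dualGenerator, krausDual_add, mul_add, add_mul, smul_add]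
  abel

lemma dualGenerator_smul (w : ι → 𝒜) (r : ℝ) (x : 𝒜) :
    dualGenerator w (r • x) = r • dualGenerator w x := by
  simp only [dualGenerator, krausDual_smul, mul_smul_comm, smul_mul_assoc, smul_sub, smul_add,
    smul_comm r]

lemma dualGenerator_sum {σ : Type*} (w : ι → 𝒜) (s : Finset σ) (x : σ → 𝒜) :
    dualGenerator w (∑ i ∈ s, x i) = ∑ i ∈ s, dualGenerator w (x i) := by
  simp only [dualGenerator, krausDual_sum, Finset.mul_sum, Finset.sum_mul,
    ← Finset.sum_add_distrib, Finset.smul_sum, ← Finset.sum_sub_distrib]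

/-- A generator annihilates every observable that commutes with its jumps. -/
lemma dualGenerator_eq_zero_of_commute {w : ι → 𝒜} {x : 𝒜} (h : ∀ α, Commute x (w α))
    (h' : ∀ α, Commute x (star (w α))) : dualGenerator w x = 0 := by
  have h1 := krausDual_mul_of_commute w (x := 1) h
  have h2 := krausDual_mul_of_commute_left w (x := 1) h'
  rw [one_mul] at h1
  rw [mul_one] at h2
  rw [dualGenerator, ← h1, ← h2, ← two_smul ℝ, smul_smul]
  norm_num

/-- The jumps of all the families `L e` and `K i`, as one family. -/
def joinJumps {E V : Type*} (L : E → ι → 𝒜) (K : V → κ → 𝒜) : (E × ι) ⊕ (V × κ) → 𝒜 :=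
  Sum.elim (fun x => L x.1 x.2) fun x => K x.1 x.2

variable {E V : Type*} [Fintype E] [Fintype V]

lemma krausDual_joinJumps (L : E → ι → 𝒜) (K : V → κ → 𝒜) (x : 𝒜) :
    krausDual (joinJumps L K) x = ∑ e, krausDual (L e) x + ∑ i, krausDual (K i) x := by
  simp [krausDual, joinJumps, Fintype.sum_sum_type, Fintype.sum_prod_type]

lemma dualGenerator_joinJumps (L : E → ι → 𝒜) (K : V → κ → 𝒜) (x : 𝒜) :
    dualGenerator (joinJumps L K) x = ∑ e, dualGenerator (L e) x + ∑ i, dualGenerator (K i) x := by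
  simp only [dualGenerator, krausDual_joinJumps, add_mul, mul_add, Finset.sum_mul, Finset.mul_sum,
    Finset.sum_sub_distrib, Finset.sum_add_distrib, Finset.smul_sum, smul_add]
  abel

end Generator

/-- A network of local algebras `𝒟` at the vertices `V`, inside one algebra `𝒜`, with a family of
bare jumps on every edge. At each vertex there are a dressing close to the identity, a projection
`complement` annihilated by the jumps of the adjacent edges, and a family `pump` of operators
which map its range into its orthogonal complement. -/
structure DressedNetwork (𝒟 𝒜 V E ι κ : Type*) [CStarAlgebra 𝒟] [CStarAlgebra 𝒜] [Fintype ι]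
    [Fintype κ] (ε : ℝ) where
  /-- the embedding of the algebra at a vertex -/
  site : V → 𝒟 →⋆ₐ[ℂ] 𝒜
  /-- the end points of an edge -/
  ends : E → Finset V
  /-- the dressing at a vertex -/
  dress : V → 𝒟
  /-- the inverse of the dressing -/
  undress : V → 𝒟
  /-- the projection onto the states which are pumped away at a vertex -/
  complement : V → 𝒟
  /-- the operators which empty the range of `complement` -/
  pump : V → κ → 𝒟
  /-- the bare jumps of an edge -/
  bond : E → ι → 𝒜
  site_commute : ∀ {i j}, i ≠ j → ∀ x y, Commute (site i x) (site j y)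
  card_ends : ∀ e, (ends e).card ≤ 2
  isDressing : ∀ i, IsDressing (dress i) (undress i) ε
  complement_mul_self : ∀ i, complement i * complement i = complement i
  complement_dress : ∀ i, Commute (complement i) (dress i)
  complement_undress : ∀ i, Commute (complement i) (undress i)
  complement_mul_pump : ∀ i k, complement i * pump i k = 0
  krausDual_pump : ∀ i, krausDual (pump i) 1 = complement i
  isBondKraus : ∀ e, IsBondKraus (bond e)
  bond_commute : ∀ {e f}, e ≠ f → ∀ α β, Commute (bond e α) (bond f β)
  bond_commute_star : ∀ {e f}, e ≠ f → ∀ α β, Commute (bond e α) (star (bond f β))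
  site_commute_bond : ∀ {i e}, i ∉ ends e → ∀ x α, Commute (site i x) (bond e α)
  complement_mul_bond : ∀ {i e}, i ∈ ends e → ∀ α, site i (complement i) * bond e α = 0
  bond_mul_complement : ∀ {i e}, i ∈ ends e → ∀ α, bond e α * site i (complement i) = 0

lemma IsDressing.mul {𝒜 : Type*} [CStarAlgebra 𝒜] {g z g' z' : 𝒜} {ε ε' : ℝ}
    (h : IsDressing g z ε) (h' : IsDressing g' z' ε') (hg : Commute g g') (hz : Commute z z') :
    IsDressing (g * g') (z * z') (ε + ε' + ε * ε') := by
  have key : ∀ {a b : 𝒜}, Commute a b → ‖a * a - 1‖ ≤ ε → ‖b * b - 1‖ ≤ ε' →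
      ‖a * b * (a * b) - 1‖ ≤ ε + ε' + ε * ε' := by
    intro a b hab ha hb
    have e : a * b * (a * b) - 1
        = (a * a - 1) + (b * b - 1) + (a * a - 1) * (b * b - 1) := by
      calc a * b * (a * b) - 1 = a * (b * a) * b - 1 := by noncomm_ring
        _ = a * (a * b) * b - 1 := by rw [hab.eq]
        _ = _ := by noncomm_ring
    rw [e]
    refine (norm_add₃_le).trans (add_le_add (add_le_add ha hb) ?_)
    exact (norm_mul_le _ _).trans
      (mul_le_mul ha hb (norm_nonneg _) ((norm_nonneg _).trans ha))
  refine ⟨?_, ?_, ?_, ?_, key hg h.norm_fst h'.norm_fst, key hz h.norm_snd h'.norm_snd⟩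
  · rw [IsSelfAdjoint, star_mul, h.isSelfAdjoint_fst.star_eq, h'.isSelfAdjoint_fst.star_eq, hg.eq]
  · rw [IsSelfAdjoint, star_mul, h.isSelfAdjoint_snd.star_eq, h'.isSelfAdjoint_snd.star_eq, hz.eq]
  · rw [hz.eq]
    calc g * g' * (z' * z) = g * (g' * z') * z := by noncomm_ring
      _ = 1 := by rw [h'.mul_eq_one, mul_one, h.mul_eq_one]
  · rw [hg.eq]
    calc z * z' * (g' * g) = z * (z' * g') * g := by noncomm_ring
      _ = 1 := by rw [h'.mul_eq_one', mul_one, h.mul_eq_one']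

namespace DressedNetwork

variable {𝒟 𝒜 V E ι κ : Type*} [CStarAlgebra 𝒟] [CStarAlgebra 𝒜] [Fintype ι] [Fintype κ] {ε₀ : ℝ}
  (W : DressedNetwork 𝒟 𝒜 V E ι κ ε₀)

lemma site_commute_star_bond {i : V} {e : E} (h : i ∉ W.ends e) (x : 𝒟) (α : ι) :
    Commute (W.site i x) (star (W.bond e α)) := by
  have := (W.site_commute_bond h (star x) α).star_star
  rwa [map_star, star_star] at this

lemma pairwise_commute (x : V → 𝒟) (T : Finset V) :
    (T : Set V).Pairwise (Function.onFun Commute fun i => W.site i (x i)) :=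
  fun _ _ _ _ h => W.site_commute h _ _

/-- The tensor product of the local operators `x i`, `i ∈ T`. -/
def prod (x : V → 𝒟) (T : Finset V) : 𝒜 :=
  T.noncommProd (fun i => W.site i (x i)) (W.pairwise_commute x T)

lemma commute_prod {y : 𝒜} {x : V → 𝒟} {T : Finset V}
    (h : ∀ i ∈ T, Commute y (W.site i (x i))) : Commute y (W.prod x T) :=
  Finset.noncommProd_commute _ _ _ _ h

lemma site_commute_prod {i : V} {x y : V → 𝒟} (T : Finset V) (h : Commute (x i) (y i)) :
    Commute (W.site i (x i)) (W.prod y T) := by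
  refine W.commute_prod fun j _ => ?_
  rcases eq_or_ne i j with rfl | hij
  · exact h.map (W.site i)
  · exact W.site_commute hij _ _

/-- The dressed jumps of an edge. -/
def jump (e : E) (α : ι) : 𝒜 :=
  W.prod W.dress (W.ends e) * W.bond e α * W.prod W.undress (W.ends e)

lemma site_commute_jump {i : V} {e : E} (h : i ∉ W.ends e) (x : 𝒟) (α : ι) :
    Commute (W.site i x) (W.jump e α) := by
  have hp : ∀ y : V → 𝒟, Commute (W.site i x) (W.prod y (W.ends e)) := fun y =>
    W.commute_prod fun j hj => W.site_commute (by rintro rfl; exact h hj) _ _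
  exact ((hp _).mul_right (W.site_commute_bond h x α)).mul_right (hp _)

lemma site_commute_star_jump {i : V} {e : E} (h : i ∉ W.ends e) (x : 𝒟) (α : ι) :
    Commute (W.site i x) (star (W.jump e α)) := by
  have := (W.site_commute_jump h (star x) α).star_star
  rwa [map_star, star_star] at this

lemma complement_mul_jump {i : V} {e : E} (h : i ∈ W.ends e) (α : ι) :
    W.site i (W.complement i) * W.jump e α = 0 := by
  rw [jump, ← mul_assoc, ← mul_assoc,
    (W.site_commute_prod (x := W.complement) (W.ends e) (W.complement_dress i)).eq,
    mul_assoc (W.prod _ _), W.complement_mul_bond h, mul_zero, zero_mul]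

lemma jump_mul_complement {i : V} {e : E} (h : i ∈ W.ends e) (α : ι) :
    W.jump e α * W.site i (W.complement i) = 0 := by
  rw [jump, mul_assoc,
    ← (W.site_commute_prod (x := W.complement) (W.ends e) (W.complement_undress i)).eq,
    ← mul_assoc, mul_assoc (W.prod _ _), W.bond_mul_complement h, mul_zero, zero_mul]

/-- The energy `∑ α, (L e α)† L e α` of an edge. -/
def edgeEnergy (e : E) : 𝒜 := krausDual (W.jump e) 1

/-- The pumping operators of a vertex, in the whole algebra. -/
def sitePump (i : V) (k : κ) : 𝒜 := W.site i (W.pump i k)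

/-- The complement projection of a vertex, in the whole algebra. -/
def siteEnergy (i : V) : 𝒜 := W.site i (W.complement i)

lemma krausDual_sitePump (i : V) : krausDual (W.sitePump i) 1 = W.siteEnergy i := by
  rw [siteEnergy, ← W.krausDual_pump, krausDual, krausDual, map_sum]
  simp [sitePump, map_star]

variable [DecidableEq V]

lemma prod_union {x : V → 𝒟} {S T : Finset V} (h : Disjoint S T) :
    W.prod x (S ∪ T) = W.prod x S * W.prod x T :=
  Finset.noncommProd_union_of_disjoint h _ _

lemma prod_insert {x : V → 𝒟} {i : V} {T : Finset V} (h : i ∉ T) :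
    W.prod x (insert i T) = W.site i (x i) * W.prod x T :=
  Finset.noncommProd_insert_of_notMem _ _ _ _ h

lemma isDressing_prod (T : Finset V) :
    IsDressing (W.prod W.dress T) (W.prod W.undress T) ((1 + ε₀) ^ T.card - 1) := by
  induction T using Finset.induction_on with
  | empty => 
    refine ⟨?_, ?_, ?_, ?_, ?_, ?_⟩ <;> simp [prod]
  | insert i T hi ih =>
    have h1 : IsDressing (W.site i (W.dress i)) (W.site i (W.undress i)) ε₀ := by
      have h := W.isDressing i
      refine ⟨h.isSelfAdjoint_fst.map _, h.isSelfAdjoint_snd.map _, ?_, ?_, ?_, ?_⟩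
      · rw [← map_mul, h.mul_eq_one, map_one]
      · rw [← map_mul, h.mul_eq_one', map_one]
      · rw [← map_mul, ← map_one (W.site i), ← map_sub]
        exact (NonUnitalStarAlgHom.norm_apply_le (W.site i) _).trans h.norm_fst
      · rw [← map_mul, ← map_one (W.site i), ← map_sub]
        exact (NonUnitalStarAlgHom.norm_apply_le (W.site i) _).trans h.norm_snd
    rw [prod_insert W hi, prod_insert W hi, Finset.card_insert_of_notMem hi]
    convert h1.mul ih (W.site_commute_prod T (Commute.refl _))
      (W.site_commute_prod T (Commute.refl _)) using 1
    rw [pow_succ]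
    ring

lemma isDressing_union (e f : E) {ε : ℝ} (h0 : 0 ≤ ε₀) (hε : (1 + ε₀) ^ 4 - 1 ≤ ε) :
    IsDressing (W.prod W.dress (W.ends e ∪ W.ends f)) (W.prod W.undress (W.ends e ∪ W.ends f))
      ε := by
  have h := W.isDressing_prod (W.ends e ∪ W.ends f)
  have hc : (W.ends e ∪ W.ends f).card ≤ 4 :=
    (Finset.card_union_le _ _).trans (add_le_add (W.card_ends e) (W.card_ends f))
  have hle : (1 + ε₀) ^ (W.ends e ∪ W.ends f).card - 1 ≤ ε :=
    (sub_le_sub_right (pow_le_pow_right₀ (by linarith) hc) 1).trans hε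
  exact ⟨h.1, h.2, h.3, h.4, h.5.trans hle, h.6.trans hle⟩

/-- The dressing may be enlarged to any set of vertices, since it cancels away from the edge. -/
lemma jump_eq {e : E} {T : Finset V} (h : W.ends e ⊆ T) (α : ι) :
    W.jump e α = W.prod W.dress T * W.bond e α * W.prod W.undress T := by
  have hT : T = W.ends e ∪ (T \ W.ends e) := (Finset.union_sdiff_of_subset h).symm
  have hd : Disjoint (W.ends e) (T \ W.ends e) := Finset.disjoint_sdiff
  have h1 : Commute (W.bond e α) (W.prod W.dress (T \ W.ends e)) := W.commute_prod fun i hi =>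
    (W.site_commute_bond (Finset.mem_sdiff.1 hi).2 _ α).symm
  have h2 : Commute (W.prod W.dress (T \ W.ends e)) (W.prod W.undress (W.ends e)) := by
    refine W.commute_prod fun i hi => Commute.symm (W.commute_prod fun j hj => ?_)
    refine W.site_commute ?_ _ _
    rintro rfl
    exact (Finset.mem_sdiff.1 hj).2 hi
  have h3 := (W.isDressing_prod (T \ W.ends e)).mul_eq_one
  rw [hT, prod_union W hd, prod_union W hd, jump]
  set g := W.prod W.dress (W.ends e)
  set z := W.prod W.undress (W.ends e)
  set g' := W.prod W.dress (T \ W.ends e)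
  set z' := W.prod W.undress (T \ W.ends e)
  calc g * W.bond e α * z = g * W.bond e α * z * (g' * z') := by rw [h3, mul_one]
    _ = g * W.bond e α * (z * g') * z' := by noncomm_ring
    _ = g * W.bond e α * (g' * z) * z' := by rw [h2.eq]
    _ = g * (W.bond e α * g') * (z * z') := by noncomm_ring
    _ = g * (g' * W.bond e α) * (z * z') := by rw [h1.eq]
    _ = _ := by noncomm_ring

omit [DecidableEq V] in
lemma jump_commute_of_disjoint {e f : E} (hef : e ≠ f) (h : Disjoint (W.ends e) (W.ends f))
    (α β : ι) : Commute (W.jump e α) (W.jump f β) := by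
  have hp : ∀ y : V → 𝒟, Commute (W.prod y (W.ends f)) (W.jump e α) := fun y =>
    Commute.symm (W.commute_prod fun j hj =>
      (W.site_commute_jump (Finset.disjoint_right.1 h hj) _ α).symm)
  have hb : Commute (W.bond f β) (W.jump e α) := by
    have hq : ∀ y : V → 𝒟, Commute (W.bond f β) (W.prod y (W.ends e)) := fun y =>
      W.commute_prod fun j hj => (W.site_commute_bond (Finset.disjoint_left.1 h hj) _ β).symm
    exact ((hq _).mul_right (W.bond_commute hef.symm β α)).mul_right (hq _)
  exact Commute.symm (((hp _).mul_left hb).mul_left (hp _))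

omit [DecidableEq V] in
lemma jump_commute_star_of_disjoint {e f : E} (hef : e ≠ f)
    (h : Disjoint (W.ends e) (W.ends f)) (α β : ι) :
    Commute (W.jump e α) (star (W.jump f β)) := by
  have hp : ∀ y : V → 𝒟, Commute (star (W.prod y (W.ends f))) (W.jump e α) := fun y => by
    have : Commute (W.prod y (W.ends f)) (star (W.jump e α)) :=
      Commute.symm (W.commute_prod fun j hj =>
        (W.site_commute_star_jump (Finset.disjoint_right.1 h hj) _ α).symm)
    simpa using this.star_star
  have hb : Commute (star (W.bond f β)) (W.jump e α) := by
    have hq : ∀ y : V → 𝒟, Commute (star (W.bond f β)) (W.prod y (W.ends e)) := fun y =>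
      W.commute_prod fun j hj => (W.site_commute_star_bond (Finset.disjoint_left.1 h hj) _ β).symm
    exact ((hq _).mul_right (W.bond_commute_star hef α β).symm).mul_right (hq _)
  have : star (W.jump f β) = star (W.prod W.undress (W.ends f)) * star (W.bond f β)
      * star (W.prod W.dress (W.ends f)) := by
    simp only [jump, star_mul, mul_assoc]
  rw [this]
  exact Commute.symm (((hp _).mul_left hb).mul_left (hp _))

lemma edgeEnergy_eq {e : E} {T : Finset V} (h : W.ends e ⊆ T) :
    W.edgeEnergy e = dressedEnergy (W.prod W.dress T) (W.prod W.undress T) (W.bond e) := by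
  rw [edgeEnergy, dressedEnergy]
  congr 1
  funext α
  exact W.jump_eq h α

variable [PartialOrder 𝒜] [StarOrderedRing 𝒜]

omit [DecidableEq V] in
lemma edgeEnergy_nonneg (e : E) : 0 ≤ W.edgeEnergy e := krausDual_nonneg _ zero_le_one

omit [DecidableEq V] in
lemma siteEnergy_nonneg (i : V) : 0 ≤ W.siteEnergy i := by
  rw [← krausDual_sitePump]; exact krausDual_nonneg _ zero_le_one

omit [DecidableEq V] in
lemma siteEnergy_le_one (i : V) : W.siteEnergy i ≤ 1 := by
  have hs : star (W.siteEnergy i) = W.siteEnergy i := (W.siteEnergy_nonneg i).isSelfAdjoint.star_eq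
  have hm : W.siteEnergy i * W.siteEnergy i = W.siteEnergy i := by
    rw [siteEnergy, ← map_mul, W.complement_mul_self]
  rw [← sub_nonneg]
  have : 1 - W.siteEnergy i = star (1 - W.siteEnergy i) * (1 - W.siteEnergy i) := by
    rw [star_sub, star_one, hs]
    simp [mul_sub, sub_mul, hm]
  rw [this]
  exact star_mul_self_nonneg _

section Bounds

variable {ε : ℝ} (h0 : 0 ≤ ε₀) (hε : (1 + ε₀) ^ 4 - 1 ≤ ε) (hε' : ε ≤ 1 / 8)
include h0 hε hε'

lemma edgeEnergy_le_two (e : E) : W.edgeEnergy e ≤ (2 : ℝ) • (1 : 𝒜) := by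
  rw [W.edgeEnergy_eq (Finset.subset_union_left (s₂ := W.ends e))]
  exact dressedEnergy_le_two (W.isDressing_union e e h0 hε) (W.isBondKraus e) (by linarith)

lemma dualGenerator_jump_self_le (e : E) :
    dualGenerator (W.jump e) (W.edgeEnergy e) ≤ -((1 - 5 * ε) • W.edgeEnergy e) := by
  have hT : W.ends e ⊆ W.ends e ∪ W.ends e := Finset.subset_union_left
  have hD := W.isDressing_union e e h0 hε
  have h1 := smul_dressedEnergy_le_sq hD (W.isBondKraus e) hε'
  have h2 := krausDual_dressed_self hD (W.isBondKraus e)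
  rw [← W.edgeEnergy_eq hT] at h1 h2
  have hJ : W.jump e = fun α => W.prod W.dress (W.ends e ∪ W.ends e) * W.bond e α
      * W.prod W.undress (W.ends e ∪ W.ends e) := funext fun α => W.jump_eq hT α
  rw [← hJ] at h2
  rw [dualGenerator, h2, ← edgeEnergy, ← two_smul ℝ, smul_smul, zero_sub]
  norm_num
  exact h1

/-- Two distinct edges: the first dissipator acts on the second energy only if they meet, and then
weakly. -/
lemma dualGenerator_jump_le {e f : E} (hef : e ≠ f) :
    dualGenerator (W.jump f) (W.edgeEnergy e)
      ≤ (4 * ε) • (W.edgeEnergy e + W.edgeEnergy f) := by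
  have hT : W.ends e ⊆ W.ends e ∪ W.ends f := Finset.subset_union_left
  have hT' : W.ends f ⊆ W.ends e ∪ W.ends f := Finset.subset_union_right
  have h := krausDual_dressed_sub_le (W.isDressing_union e f h0 hε) (W.isBondKraus e)
    (W.isBondKraus f) (W.bond_commute hef) (W.bond_commute_star hef) hε'
  rw [← W.edgeEnergy_eq hT, ← W.edgeEnergy_eq hT'] at h
  have hJ : W.jump f = fun α => W.prod W.dress (W.ends e ∪ W.ends f) * W.bond f α
      * W.prod W.undress (W.ends e ∪ W.ends f) := funext fun α => W.jump_eq hT' α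
  rw [← hJ] at h
  exact h

omit [PartialOrder 𝒜] [StarOrderedRing 𝒜] h0 hε hε' [DecidableEq V] in
lemma dualGenerator_jump_eq_zero {e f : E} (hef : e ≠ f) (h : Disjoint (W.ends e) (W.ends f)) :
    dualGenerator (W.jump f) (W.edgeEnergy e) = 0 := by
  refine dualGenerator_eq_zero_of_commute (fun β => ?_) fun β => ?_
  · refine Commute.sum_left _ _ _ fun α _ => ?_
    rw [mul_one]
    refine Commute.mul_left ?_ (W.jump_commute_of_disjoint hef h α β)
    exact (W.jump_commute_star_of_disjoint hef.symm h.symm β α).symm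
  · refine Commute.sum_left _ _ _ fun α _ => ?_
    rw [mul_one]
    refine Commute.mul_left ?_ (W.jump_commute_star_of_disjoint hef h α β)
    exact (W.jump_commute_of_disjoint hef h α β).star_star

omit [PartialOrder 𝒜] [StarOrderedRing 𝒜] h0 hε hε' in
lemma dualGenerator_jump_siteEnergy (e : E) (i : V) :
    dualGenerator (W.jump e) (W.siteEnergy i) = 0 := by
  by_cases h : i ∈ W.ends e
  · have h1 : krausDual (W.jump e) (W.siteEnergy i) = 0 :=
      Finset.sum_eq_zero fun α _ => by
        rw [mul_assoc, siteEnergy, W.complement_mul_jump h, mul_zero]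
    have h2 : krausDual (W.jump e) 1 * W.siteEnergy i = 0 := by
      rw [krausDual, Finset.sum_mul]
      exact Finset.sum_eq_zero fun α _ => by
        rw [mul_assoc, siteEnergy, W.jump_mul_complement h, mul_zero]
    have hs : star (W.siteEnergy i) = W.siteEnergy i := by
      rw [← krausDual_sitePump, star_krausDual, star_one]
    have h3 : W.siteEnergy i * krausDual (W.jump e) 1 = 0 := by
      have := congrArg star h2
      rwa [star_mul, hs, star_krausDual, star_one, star_zero] at this
    rw [dualGenerator, h1, h2, h3]
    simp
  · exact dualGenerator_eq_zero_of_commute (fun α => W.site_commute_jump h _ α)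
      fun α => W.site_commute_star_jump h _ α

omit [PartialOrder 𝒜] [StarOrderedRing 𝒜] h0 hε hε' [DecidableEq V] in
lemma dualGenerator_sitePump_siteEnergy (i : V) :
    dualGenerator (W.sitePump i) (W.siteEnergy i) = -W.siteEnergy i := by
  have h1 : krausDual (W.sitePump i) (W.siteEnergy i) = 0 :=
    Finset.sum_eq_zero fun k _ => by
      rw [mul_assoc, siteEnergy, sitePump, ← map_mul, W.complement_mul_pump, map_zero, mul_zero]
  have hm : W.siteEnergy i * W.siteEnergy i = W.siteEnergy i := by
    rw [siteEnergy, ← map_mul, W.complement_mul_self]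
  rw [dualGenerator, h1, krausDual_sitePump, hm, ← two_smul ℝ, smul_smul, zero_sub]
  norm_num

omit [PartialOrder 𝒜] [StarOrderedRing 𝒜] h0 hε hε' [DecidableEq V] in
lemma dualGenerator_sitePump_siteEnergy_of_ne {i j : V} (h : i ≠ j) :
    dualGenerator (W.sitePump i) (W.siteEnergy j) = 0 := by
  refine dualGenerator_eq_zero_of_commute (fun k => W.site_commute h.symm _ _) fun k => ?_
  rw [sitePump, ← map_star]
  exact W.site_commute h.symm _ _

omit [PartialOrder 𝒜] [StarOrderedRing 𝒜] h0 hε hε' [DecidableEq V] in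
lemma dualGenerator_sitePump_edgeEnergy_of_notMem {i : V} {e : E} (h : i ∉ W.ends e) :
    dualGenerator (W.sitePump i) (W.edgeEnergy e) = 0 := by
  have hc : ∀ x, Commute (W.edgeEnergy e) (W.site i x) := fun x => by
    refine Commute.sum_left _ _ _ fun α _ => ?_
    rw [mul_one]
    exact ((W.site_commute_star_jump h x α).symm).mul_left (W.site_commute_jump h x α).symm
  refine dualGenerator_eq_zero_of_commute (fun k => hc _) fun k => ?_
  rw [sitePump, ← map_star]
  exact hc _

lemma dualGenerator_sitePump_edgeEnergy_le {i : V} {e : E} (h : i ∈ W.ends e) :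
    dualGenerator (W.sitePump i) (W.edgeEnergy e) ≤ (2 : ℝ) • W.siteEnergy i := by
  have h1 : krausDual (W.sitePump i) (W.edgeEnergy e) ≤ (2 : ℝ) • W.siteEnergy i := by
    refine (krausDual_mono _ (W.edgeEnergy_le_two h0 hε hε' e)).trans (le_of_eq ?_)
    rw [krausDual_smul, krausDual_sitePump]
  have h2 : W.edgeEnergy e * W.siteEnergy i = 0 := by
    rw [edgeEnergy, krausDual, Finset.sum_mul]
    exact Finset.sum_eq_zero fun α _ => by
      rw [mul_assoc, siteEnergy, W.jump_mul_complement h, mul_zero]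
  have h3 : W.siteEnergy i * W.edgeEnergy e = 0 := by
    have := congrArg star h2
    rwa [star_mul, (W.siteEnergy_nonneg i).isSelfAdjoint.star_eq,
      (W.edgeEnergy_nonneg e).isSelfAdjoint.star_eq, star_zero] at this
  rw [dualGenerator, krausDual_sitePump, h2, h3]
  simpa using h1

end Bounds

variable [Fintype V] [Fintype E]

/-- The total energy. The weight of the vertex terms compensates the energy that the pumps at a
vertex deposit on the adjacent edges. -/
def energy (m : ℕ) : 𝒜 := ∑ e, W.edgeEnergy e + (4 * m : ℝ) • ∑ i, W.siteEnergy i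

/-- All jumps of the network. -/
def jumps : (E × ι) ⊕ (V × κ) → 𝒜 := joinJumps W.jump W.sitePump

omit [DecidableEq V] in
lemma krausDual_jumps_le {m : ℕ} (hm : 1 ≤ m) : krausDual W.jumps 1 ≤ W.energy m := by
  rw [jumps, krausDual_joinJumps, energy]
  simp only [krausDual_sitePump]
  refine add_le_add le_rfl ?_
  have hm' : (1 : ℝ) ≤ m := by exact_mod_cast hm
  calc ∑ i, W.siteEnergy i = (1 : ℝ) • ∑ i, W.siteEnergy i := (one_smul _ _).symm
    _ ≤ _ := smul_le_smul_of_nonneg_right (by linarith)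
      (Finset.sum_nonneg fun i _ => W.siteEnergy_nonneg i)

variable {ε : ℝ} (h0 : 0 ≤ ε₀) (hε : (1 + ε₀) ^ 4 - 1 ≤ ε) {m : ℕ} (hm : 1 ≤ m)
  (hdeg : ∀ i, (Finset.univ.filter fun e => i ∈ W.ends e).card ≤ m)
include h0 hε hm hdeg

omit [PartialOrder 𝒜] [StarOrderedRing 𝒜] [Fintype V] h0 hε hm in
lemma card_meeting_le (e : E) :
    (Finset.univ.filter fun f => ¬ Disjoint (W.ends e) (W.ends f)).card ≤ 2 * m := by
  classical
  have hsub : (Finset.univ.filter fun f => ¬ Disjoint (W.ends e) (W.ends f))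
      ⊆ (W.ends e).biUnion fun i => Finset.univ.filter fun f => i ∈ W.ends f := by
    intro f hf
    rw [Finset.mem_filter, Finset.not_disjoint_iff] at hf
    obtain ⟨-, i, hi, hi'⟩ := hf
    simp only [Finset.mem_biUnion, Finset.mem_filter, Finset.mem_univ, true_and]
    exact ⟨i, hi, hi'⟩
  refine (Finset.card_le_card hsub).trans (Finset.card_biUnion_le.trans ?_)
  refine (Finset.sum_le_sum fun i _ => hdeg i).trans ?_
  rw [Finset.sum_const, smul_eq_mul]
  exact Nat.mul_le_mul_right m (W.card_ends e)

omit [PartialOrder 𝒜] [StarOrderedRing 𝒜] h0 hε hm in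
lemma card_edge_le (hne : ∀ e, (W.ends e).Nonempty) :
    Fintype.card E ≤ Fintype.card V * m := by
  classical
  have hsub : (Finset.univ : Finset E)
      ⊆ Finset.univ.biUnion fun i => Finset.univ.filter fun f => i ∈ W.ends f := by
    intro f _
    obtain ⟨i, hi⟩ := hne f
    simp only [Finset.mem_biUnion, Finset.mem_filter, Finset.mem_univ, true_and]
    exact ⟨i, hi⟩
  rw [← Finset.card_univ (α := E)]
  refine (Finset.card_le_card hsub).trans (Finset.card_biUnion_le.trans ?_)
  refine (Finset.sum_le_sum fun i _ => hdeg i).trans ?_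
  rw [Finset.sum_const, smul_eq_mul, Finset.card_univ]

lemma energy_le (hεm : 42 * ε * m ≤ 1) (hne : ∀ e, (W.ends e).Nonempty) :
    W.energy m ≤ (6 * (Fintype.card V * m) : ℝ) • (1 : 𝒜) := by
  have hm' : (1 : ℝ) ≤ m := by exact_mod_cast hm
  have hε0 : 0 ≤ ε := by
    refine le_trans ?_ hε
    exact sub_nonneg.2 (one_le_pow₀ (by linarith))
  have hε' : ε ≤ 1 / 8 := by nlinarith
  have h1 : ∑ e, W.edgeEnergy e ≤ (2 * (Fintype.card V * m) : ℝ) • (1 : 𝒜) := by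
    calc ∑ e, W.edgeEnergy e ≤ ∑ _e : E, (2 : ℝ) • (1 : 𝒜) :=
          Finset.sum_le_sum fun e _ => W.edgeEnergy_le_two h0 hε hε' e
      _ = (2 * Fintype.card E : ℝ) • (1 : 𝒜) := by
          rw [Finset.sum_const, Finset.card_univ, ← Nat.cast_smul_eq_nsmul ℝ, smul_smul, mul_comm]
      _ ≤ _ := by
          refine smul_le_smul_of_nonneg_right ?_ zero_le_one
          have := W.card_edge_le hdeg hne
          have h2 : (Fintype.card E : ℝ) ≤ Fintype.card V * m := by exact_mod_cast this
          linarith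
  have h2 : (4 * m : ℝ) • ∑ i, W.siteEnergy i ≤ (4 * (Fintype.card V * m) : ℝ) • (1 : 𝒜) := by
    calc (4 * m : ℝ) • ∑ i, W.siteEnergy i ≤ (4 * m : ℝ) • ∑ _i : V, (1 : 𝒜) :=
          smul_le_smul_of_nonneg_left (Finset.sum_le_sum fun i _ => W.siteEnergy_le_one i)
            (by positivity)
      _ = _ := by
          rw [Finset.sum_const, Finset.card_univ, ← Nat.cast_smul_eq_nsmul ℝ, smul_smul]
          congr 1
          ring
  calc W.energy m ≤ _ := add_le_add h1 h2
    _ = _ := by rw [← add_smul]; congr 1; ring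

/-- The energy of the network decays at rate `1/2`, if the dressing is small compared to the
inverse of the degree. -/
theorem dualGenerator_energy_le (hεm : 42 * ε * m ≤ 1) :
    dualGenerator W.jumps (W.energy m) ≤ -((1 / 2 : ℝ) • W.energy m) := by
  classical
  have hm' : (1 : ℝ) ≤ m := by exact_mod_cast hm
  have hε0 : 0 ≤ ε := by
    refine le_trans ?_ hε
    exact sub_nonneg.2 (one_le_pow₀ (by linarith))
  have hε' : ε ≤ 1 / 8 := by nlinarith
  set A := ∑ e, W.edgeEnergy e with hA
  set B := ∑ i, W.siteEnergy i with hB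
  have hA0 : 0 ≤ A := Finset.sum_nonneg fun e _ => W.edgeEnergy_nonneg e
  have hB0 : 0 ≤ B := Finset.sum_nonneg fun i _ => W.siteEnergy_nonneg i
  -- the edge dissipators on the edge energies
  have hEE : ∑ f, dualGenerator (W.jump f) A ≤ -((1 - 5 * ε) • A) + (16 * ε * m) • A := by
    have hb : ∀ f e, dualGenerator (W.jump f) (W.edgeEnergy e)
        ≤ (if e = f then -((1 - 5 * ε) • W.edgeEnergy e) else 0)
          + (if ¬ Disjoint (W.ends e) (W.ends f) then
              (4 * ε) • (W.edgeEnergy e + W.edgeEnergy f) else 0) := by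
      intro f e
      have hpos : 0 ≤ (4 * ε) • (W.edgeEnergy e + W.edgeEnergy f) :=
        smul_nonneg (by positivity) (add_nonneg (W.edgeEnergy_nonneg e) (W.edgeEnergy_nonneg f))
      rcases eq_or_ne e f with rfl | hef
      · rw [if_pos rfl]
        refine (W.dualGenerator_jump_self_le h0 hε hε' e).trans (le_add_of_nonneg_right ?_)
        split_ifs
        · exact le_rfl
        · exact hpos
      · rw [if_neg hef, zero_add]
        split_ifs with h
        · exact (W.dualGenerator_jump_eq_zero hef h).le
        · exact W.dualGenerator_jump_le h0 hε hε' hef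
    have hcount : ∀ e, ∑ f, (if ¬ Disjoint (W.ends e) (W.ends f) then
        (4 * ε) • W.edgeEnergy e else 0) ≤ (8 * ε * m) • W.edgeEnergy e := by
      intro e
      rw [← Finset.sum_filter, Finset.sum_const, ← Nat.cast_smul_eq_nsmul ℝ, smul_smul]
      refine smul_le_smul_of_nonneg_right ?_ (W.edgeEnergy_nonneg e)
      have h1 : ((Finset.univ.filter fun f => ¬ Disjoint (W.ends e) (W.ends f)).card : ℝ)
          ≤ 2 * m := by exact_mod_cast W.card_meeting_le hdeg e
      nlinarith
    have hsum1 : ∑ e, ∑ f, (if ¬ Disjoint (W.ends e) (W.ends f) then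
        (4 * ε) • W.edgeEnergy e else 0) ≤ (8 * ε * m) • A := by
      rw [hA, Finset.smul_sum]
      exact Finset.sum_le_sum fun e _ => hcount e
    have hsum2 : ∑ f, ∑ e, (if ¬ Disjoint (W.ends e) (W.ends f) then
        (4 * ε) • W.edgeEnergy f else 0) ≤ (8 * ε * m) • A := by
      refine le_trans (le_of_eq ?_) hsum1
      refine Finset.sum_congr rfl fun f _ => Finset.sum_congr rfl fun e _ => ?_
      simp only [disjoint_comm]
    calc ∑ f, dualGenerator (W.jump f) A
        = ∑ f, ∑ e, dualGenerator (W.jump f) (W.edgeEnergy e) := by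
          simp only [hA, dualGenerator_sum]
      _ ≤ ∑ f, ∑ e, ((if e = f then -((1 - 5 * ε) • W.edgeEnergy e) else 0)
          + (if ¬ Disjoint (W.ends e) (W.ends f) then
              (4 * ε) • (W.edgeEnergy e + W.edgeEnergy f) else 0)) :=
          Finset.sum_le_sum fun f _ => Finset.sum_le_sum fun e _ => hb f e
      _ = -((1 - 5 * ε) • A)
          + (∑ e, ∑ f, (if ¬ Disjoint (W.ends e) (W.ends f) then
              (4 * ε) • W.edgeEnergy e else 0)
            + ∑ f, ∑ e, (if ¬ Disjoint (W.ends e) (W.ends f) then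
              (4 * ε) • W.edgeEnergy f else 0)) := by
          rw [Finset.sum_comm (f := fun e f => if ¬ Disjoint (W.ends e) (W.ends f) then
              (4 * ε) • W.edgeEnergy e else 0)]
          simp only [Finset.sum_add_distrib, Finset.sum_ite_eq', Finset.mem_univ, if_true,
            Finset.sum_neg_distrib, ← Finset.smul_sum]
          rw [← hA, ← Finset.sum_add_distrib]
          congr 1
          refine Finset.sum_congr rfl fun f _ => ?_
          rw [← Finset.sum_add_distrib]
          refine Finset.sum_congr rfl fun e _ => ?_
          split_ifs <;> simp [smul_add]
      _ ≤ -((1 - 5 * ε) • A) + ((8 * ε * m) • A + (8 * ε * m) • A) := by gcongr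
      _ = _ := by rw [← add_smul]; congr 2; ring
  -- the pumps on the edge energies
  have hVE : ∑ i, dualGenerator (W.sitePump i) A ≤ (2 * m : ℝ) • B := by
    have hb : ∀ i e, dualGenerator (W.sitePump i) (W.edgeEnergy e)
        ≤ if i ∈ W.ends e then (2 : ℝ) • W.siteEnergy i else 0 := by
      intro i e
      split_ifs with h
      · exact W.dualGenerator_sitePump_edgeEnergy_le h0 hε hε' h
      · exact (W.dualGenerator_sitePump_edgeEnergy_of_notMem h).le
    rw [hB, Finset.smul_sum]
    refine Finset.sum_le_sum fun i _ => ?_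
    rw [hA, dualGenerator_sum]
    refine (Finset.sum_le_sum fun e _ => hb i e).trans ?_
    rw [← Finset.sum_filter, Finset.sum_const, ← Nat.cast_smul_eq_nsmul ℝ, smul_smul]
    refine smul_le_smul_of_nonneg_right ?_ (W.siteEnergy_nonneg i)
    have h1 : ((Finset.univ.filter fun e => i ∈ W.ends e).card : ℝ) ≤ m := by
      exact_mod_cast hdeg i
    linarith
  have hEV : ∑ f, dualGenerator (W.jump f) B = 0 :=
    Finset.sum_eq_zero fun f _ => by
      rw [hB, dualGenerator_sum]
      exact Finset.sum_eq_zero fun i _ => W.dualGenerator_jump_siteEnergy f i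
  have hVV : ∑ i, dualGenerator (W.sitePump i) B = -B := by
    rw [hB, ← Finset.sum_neg_distrib]
    refine Finset.sum_congr rfl fun i _ => ?_
    rw [dualGenerator_sum, Finset.sum_eq_single i]
    · exact W.dualGenerator_sitePump_siteEnergy i
    · exact fun j _ hj => W.dualGenerator_sitePump_siteEnergy_of_ne hj.symm
    · simp
  have htot : dualGenerator W.jumps (W.energy m)
      = ∑ f, dualGenerator (W.jump f) A + ∑ i, dualGenerator (W.sitePump i) A
        + (4 * m : ℝ) • (∑ f, dualGenerator (W.jump f) B
          + ∑ i, dualGenerator (W.sitePump i) B) := by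
    rw [energy, ← hA, ← hB, dualGenerator_add, dualGenerator_smul, jumps, dualGenerator_joinJumps,
      dualGenerator_joinJumps]
  rw [htot, hEV, hVV, zero_add, energy, ← hA, ← hB]
  have hcA : (1 / 2 : ℝ) • A ≤ (1 - 5 * ε - 16 * ε * m) • A :=
    smul_le_smul_of_nonneg_right (by nlinarith) hA0
  calc _ ≤ -((1 - 5 * ε) • A) + (16 * ε * m) • A + (2 * m : ℝ) • B + (4 * m : ℝ) • -B := by
        gcongr
    _ = -((1 - 5 * ε - 16 * ε * m) • A) - (2 * m : ℝ) • B := by module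
    _ ≤ -((1 / 2 : ℝ) • A) - (2 * m : ℝ) • B := by gcongr
    _ = _ := by module

end DressedNetwork

end Network


/-! ### Operators acting on one factor of a tensor product -/

section Local
open Matrix
open scoped Kronecker Matrix.Norms.L2Operator MatrixOrder ComplexOrder

section LocOp

variable {K : Type*} {β : K → Type*} [Fintype K] [DecidableEq K] [∀ k, Fintype (β k)]
  [∀ k, DecidableEq (β k)]

/-- `M` acting on the factor `k` of `⨂ k, ℂ^(β k)`, identity on the other factors. -/
def locOp (k : K) (M : Matrix (β k) (β k) ℂ) : Matrix (∀ k, β k) (∀ k, β k) ℂ :=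
  Matrix.of fun s t => if ∀ l, l ≠ k → s l = t l then M (s k) (t k) else 0

omit [∀ k, Fintype (β k)] in
lemma locOp_apply (k : K) (M : Matrix (β k) (β k) ℂ) (s t : ∀ k, β k) :
    locOp k M s t = if ∀ l, l ≠ k → s l = t l then M (s k) (t k) else 0 := rfl

omit [Fintype K] [∀ k, Fintype (β k)] [∀ k, DecidableEq (β k)] in
lemma eq_update_of_forall_ne {k : K} {s t : ∀ k, β k} (h : ∀ l, l ≠ k → s l = t l) :
    t = Function.update s k (t k) := by
  ext l
  by_cases hl : l = k
  · subst hl; simp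
  · rw [Function.update_of_ne hl, h l hl]

lemma locOp_mulVec (k : K) (M : Matrix (β k) (β k) ℂ) (v : (∀ k, β k) → ℂ) (s : ∀ k, β k) :
    (locOp k M *ᵥ v) s = ∑ b, M (s k) b * v (Function.update s k b) := by
  rw [mulVec, dotProduct]
  symm
  refine Fintype.sum_of_injective (fun b => Function.update s k b)
    (Function.update_injective s k) _ _ ?_ ?_
  · intro t ht
    rw [locOp_apply, if_neg, zero_mul]
    exact fun h => ht ⟨t k, (eq_update_of_forall_ne h).symm⟩
  · intro b
    rw [locOp_apply, if_pos]
    · simp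
    · intro l hl
      rw [Function.update_of_ne hl]

lemma locOp_mul_apply {σ : Type*} (k : K) (M : Matrix (β k) (β k) ℂ) (X : Matrix (∀ k, β k) σ ℂ)
    (s : ∀ k, β k) (t : σ) :
    (locOp k M * X) s t = ∑ b, M (s k) b * X (Function.update s k b) t :=
  locOp_mulVec k M (fun s => X s t) s

lemma mul_locOp_apply {σ : Type*} (k : K) (M : Matrix (β k) (β k) ℂ) (X : Matrix σ (∀ k, β k) ℂ)
    (s : σ) (t : ∀ k, β k) :
    (X * locOp k M) s t = ∑ b, X s (Function.update t k b) * M b (t k) := by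
  have h : (locOp k M)ᵀ = locOp k Mᵀ := by
    ext s t
    simp only [locOp_apply, Matrix.transpose_apply]
    have : (∀ l, l ≠ k → s l = t l) ↔ (∀ l, l ≠ k → t l = s l) :=
      forall₂_congr fun _ _ => eq_comm
    simp only [this]
  have h' := locOp_mul_apply k Mᵀ Xᵀ t s
  rw [← h, ← Matrix.transpose_mul, Matrix.transpose_apply] at h'
  rw [h']
  exact Finset.sum_congr rfl fun b _ => mul_comm _ _

lemma matrix_eq_of_mulVec {m n : Type*} [Fintype n] [DecidableEq n] {A B : Matrix m n ℂ}
    (h : ∀ v, A *ᵥ v = B *ᵥ v) : A = B := Matrix.toLin'.injective (LinearMap.ext h)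

/-- The embedding of the matrices on the factor `k`, as a homomorphism. -/
def locHom (k : K) : Matrix (β k) (β k) ℂ →⋆ₐ[ℂ] Matrix (∀ k, β k) (∀ k, β k) ℂ where
  toFun := locOp k
  map_one' := by
    refine matrix_eq_of_mulVec fun v => funext fun s => ?_
    simp [locOp_mulVec, Matrix.one_apply]
  map_mul' M N := by
    refine matrix_eq_of_mulVec fun v => funext fun s => ?_
    rw [← mulVec_mulVec]
    simp only [locOp_mulVec, Matrix.mul_apply, Function.update_self, Function.update_idem,
      Finset.sum_mul, Finset.mul_sum, mul_assoc]
    exact Finset.sum_comm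
  map_zero' := by ext s t; simp [locOp]
  map_add' M N := by
    ext s t
    simp only [locOp, Matrix.of_apply, Matrix.add_apply]
    split_ifs <;> simp
  commutes' c := by
    refine matrix_eq_of_mulVec fun v => funext fun s => ?_
    simp [locOp_mulVec, Algebra.algebraMap_eq_smul_one, Matrix.one_apply, smul_mulVec]
  map_star' M := by
    ext s t
    simp only [locOp, Matrix.of_apply, Matrix.star_apply]
    have : (∀ l, l ≠ k → s l = t l) ↔ (∀ l, l ≠ k → t l = s l) :=
      forall₂_congr fun _ _ => eq_comm
    simp only [this]
    split_ifs <;> simp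

lemma locHom_eq (k : K) (M : Matrix (β k) (β k) ℂ) : locHom k M = locOp k M := rfl

lemma locHom_commute {k l : K} (h : k ≠ l) (M : Matrix (β k) (β k) ℂ)
    (N : Matrix (β l) (β l) ℂ) : Commute (locHom k M) (locHom l N) := by
  refine matrix_eq_of_mulVec fun v => funext fun s => ?_
  change ((locOp k M * locOp l N) *ᵥ v) s = ((locOp l N * locOp k M) *ᵥ v) s
  rw [← mulVec_mulVec, ← mulVec_mulVec]
  simp only [locOp_mulVec, Function.update_of_ne h, Function.update_of_ne h.symm, Finset.mul_sum]
  rw [Finset.sum_comm]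
  refine Finset.sum_congr rfl fun b _ => Finset.sum_congr rfl fun c _ => ?_
  rw [Function.update_comm h, mul_left_comm]

/-- The tensor product of the matrices `A k`. -/
def tensor {γ : K → Type*} (A : ∀ k, Matrix (β k) (γ k) ℂ) :
    Matrix (∀ k, β k) (∀ k, γ k) ℂ :=
  Matrix.of fun s t => ∏ k, A k (s k) (t k)

variable {γ : K → Type*} [∀ k, Fintype (γ k)] [∀ k, DecidableEq (γ k)]

omit [∀ k, Fintype (β k)] [∀ k, DecidableEq (β k)] [∀ k, DecidableEq (γ k)] in
lemma tensor_mul {η : K → Type*} (A : ∀ k, Matrix (β k) (γ k) ℂ) (B : ∀ k, Matrix (γ k) (η k) ℂ) :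
    tensor A * tensor B = tensor fun k => A k * B k := by
  ext s t
  simp only [tensor, Matrix.mul_apply, Matrix.of_apply, ← Finset.prod_mul_distrib]
  exact (Fintype.prod_sum fun k b => A k (s k) b * B k b (t k)).symm

omit [DecidableEq K] [∀ k, Fintype (β k)] in
lemma tensor_one : tensor (fun k => (1 : Matrix (β k) (β k) ℂ)) = 1 := by
  ext s t
  simp only [tensor, Matrix.of_apply, Matrix.one_apply, Finset.prod_ite_zero]
  simp [funext_iff]

/-- An intertwining relation at one factor extends to the tensor product. -/
lemma locOp_mul_tensor {A : ∀ k, Matrix (β k) (γ k) ℂ} {k : K} {M : Matrix (β k) (β k) ℂ}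
    {N : Matrix (γ k) (γ k) ℂ} (h : M * A k = A k * N) :
    locOp k M * tensor A = tensor A * locOp k N := by
  ext s t
  rw [locOp_mul_apply, mul_locOp_apply]
  have h1 : ∀ b, tensor A (Function.update s k b) t
      = A k b (t k) * ∏ l ∈ Finset.univ.erase k, A l (s l) (t l) := by
    intro b
    rw [tensor, Matrix.of_apply, ← Finset.mul_prod_erase _ _ (Finset.mem_univ k),
      Function.update_self]
    congr 1
    refine Finset.prod_congr rfl fun l hl => ?_
    rw [Function.update_of_ne (Finset.ne_of_mem_erase hl)]
  have h2 : ∀ c, tensor A s (Function.update t k c)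
      = A k (s k) c * ∏ l ∈ Finset.univ.erase k, A l (s l) (t l) := by
    intro c
    rw [tensor, Matrix.of_apply, ← Finset.mul_prod_erase _ _ (Finset.mem_univ k),
      Function.update_self]
    congr 1
    refine Finset.prod_congr rfl fun l hl => ?_
    rw [Function.update_of_ne (Finset.ne_of_mem_erase hl)]
  simp only [h1, h2, ← mul_assoc]
  simp only [mul_right_comm _ _ (N _ _)]
  rw [← Finset.sum_mul, ← Finset.sum_mul]
  congr 1
  exact congrFun (congrFun h (s k)) (t k)

end LocOp

section Isometry

variable {m p : Type*} [Fintype m] [Fintype p] [DecidableEq p] [DecidableEq m]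

/-- Conjugation with an isometry. -/
def isometryHom (U : Matrix m p ℂ) (hU : Uᴴ * U = 1) : Matrix p p ℂ →⋆ₙₐ[ℂ] Matrix m m ℂ where
  toFun X := U * X * Uᴴ
  map_smul' c X := by simp
  map_zero' := by simp
  map_add' X Y := by simp [Matrix.mul_add, Matrix.add_mul]
  map_mul' X Y := by
    calc U * (X * Y) * Uᴴ = U * X * (1 : Matrix p p ℂ) * Y * Uᴴ := by simp [Matrix.mul_assoc]
      _ = _ := by rw [← hU]; simp only [Matrix.mul_assoc]
  map_star' X := by simp [Matrix.star_eq_conjTranspose, Matrix.mul_assoc]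

omit [DecidableEq m] in
lemma isometryHom_apply (U : Matrix m p ℂ) (hU : Uᴴ * U = 1) (X : Matrix p p ℂ) :
    isometryHom U hU X = U * X * Uᴴ := rfl

end Isometry

section MatrixUnits

variable {γ 𝒜 : Type*} [Fintype γ] [DecidableEq γ] [CStarAlgebra 𝒜]

/-- The homomorphism determined by a system of matrix units, as a plain map. -/
def ofMatrixUnits (E : γ → γ → 𝒜) (M : Matrix γ γ ℂ) : 𝒜 := ∑ p, ∑ q, M p q • E p q

lemma ofMatrixUnits_mul {E : γ → γ → 𝒜}
    (hE : ∀ p q p' q', E p q * E p' q' = if q = p' then E p q' else 0) (M N : Matrix γ γ ℂ) :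
    ofMatrixUnits E M * ofMatrixUnits E N = ofMatrixUnits E (M * N) := by
  calc ofMatrixUnits E M * ofMatrixUnits E N
      = ∑ p, ∑ q, ∑ p', ∑ q', (if q = p' then (M p q * N p' q') • E p q' else 0) := by
        simp only [ofMatrixUnits, Finset.sum_mul]
        refine Finset.sum_congr rfl fun p _ => Finset.sum_congr rfl fun q _ => ?_
        simp only [Finset.mul_sum, smul_mul_smul_comm, hE, smul_ite, smul_zero]
    _ = ∑ p, ∑ q, ∑ q', (M p q * N q q') • E p q' := by
        refine Finset.sum_congr rfl fun p _ => Finset.sum_congr rfl fun q _ => ?_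
        rw [Finset.sum_comm]
        refine Finset.sum_congr rfl fun q' _ => ?_
        simp
    _ = ∑ p, ∑ q', ∑ q, (M p q * N q q') • E p q' :=
        Finset.sum_congr rfl fun p _ => Finset.sum_comm
    _ = _ := by simp only [ofMatrixUnits, Matrix.mul_apply, Finset.sum_smul]

omit [DecidableEq γ] in
lemma star_ofMatrixUnits {E : γ → γ → 𝒜} (hE : ∀ p q, star (E p q) = E q p)
    (M : Matrix γ γ ℂ) : star (ofMatrixUnits E M) = ofMatrixUnits E Mᴴ := by
  simp only [ofMatrixUnits, star_sum, star_smul, hE]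
  rw [Finset.sum_comm]
  rfl

omit [DecidableEq γ] in
lemma commute_ofMatrixUnits {E : γ → γ → 𝒜} {x : 𝒜} (h : ∀ p q, Commute x (E p q))
    (M : Matrix γ γ ℂ) : Commute x (ofMatrixUnits E M) :=
  Commute.sum_right _ _ _ fun p _ => Commute.sum_right _ _ _ fun q _ => (h p q).smul_right _

end MatrixUnits

section Polar

variable {m p : Type*} [Fintype m] [Fintype p] [DecidableEq p] [DecidableEq m]

/-- `A = U s` with an isometry `U` and a selfadjoint invertible `s`. -/
structure IsPolar (A U : Matrix m p ℂ) (s : Matrix p p ℂ) : Prop where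
  isometry : Uᴴ * U = 1
  selfAdjoint : sᴴ = s
  isUnit_det : IsUnit s.det
  eq_mul : A = U * s

omit [DecidableEq m] in
lemma exists_isPolar {A : Matrix m p ℂ} (hA : Function.Injective A.mulVec) :
    ∃ U s, IsPolar A U s := by
  have hpd : (Aᴴ * A).PosDef := Matrix.PosDef.conjTranspose_mul_self A hA
  have h0 : 0 ≤ Aᴴ * A := Matrix.nonneg_iff_posSemidef.2 hpd.posSemidef
  set s := CFC.sqrt (Aᴴ * A) with hs
  have hss : s * s = Aᴴ * A := CFC.sqrt_mul_sqrt_self _ h0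
  have hsa : sᴴ = s := (CFC.sqrt_nonneg (Aᴴ * A)).isSelfAdjoint.star_eq
  have hdet : IsUnit s.det := by
    have : s.det * s.det = (Aᴴ * A).det := by rw [← Matrix.det_mul, hss]
    refine isUnit_iff_ne_zero.2 fun h => hpd.det_pos.ne' ?_
    rw [← this, h, zero_mul]
  refine ⟨A * s⁻¹, s, ?_, hsa, hdet, ?_⟩
  · rw [Matrix.conjTranspose_mul, Matrix.conjTranspose_nonsing_inv, hsa]
    calc s⁻¹ * Aᴴ * (A * s⁻¹) = s⁻¹ * (Aᴴ * A) * s⁻¹ := by simp only [Matrix.mul_assoc]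
      _ = (s⁻¹ * s) * (s * s⁻¹) := by rw [← hss]; simp only [Matrix.mul_assoc]
      _ = 1 := by rw [Matrix.nonsing_inv_mul _ hdet, Matrix.mul_nonsing_inv _ hdet, mul_one]
  · rw [Matrix.mul_assoc, Matrix.nonsing_inv_mul _ hdet, Matrix.mul_one]

namespace IsPolar

variable {A U : Matrix m p ℂ} {s : Matrix p p ℂ} (h : IsPolar A U s)
include h

omit [DecidableEq m] in
lemma gram_eq : Aᴴ * A = s * s := by
  rw [h.eq_mul, Matrix.conjTranspose_mul, h.selfAdjoint]
  calc s * Uᴴ * (U * s) = s * (Uᴴ * U) * s := by simp only [Matrix.mul_assoc]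
    _ = s * s := by rw [h.isometry, Matrix.mul_one]

omit [DecidableEq m] in
lemma pinv_eq : (Aᴴ * A)⁻¹ * Aᴴ = s⁻¹ * Uᴴ := by
  rw [h.gram_eq, Matrix.mul_inv_rev, h.eq_mul, Matrix.conjTranspose_mul, h.selfAdjoint]
  calc s⁻¹ * s⁻¹ * (s * Uᴴ) = s⁻¹ * (s⁻¹ * s) * Uᴴ := by simp only [Matrix.mul_assoc]
    _ = s⁻¹ * Uᴴ := by rw [Matrix.nonsing_inv_mul _ h.isUnit_det, Matrix.mul_one]

omit [DecidableEq m] in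
lemma proj_eq : A * ((Aᴴ * A)⁻¹ * Aᴴ) = U * Uᴴ := by
  rw [h.pinv_eq, h.eq_mul]
  calc U * s * (s⁻¹ * Uᴴ) = U * (s * s⁻¹) * Uᴴ := by simp only [Matrix.mul_assoc]
    _ = U * Uᴴ := by rw [Matrix.mul_nonsing_inv _ h.isUnit_det, Matrix.mul_one]

omit [DecidableEq m] in
lemma proj_mul_proj : U * Uᴴ * (U * Uᴴ) = U * Uᴴ := by
  calc U * Uᴴ * (U * Uᴴ) = U * (Uᴴ * U) * Uᴴ := by simp only [Matrix.mul_assoc]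
    _ = U * Uᴴ := by rw [h.isometry, Matrix.mul_one]

lemma complement_mul : (1 - U * Uᴴ) * U = 0 := by
  rw [Matrix.sub_mul, Matrix.one_mul, Matrix.mul_assoc, h.isometry, Matrix.mul_one, sub_self]

lemma mul_complement : Uᴴ * (1 - U * Uᴴ) = 0 := by
  rw [Matrix.mul_sub, Matrix.mul_one, ← Matrix.mul_assoc, h.isometry, Matrix.one_mul, sub_self]

lemma complement_mul_self : (1 - U * Uᴴ) * (1 - U * Uᴴ) = 1 - U * Uᴴ := by
  rw [sub_mul, one_mul, mul_sub, mul_one, h.proj_mul_proj, sub_self, sub_zero]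

end IsPolar

/-- `x` transported to the range of the isometry `U`, extended by the identity on the orthogonal
complement. -/
def extendOne (U : Matrix m p ℂ) (x : Matrix p p ℂ) : Matrix m m ℂ := U * x * Uᴴ + (1 - U * Uᴴ)

namespace IsPolar

variable {A U : Matrix m p ℂ} {s : Matrix p p ℂ} (h : IsPolar A U s)
include h

lemma extendOne_mul (x y : Matrix p p ℂ) :
    extendOne U x * extendOne U y = extendOne U (x * y) := by
  have e1 : U * x * Uᴴ * (U * y * Uᴴ) = U * (x * y) * Uᴴ := by
    calc U * x * Uᴴ * (U * y * Uᴴ) = U * x * (Uᴴ * U) * y * Uᴴ := by simp only [Matrix.mul_assoc]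
      _ = _ := by rw [h.isometry, Matrix.mul_one]; simp only [Matrix.mul_assoc]
  have e2 : U * x * Uᴴ * (1 - U * Uᴴ) = 0 := by
    rw [Matrix.mul_assoc, h.mul_complement, Matrix.mul_zero]
  have e3 : (1 - U * Uᴴ) * (U * y * Uᴴ) = 0 := by
    rw [← Matrix.mul_assoc, ← Matrix.mul_assoc, h.complement_mul, Matrix.zero_mul, Matrix.zero_mul]
  rw [extendOne, extendOne, extendOne, mul_add, add_mul, add_mul, e1, e2, e3,
    h.complement_mul_self, add_zero, zero_add]

lemma extendOne_complement (x : Matrix p p ℂ) : Commute (1 - U * Uᴴ) (extendOne U x) := by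
  have e2 : U * x * Uᴴ * (1 - U * Uᴴ) = 0 := by
    rw [Matrix.mul_assoc, h.mul_complement, Matrix.mul_zero]
  have e3 : (1 - U * Uᴴ) * (U * x * Uᴴ) = 0 := by
    rw [← Matrix.mul_assoc, ← Matrix.mul_assoc, h.complement_mul, Matrix.zero_mul, Matrix.zero_mul]
  rw [Commute, SemiconjBy, extendOne, mul_add, add_mul, e2, e3]

lemma extendOne_mul_isometry (x : Matrix p p ℂ) : extendOne U x * U = U * x := by
  rw [extendOne, Matrix.add_mul, h.complement_mul, add_zero, Matrix.mul_assoc, h.isometry,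
    Matrix.mul_one]

lemma isometry_mul_extendOne (x : Matrix p p ℂ) : Uᴴ * extendOne U x = x * Uᴴ := by
  rw [extendOne, Matrix.mul_add, h.mul_complement, add_zero, ← Matrix.mul_assoc,
    ← Matrix.mul_assoc, h.isometry, Matrix.one_mul]

lemma isDressing {δ : ℝ} (hδ : ‖Aᴴ * A - 1‖ ≤ δ) (hδ' : δ ≤ 1 / 2) :
    IsDressing (extendOne U s) (extendOne U s⁻¹) (2 * δ) := by
  have hδ0 : 0 ≤ δ := (norm_nonneg _).trans hδ
  have hone : extendOne U (1 : Matrix p p ℂ) = 1 := by simp [extendOne]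
  have hsa : ∀ x : Matrix p p ℂ, xᴴ = x → IsSelfAdjoint (extendOne U x) := by
    intro x hx
    simp only [IsSelfAdjoint, extendOne, Matrix.star_eq_conjTranspose, Matrix.conjTranspose_add,
      Matrix.conjTranspose_sub, Matrix.conjTranspose_mul, Matrix.conjTranspose_conjTranspose,
      Matrix.conjTranspose_one, hx, Matrix.mul_assoc]
  have hnorm : ∀ x : Matrix p p ℂ, ‖extendOne U x - 1‖ ≤ ‖x - 1‖ := by
    intro x
    have e : extendOne U x - 1 = isometryHom U h.isometry (x - 1) := by
      change U * x * Uᴴ + (1 - U * Uᴴ) - 1 = U * (x - 1) * Uᴴ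
      rw [Matrix.mul_sub, Matrix.sub_mul, Matrix.mul_one]
      abel
    rw [e]
    exact NonUnitalStarAlgHom.norm_apply_le _ _
  have hsi : s * s⁻¹ = 1 := Matrix.mul_nonsing_inv _ h.isUnit_det
  have hsi' : s⁻¹ * s = 1 := Matrix.nonsing_inv_mul _ h.isUnit_det
  rw [h.gram_eq] at hδ
  refine ⟨hsa s h.selfAdjoint, hsa s⁻¹ ?_, ?_, ?_, ?_, ?_⟩
  · rw [Matrix.conjTranspose_nonsing_inv, h.selfAdjoint]
  · rw [h.extendOne_mul, hsi, hone]
  · rw [h.extendOne_mul, hsi', hone]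
  · rw [h.extendOne_mul]
    exact (hnorm _).trans (hδ.trans (by linarith))
  · rw [h.extendOne_mul]
    refine (hnorm _).trans ?_
    rcases subsingleton_or_nontrivial (Matrix p p ℂ) with hs | hs
    · rw [Subsingleton.elim (s⁻¹ * s⁻¹ - 1) 0, norm_zero]
      linarith
    -- this identity turns the bound on `s² - 1` into one on its inverse
    have e : s⁻¹ * s⁻¹ - 1 = -((s⁻¹ * s⁻¹ - 1) * (s * s - 1) + (s * s - 1)) := by
      have : s⁻¹ * s⁻¹ * (s * s) = 1 := by
        calc s⁻¹ * s⁻¹ * (s * s) = s⁻¹ * (s⁻¹ * s) * s := by noncomm_ring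
          _ = 1 := by rw [hsi', mul_one, hsi']
      rw [sub_mul, mul_sub, this]
      noncomm_ring
    have h1 : ‖s⁻¹ * s⁻¹ - 1‖ ≤ ‖s⁻¹ * s⁻¹ - 1‖ * δ + δ := by
      conv_lhs => rw [e, norm_neg]
      refine (norm_add_le _ _).trans (add_le_add ((norm_mul_le _ _).trans ?_) hδ)
      exact mul_le_mul_of_nonneg_left hδ (norm_nonneg _)
    nlinarith [norm_nonneg (s⁻¹ * s⁻¹ - 1)]

/-- The operators `r^{-1/2} P |a⟩⟨b| P^⊥`, with `r` the dimension of the range of `P = U U†`, pump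
the orthogonal complement of that range at unit rate. -/
lemma krausDual_pump [Nonempty p] :
    krausDual (fun x : m × m => ((Real.sqrt (Fintype.card p))⁻¹ : ℂ) •
      (U * Uᴴ * Matrix.single x.1 x.2 (1 : ℂ) * (1 - U * Uᴴ))) 1 = 1 - U * Uᴴ := by
  set Q := U * Uᴴ with hQ
  set q := 1 - Q with hq
  have hQs : star Q = Q := by
    rw [hQ, Matrix.star_eq_conjTranspose, Matrix.conjTranspose_mul,
      Matrix.conjTranspose_conjTranspose]
  have hqs : star q = q := by rw [hq, star_sub, star_one, hQs]
  have hr : (0 : ℝ) < Fintype.card p := by exact_mod_cast Fintype.card_pos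
  have hcc : ((Real.sqrt (Fintype.card p))⁻¹ : ℂ) * ((Real.sqrt (Fintype.card p))⁻¹ : ℂ)
      = ((Fintype.card p : ℂ))⁻¹ := by
    rw [← mul_inv, ← Complex.ofReal_mul, Real.mul_self_sqrt hr.le, Complex.ofReal_natCast]
  have hcs : star ((Real.sqrt (Fintype.card p))⁻¹ : ℂ) = ((Real.sqrt (Fintype.card p))⁻¹ : ℂ) := by
    rw [star_inv₀, Complex.star_def, Complex.conj_ofReal]
  have hterm : ∀ a b : m, star (Q * Matrix.single a b (1 : ℂ) * q)
      * (Q * Matrix.single a b (1 : ℂ) * q) = Q a a • (q * Matrix.single b b (1 : ℂ) * q) := by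
    intro a b
    have h1 : Matrix.single b a (1 : ℂ) * Q * Matrix.single a b (1 : ℂ)
        = Q a a • Matrix.single b b (1 : ℂ) := by
      rw [Matrix.single_mul_mul_single]
      simp
    have h2 : star (Matrix.single a b (1 : ℂ)) = Matrix.single b a (1 : ℂ) := by
      rw [Matrix.star_eq_conjTranspose, Matrix.conjTranspose_single, star_one]
    calc star (Q * Matrix.single a b (1 : ℂ) * q) * (Q * Matrix.single a b (1 : ℂ) * q)
        = q * (Matrix.single b a (1 : ℂ) * (Q * Q) * Matrix.single a b (1 : ℂ)) * q := by
          rw [star_mul, star_mul, hqs, hQs, h2]; noncomm_ring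
      _ = _ := by rw [hQ, h.proj_mul_proj, ← hQ, h1, Matrix.mul_smul, Matrix.smul_mul]
  have hsum : ∑ b : m, q * Matrix.single b b (1 : ℂ) * q = q := by
    rw [← Finset.sum_mul, ← Finset.mul_sum]
    rw [Matrix.sum_single_one, mul_one, h.complement_mul_self]
  have htr : ∑ a, Q a a = (Fintype.card p : ℂ) := by
    change Q.trace = _
    rw [hQ, Matrix.trace_mul_comm, h.isometry, Matrix.trace_one]
  rw [krausDual, Fintype.sum_prod_type]
  simp only [star_smul, hcs, mul_one, smul_mul_smul_comm, hcc, hterm]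
  simp only [← Finset.smul_sum, hsum]
  rw [← Finset.sum_smul, htr, smul_smul, inv_mul_cancel₀, one_smul]
  exact_mod_cast hr.ne'

end IsPolar

end Polar

end Local


/-! ### The parent Lindbladian in Lindblad form -/

section Bridge
open Matrix
open scoped Kronecker Matrix.Norms.L2Operator MatrixOrder ComplexOrder

variable {N d D : ℕ} {G : SimpleGraph (Fin N)} [DecidableRel G.Adj]

section PhysicalOperators

variable (N d) in
/-- The operators on the physical site `i`. -/
abbrev physHom (i : Fin N) :
    Matrix (Fin d) (Fin d) ℂ →⋆ₐ[ℂ] Matrix (Config N d) (Config N d) ℂ :=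
  locHom (β := fun _ : Fin N => Fin d) i

lemma siteOp_eq (i : Fin N) (M : Matrix (Fin d) (Fin d) ℂ) : siteOp i M = physHom N d i M := by
  ext s t
  rw [locHom_eq, locOp_apply, siteOp, Matrix.of_apply]
  congr 1

lemma pairOp_add (i j : Fin N) (M M' : Matrix (Fin d × Fin d) (Fin d × Fin d) ℂ) :
    pairOp i j (M + M') = pairOp i j M + pairOp i j M' := by
  ext s t
  simp only [pairOp, Matrix.of_apply, Matrix.add_apply]
  split_ifs <;> simp

lemma pairOp_smul (i j : Fin N) (c : ℂ) (M : Matrix (Fin d × Fin d) (Fin d × Fin d) ℂ) :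
    pairOp i j (c • M) = c • pairOp i j M := by
  ext s t
  simp only [pairOp, Matrix.of_apply, Matrix.smul_apply]
  split_ifs <;> simp

lemma pairOp_sum {σ : Type*} (i j : Fin N) (u : Finset σ)
    (M : σ → Matrix (Fin d × Fin d) (Fin d × Fin d) ℂ) :
    pairOp i j (∑ x ∈ u, M x) = ∑ x ∈ u, pairOp i j (M x) :=
  map_sum ({ toFun := pairOp i j, map_zero' := by ext; simp [pairOp],
             map_add' := pairOp_add i j } : _ →+ _) M u

lemma pairOp_kronecker {i j : Fin N} (h : i ≠ j) (X Y : Matrix (Fin d) (Fin d) ℂ) :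
    pairOp i j (X ⊗ₖ Y) = physHom N d i X * physHom N d j Y := by
  ext s t
  rw [locHom_eq, locHom_eq, locOp_mul_apply, Finset.sum_eq_single (t i)]
  · simp only [locOp_apply, pairOp, Matrix.of_apply, Function.update_of_ne h.symm,
      Matrix.kroneckerMap_apply]
    have : (∀ l, l ≠ j → Function.update s i (t i) l = t l)
        ↔ ∀ k, k ≠ i → k ≠ j → s k = t k := by
      refine ⟨fun H k hi hj => ?_, fun H k hj => ?_⟩
      · rw [← H k hj, Function.update_of_ne hi]
      · by_cases hi : k = i
        · subst hi; simp
        · rw [Function.update_of_ne hi, H k hi hj]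
    simp only [this]
    split_ifs <;> simp
  · intro b _ hb
    rw [locOp_apply, if_neg, mul_zero]
    intro H
    exact hb (by simpa using H i h)
  · simp

/-- The partial trace at the site `i` does not see the order of the factors at that site. -/
lemma replaceSite_mul_comm (i : Fin N) (P q : Matrix (Fin d) (Fin d) ℂ)
    (X : Matrix (Config N d) (Config N d) ℂ) :
    replaceSite i P (X * physHom N d i q) = replaceSite i P (physHom N d i q * X) := by
  ext s t
  simp only [replaceSite, LinearMap.coe_mk, AddHom.coe_mk, Matrix.of_apply]
  congr 1
  simp only [locHom_eq, mul_locOp_apply, locOp_mul_apply, Function.update_self,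
    Function.update_idem]
  rw [Finset.sum_comm]
  exact Finset.sum_congr rfl fun b _ => Finset.sum_congr rfl fun c _ => mul_comm _ _

/-- A Kraus decomposition of the superoperator which resets the site `i`. -/
lemma sum_single_conj (i : Fin N) (Q : Matrix (Fin d) (Fin d) ℂ)
    (X : Matrix (Config N d) (Config N d) ℂ) :
    ∑ x : Fin d × Fin d, physHom N d i (Q * Matrix.single x.1 x.2 1) * X
        * physHom N d i (Matrix.single x.2 x.1 1 * Q)
      = replaceSite i (Q * Q) X := by
  ext s t
  simp only [replaceSite, LinearMap.coe_mk, AddHom.coe_mk, Matrix.of_apply, Matrix.sum_apply,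
    locHom_eq, mul_locOp_apply, locOp_mul_apply, Fintype.sum_prod_type]
  have h1 : ∀ a b c : Fin d, (Q * Matrix.single a b (1 : ℂ)) (s i) c
      = if c = b then Q (s i) a else 0 := by
    intro a b c
    split_ifs with h
    · subst h; simp
    · exact Matrix.mul_single_apply_of_ne _ _ _ _ _ h _
  have h2 : ∀ a b c : Fin d, (Matrix.single b a (1 : ℂ) * Q) c (t i)
      = if c = b then Q a (t i) else 0 := by
    intro a b c
    split_ifs with h
    · subst h; simp
    · exact Matrix.single_mul_apply_of_ne _ _ _ _ _ h _
  simp only [h1, h2, ite_mul, zero_mul, mul_ite, mul_zero, Finset.sum_ite_eq', Finset.mem_univ,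
    if_true, Matrix.mul_apply, Finset.sum_mul, Finset.mul_sum]
  rw [Finset.sum_comm]
  exact Finset.sum_congr rfl fun a _ => Finset.sum_congr rfl fun b _ => by ring

end PhysicalOperators


omit [DecidableRel G.Adj] in
lemma Edge.fst_ne_snd (e : Edge G) : e.1.1 ≠ e.1.2 := e.2.1.ne

namespace InjectivePEPS

variable (P : InjectivePEPS d D G)

lemma bondOp_eq (e : Edge G) (α : Fin (D ^ 2 - 1)) :
    P.bondOp e α = ∑ p : Fin D × Fin D, ∑ q : Fin D × Fin D,
      (P.phi₀ e p * star (P.phi e α q)) •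
        (locHom (β := fun _ => Fin D) e.legFst (Matrix.single p.1 q.1 1) ⊗ₖ
          locHom (β := fun _ => Fin D) e.legSnd (Matrix.single p.2 q.2 1)) := by
  ext x y
  simp only [Matrix.sum_apply, Matrix.smul_apply, Matrix.kroneckerMap_apply, locHom_eq, locOp_apply,
    smul_eq_mul]
  rw [Finset.sum_eq_single (x.1 e.legFst, x.2 e.legSnd),
    Finset.sum_eq_single (y.1 e.legFst, y.2 e.legSnd)]
  · simp only [bondOp, Matrix.of_apply, Matrix.single_apply_same]
    split_ifs <;> simp_all
  · intro q _ hq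
    rw [mul_eq_zero]
    right
    have : ¬ (q.1 = y.1 e.legFst ∧ q.2 = y.2 e.legSnd) := fun h => hq (Prod.ext h.1 h.2)
    simp only [Matrix.single_apply]
    split_ifs <;> simp_all
  · simp
  · intro p _ hp
    refine Finset.sum_eq_zero fun q _ => ?_
    rw [mul_eq_zero]
    right
    have : ¬ (p.1 = x.1 e.legFst ∧ p.2 = x.2 e.legSnd) := fun h => hp (Prod.ext h.1 h.2)
    simp only [Matrix.single_apply]
    split_ifs <;> simp_all
  · simp

/-- The isometry `U_i` of a polar decomposition `A_i = U_i s_i`. -/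
def iso (i : Fin N) : Matrix (Fin d) (Legs D G i) ℂ := (exists_isPolar (P.A_injective i)).choose

/-- The selfadjoint invertible factor `s_i` of a polar decomposition `A_i = U_i s_i`. -/
def modulus (i : Fin N) : Matrix (Legs D G i) (Legs D G i) ℂ :=
  (exists_isPolar (P.A_injective i)).choose_spec.choose

lemma isPolar (i : Fin N) : IsPolar (P.A i) (P.iso i) (P.modulus i) :=
  (exists_isPolar (P.A_injective i)).choose_spec.choose_spec

lemma pinv_eq (i : Fin N) : P.pinv i = (P.modulus i)⁻¹ * (P.iso i)ᴴ := (P.isPolar i).pinv_eq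

lemma proj_eq (i : Fin N) : P.proj i = P.iso i * (P.iso i)ᴴ := (P.isPolar i).proj_eq

/-- The operator `X` on the virtual qudit `(i, k)`, transported to the physical site `i` by the
isometry `U_i`. -/
def legOp (i : Fin N) (k : G.neighborSet i) (X : Matrix (Fin D) (Fin D) ℂ) :
    Matrix (Config N d) (Config N d) ℂ :=
  physHom N d i (isometryHom (P.iso i) (P.isPolar i).isometry
    (locHom (β := fun _ : G.neighborSet i => Fin D) k X))

lemma legOp_mul (i : Fin N) (k : G.neighborSet i) (X Y : Matrix (Fin D) (Fin D) ℂ) :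
    P.legOp i k X * P.legOp i k Y = P.legOp i k (X * Y) := by
  simp only [legOp, map_mul]

lemma legOp_zero (i : Fin N) (k : G.neighborSet i) : P.legOp i k 0 = 0 := by
  simp only [legOp, map_zero]

lemma star_legOp (i : Fin N) (k : G.neighborSet i) (X : Matrix (Fin D) (Fin D) ℂ) :
    star (P.legOp i k X) = P.legOp i k Xᴴ := by
  simp only [legOp, ← map_star, Matrix.star_eq_conjTranspose]

lemma legOp_commute {i j : Fin N} {k : G.neighborSet i} {l : G.neighborSet j}
    (h : i = j → k.1 ≠ l.1) (X Y : Matrix (Fin D) (Fin D) ℂ) :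
    Commute (P.legOp i k X) (P.legOp j l Y) := by
  rcases eq_or_ne i j with rfl | hij
  · have hkl : k ≠ l := fun hkl => h rfl (congrArg _ hkl)
    exact ((locHom_commute (β := fun _ : G.neighborSet i => Fin D) hkl X Y).map
      (isometryHom (P.iso i) (P.isPolar i).isometry)).map (physHom N d i)
  · exact locHom_commute (β := fun _ : Fin N => Fin d) hij _ _

lemma complement_mul_legOp (i : Fin N) (k : G.neighborSet i) (X : Matrix (Fin D) (Fin D) ℂ) :
    physHom N d i (1 - P.iso i * (P.iso i)ᴴ) * P.legOp i k X = 0 := by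
  rw [legOp, ← map_mul, isometryHom_apply, ← Matrix.mul_assoc, ← Matrix.mul_assoc,
    (P.isPolar i).complement_mul, Matrix.zero_mul, Matrix.zero_mul, map_zero]

lemma legOp_mul_complement (i : Fin N) (k : G.neighborSet i) (X : Matrix (Fin D) (Fin D) ℂ) :
    P.legOp i k X * physHom N d i (1 - P.iso i * (P.iso i)ᴴ) = 0 := by
  rw [legOp, ← map_mul, isometryHom_apply, Matrix.mul_assoc, (P.isPolar i).mul_complement,
    Matrix.mul_zero, map_zero]

/-- The matrix units `|p⟩⟨q|` on the two virtual qudits of an edge, transported to the physical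
sites. -/
def bondUnit (e : Edge G) (p q : Fin D × Fin D) : Matrix (Config N d) (Config N d) ℂ :=
  P.legOp e.1.1 e.legFst (Matrix.single p.1 q.1 1) *
    P.legOp e.1.2 e.legSnd (Matrix.single p.2 q.2 1)

lemma legOp_commute_ends (e : Edge G) (X Y : Matrix (Fin D) (Fin D) ℂ) :
    Commute (P.legOp e.1.1 e.legFst X) (P.legOp e.1.2 e.legSnd Y) :=
  P.legOp_commute (fun h => absurd h e.fst_ne_snd) X Y

lemma bondUnit_mul (e : Edge G) (p q p' q' : Fin D × Fin D) :
    P.bondUnit e p q * P.bondUnit e p' q' = if q = p' then P.bondUnit e p q' else 0 := by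
  have h : P.bondUnit e p q * P.bondUnit e p' q'
      = P.legOp e.1.1 e.legFst (Matrix.single p.1 q.1 1 * Matrix.single p'.1 q'.1 1) *
        P.legOp e.1.2 e.legSnd (Matrix.single p.2 q.2 1 * Matrix.single p'.2 q'.2 1) := by
    rw [bondUnit, bondUnit, ← legOp_mul, ← legOp_mul,
      ← (P.legOp_commute_ends e _ (Matrix.single p.2 q.2 1)).mul_mul_mul_comm]
  rw [h]
  split_ifs with hq
  · subst hq
    simp [bondUnit]
  · by_cases h1 : q.1 = p'.1
    · have h2 : q.2 ≠ p'.2 := fun h2 => hq (Prod.ext h1 h2)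
      rw [Matrix.single_mul_single_of_ne (1 : ℂ) p.2 _ _ h2, legOp_zero, mul_zero]
    · rw [Matrix.single_mul_single_of_ne (1 : ℂ) p.1 _ _ h1, legOp_zero, zero_mul]

lemma star_bondUnit (e : Edge G) (p q : Fin D × Fin D) :
    star (P.bondUnit e p q) = P.bondUnit e q p := by
  rw [bondUnit, star_mul, star_legOp, star_legOp, Matrix.conjTranspose_single,
    Matrix.conjTranspose_single, star_one, bondUnit, (P.legOp_commute_ends e _ _).eq]

lemma bondUnit_commute {e f : Edge G} (h : e ≠ f) (p q p' q' : Fin D × Fin D) :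
    Commute (P.bondUnit e p q) (P.bondUnit f p' q') := by
  have h11 : e.1.1 = f.1.1 → e.1.2 ≠ f.1.2 := fun h1 h2 => h (Subtype.ext (Prod.ext h1 h2))
  have h22 : e.1.2 = f.1.2 → e.1.1 ≠ f.1.1 := fun h1 h2 => h11 h2 h1
  have h12 : e.1.1 = f.1.2 → e.1.2 ≠ f.1.1 := fun h1 h2 => by
    have h3 := e.2.1
    rw [h1, h2] at h3
    exact absurd f.2.1 h3.asymm
  have h21 : e.1.2 = f.1.1 → e.1.1 ≠ f.1.2 := fun h1 h2 => h12 h2 h1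
  exact Commute.mul_left
    ((P.legOp_commute h11 _ _).mul_right (P.legOp_commute h12 _ _))
    ((P.legOp_commute h21 _ _).mul_right (P.legOp_commute h22 _ _))

/-- The undressed jump operators `|φ₀⟩⟨φ_α|` of an edge, transported to the physical sites. -/
def bareJump (e : Edge G) (α : Fin (D ^ 2 - 1)) : Matrix (Config N d) (Config N d) ℂ :=
  ofMatrixUnits (P.bondUnit e) (vecMulVec (P.phi₀ e) (star (P.phi e α : Fin D × Fin D → ℂ)))

lemma mul_mul_pinv (i : Fin N) (X : Matrix (Legs D G i) (Legs D G i) ℂ) :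
    P.A i * X * P.pinv i = extendOne (P.iso i) (P.modulus i)
      * isometryHom (P.iso i) (P.isPolar i).isometry X * extendOne (P.iso i) (P.modulus i)⁻¹ := by
  have h := P.isPolar i
  rw [isometryHom_apply, Matrix.mul_assoc _ _ (extendOne _ (P.modulus i)⁻¹),
    Matrix.mul_assoc _ (P.iso i)ᴴ, h.isometry_mul_extendOne, ← Matrix.mul_assoc,
    ← Matrix.mul_assoc (extendOne _ _), h.extendOne_mul_isometry, ← h.eq_mul, P.pinv_eq]

lemma jump_eq_sum (e : Edge G) (α : Fin (D ^ 2 - 1)) :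
    P.jump e α = ∑ p : Fin D × Fin D, ∑ q : Fin D × Fin D,
      (P.phi₀ e p * star (P.phi e α q)) •
        (physHom N d e.1.1 (P.A e.1.1 *
            locHom (β := fun _ => Fin D) e.legFst (Matrix.single p.1 q.1 1) * P.pinv e.1.1) *
          physHom N d e.1.2 (P.A e.1.2 *
            locHom (β := fun _ => Fin D) e.legSnd (Matrix.single p.2 q.2 1) * P.pinv e.1.2)) := by
  rw [jump, bondOp_eq, Matrix.mul_sum, Matrix.sum_mul, pairOp_sum]
  refine Finset.sum_congr rfl fun p _ => ?_
  rw [Matrix.mul_sum, Matrix.sum_mul, pairOp_sum]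
  refine Finset.sum_congr rfl fun q _ => ?_
  rw [Matrix.mul_smul, Matrix.smul_mul, pairOp_smul, ← Matrix.mul_kronecker_mul,
    ← Matrix.mul_kronecker_mul, pairOp_kronecker e.fst_ne_snd]

lemma jump_eq (e : Edge G) (α : Fin (D ^ 2 - 1)) :
    P.jump e α
      = (physHom N d e.1.1 (extendOne (P.iso e.1.1) (P.modulus e.1.1)) *
          physHom N d e.1.2 (extendOne (P.iso e.1.2) (P.modulus e.1.2))) * P.bareJump e α *
        (physHom N d e.1.1 (extendOne (P.iso e.1.1) (P.modulus e.1.1)⁻¹) *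
          physHom N d e.1.2 (extendOne (P.iso e.1.2) (P.modulus e.1.2)⁻¹)) := by
  rw [jump_eq_sum, bareJump, ofMatrixUnits, Finset.mul_sum, Finset.sum_mul]
  refine Finset.sum_congr rfl fun p _ => ?_
  rw [Finset.mul_sum, Finset.sum_mul]
  refine Finset.sum_congr rfl fun q _ => ?_
  rw [mul_smul_comm, smul_mul_assoc, mul_mul_pinv, mul_mul_pinv]
  congr 1
  have hc : ∀ X Y, Commute (physHom N d e.1.1 X) (physHom N d e.1.2 Y) := fun X Y =>
    locHom_commute (β := fun _ : Fin N => Fin d) e.fst_ne_snd X Y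
  rw [bondUnit, legOp, legOp, map_mul, map_mul, map_mul, map_mul]
  rw [((hc _ _).mul_right (hc _ _)).mul_mul_mul_comm, (hc _ _).mul_mul_mul_comm]

end InjectivePEPS

end Bridge


/-! ### The network of an injective PEPS -/

section PEPSNetwork
open Matrix
open scoped Kronecker Matrix.Norms.L2Operator MatrixOrder ComplexOrder

variable {N d D : ℕ} {G : SimpleGraph (Fin N)} [DecidableRel G.Adj]

/-- The operators `|a⟩⟨b α|`, for a family `a`, `b α` of orthonormal vectors, in any system of
matrix units. -/
lemma isBondKraus_ofMatrixUnits {γ ι 𝒜 : Type*} [Fintype γ] [DecidableEq γ] [Fintype ι]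
    [DecidableEq ι] [CStarAlgebra 𝒜] {E : γ → γ → 𝒜}
    (hE : ∀ p q p' q', E p q * E p' q' = if q = p' then E p q' else 0)
    (hE' : ∀ p q, star (E p q) = E q p) {a : γ → ℂ} {b : ι → γ → ℂ} (ha : star a ⬝ᵥ a = 1)
    (hb : ∀ α β, star (b α) ⬝ᵥ b β = if α = β then 1 else 0) (hab : ∀ α, star (b α) ⬝ᵥ a = 0) :
    IsBondKraus fun α => ofMatrixUnits E (vecMulVec a (star (b α))) := by
  refine ⟨fun α β => ?_, fun α => ?_⟩
  · rw [ofMatrixUnits_mul hE, vecMulVec_mul_vecMulVec, hab]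
    simp [ofMatrixUnits]
  · rw [krausDual, Finset.mul_sum]
    simp only [mul_one, star_ofMatrixUnits hE', ofMatrixUnits_mul hE, conjTranspose_vecMulVec,
      star_star, vecMulVec_mul_vecMulVec]
    rw [Finset.sum_eq_single α]
    · simp [ha, hb]
    · intro β _ hβ
      simp [hb, hβ.symm, ofMatrixUnits]
    · simp

namespace InjectivePEPS

variable (P : InjectivePEPS d D G)

lemma phi₀_dotProduct (e : Edge G) :
    star (P.phi₀ e : Fin D × Fin D → ℂ) ⬝ᵥ (P.phi₀ e : Fin D × Fin D → ℂ) = 1 := by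
  have h : inner ℂ (P.phi₀ e) (P.phi₀ e) = 1 := by
    rw [inner_self_eq_norm_sq_to_K, P.phi₀_norm]
    simp
  rw [← h, EuclideanSpace.inner_eq_star_dotProduct, dotProduct_comm]

lemma phi_dotProduct (e : Edge G) (α β : Fin (D ^ 2 - 1)) :
    star (P.phi e α : Fin D × Fin D → ℂ) ⬝ᵥ (P.phi e β : Fin D × Fin D → ℂ)
      = if α = β then 1 else 0 := by
  rw [← orthonormal_iff_ite.1 (P.phi_orthonormal e) α β, EuclideanSpace.inner_eq_star_dotProduct,
    dotProduct_comm]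

lemma phi_dotProduct_phi₀ (e : Edge G) (α : Fin (D ^ 2 - 1)) :
    star (P.phi e α : Fin D × Fin D → ℂ) ⬝ᵥ (P.phi₀ e : Fin D × Fin D → ℂ) = 0 := by
  have h : inner ℂ (P.phi e α) (P.phi₀ e) = 0 := inner_eq_zero_symm.1 (P.phi_orthogonal e α)
  rw [← h, EuclideanSpace.inner_eq_star_dotProduct, dotProduct_comm]

/-- The two ends of an edge. -/
def ends (e : Edge G) : Finset (Fin N) := {e.1.1, e.1.2}

lemma physHom_commute_bareJump {i : Fin N} {e : Edge G} (h : i ∉ ends e)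
    (x : Matrix (Fin d) (Fin d) ℂ) (α : Fin (D ^ 2 - 1)) :
    Commute (physHom N d i x) (P.bareJump e α) := by
  rw [ends, Finset.mem_insert, Finset.mem_singleton, not_or] at h
  refine commute_ofMatrixUnits (fun p q => ?_) _
  exact Commute.mul_right (locHom_commute (β := fun _ : Fin N => Fin d) h.1 _ _)
    (locHom_commute (β := fun _ : Fin N => Fin d) h.2 _ _)

lemma complement_mul_bareJump {i : Fin N} {e : Edge G} (h : i ∈ ends e) (α : Fin (D ^ 2 - 1)) :
    physHom N d i (1 - P.iso i * (P.iso i)ᴴ) * P.bareJump e α = 0 := by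
  rw [bareJump, ofMatrixUnits, Finset.mul_sum]
  refine Finset.sum_eq_zero fun p _ => ?_
  rw [Finset.mul_sum]
  refine Finset.sum_eq_zero fun q _ => ?_
  rw [mul_smul_comm, bondUnit]
  rw [ends, Finset.mem_insert, Finset.mem_singleton] at h
  rcases h with rfl | rfl
  · rw [← mul_assoc, complement_mul_legOp, zero_mul, smul_zero]
  · rw [(P.legOp_commute_ends e _ _).eq, ← mul_assoc, complement_mul_legOp, zero_mul, smul_zero]

lemma bareJump_mul_complement {i : Fin N} {e : Edge G} (h : i ∈ ends e) (α : Fin (D ^ 2 - 1)) :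
    P.bareJump e α * physHom N d i (1 - P.iso i * (P.iso i)ᴴ) = 0 := by
  rw [bareJump, ofMatrixUnits, Finset.sum_mul]
  refine Finset.sum_eq_zero fun p _ => ?_
  rw [Finset.sum_mul]
  refine Finset.sum_eq_zero fun q _ => ?_
  rw [smul_mul_assoc, bondUnit]
  rw [ends, Finset.mem_insert, Finset.mem_singleton] at h
  rcases h with rfl | rfl
  · rw [(P.legOp_commute_ends e _ _).eq, mul_assoc, legOp_mul_complement, mul_zero, smul_zero]
  · rw [mul_assoc, legOp_mul_complement, mul_zero, smul_zero]

include P in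
/-- A vertex without edges has a one-dimensional virtual space; otherwise `D ≠ 0`, because the
states of the edges are unit vectors. -/
lemma nonempty_legs (i : Fin N) : Nonempty (Legs D G i) := by
  have hD : ∀ e : Edge G, 0 < D := by
    intro e
    by_contra h
    have hD : D = 0 := by omega
    subst hD
    have h1 := P.phi₀_dotProduct e
    simp at h1
  refine ⟨fun k => ⟨0, ?_⟩⟩
  rcases lt_trichotomy i k.1 with h | h | h
  · exact hD ⟨(i, k.1), h, k.2⟩
  · exact absurd h (SimpleGraph.Adj.ne k.2)
  · exact hD ⟨(k.1, i), h, SimpleGraph.Adj.symm k.2⟩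

/-- The pumps of a vertex: Kraus operators of the map `X ↦ dim(S_i)⁻¹ P_{S_i} Tr (P_{S_i}^⊥ X)`. -/
def pump (i : Fin N) (x : Fin d × Fin d) : Matrix (Fin d) (Fin d) ℂ :=
  ((Real.sqrt (Fintype.card (Legs D G i)))⁻¹ : ℂ) •
    (P.iso i * (P.iso i)ᴴ * Matrix.single x.1 x.2 (1 : ℂ) * (1 - P.iso i * (P.iso i)ᴴ))

/-- The network of the dressed jumps of the parent Lindbladian; the dressing at a vertex is the
factor `s_i` on the range of `A_i` and `1` on its orthogonal complement. -/
def network {δ : ℝ} (hδ : ∀ i, opNorm ((P.A i)ᴴ * P.A i - 1) ≤ δ) (hδ' : δ ≤ 1 / 2) :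
    DressedNetwork (Matrix (Fin d) (Fin d) ℂ) (Matrix (Config N d) (Config N d) ℂ) (Fin N)
      (Edge G) (Fin (D ^ 2 - 1)) (Fin d × Fin d) (2 * δ) where
  site := physHom N d
  ends := ends
  dress i := extendOne (P.iso i) (P.modulus i)
  undress i := extendOne (P.iso i) (P.modulus i)⁻¹
  complement i := 1 - P.iso i * (P.iso i)ᴴ
  pump := P.pump
  bond := P.bareJump
  site_commute h x y := locHom_commute (β := fun _ : Fin N => Fin d) h x y
  card_ends _ := Finset.card_le_two
  isDressing i := (P.isPolar i).isDressing (hδ i) hδ'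
  complement_mul_self i := (P.isPolar i).complement_mul_self
  complement_dress i := (P.isPolar i).extendOne_complement _
  complement_undress i := (P.isPolar i).extendOne_complement _
  complement_mul_pump i x := by
    rw [pump, mul_smul_comm, ← mul_assoc, ← mul_assoc, ← Matrix.mul_assoc _ (P.iso i),
      (P.isPolar i).complement_mul]
    simp
  krausDual_pump i := by
    have := P.nonempty_legs i
    exact (P.isPolar i).krausDual_pump
  isBondKraus e := isBondKraus_ofMatrixUnits (P.bondUnit_mul e) (P.star_bondUnit e)
    (P.phi₀_dotProduct e) (P.phi_dotProduct e) (P.phi_dotProduct_phi₀ e)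
  bond_commute h α β := commute_ofMatrixUnits (fun p q => Commute.symm
    (commute_ofMatrixUnits (fun p' q' => P.bondUnit_commute h.symm p q p' q') _)) _
  bond_commute_star {e f} h α β := by
    rw [bareJump, bareJump, star_ofMatrixUnits (P.star_bondUnit f)]
    exact commute_ofMatrixUnits (fun p q => Commute.symm
      (commute_ofMatrixUnits (fun p' q' => P.bondUnit_commute h.symm p q p' q') _)) _
  site_commute_bond h x α := P.physHom_commute_bareJump h x α
  complement_mul_bond h α := P.complement_mul_bareJump h α
  bond_mul_complement h α := P.bareJump_mul_complement h α

variable {δ : ℝ} (hδ : ∀ i, opNorm ((P.A i)ᴴ * P.A i - 1) ≤ δ) (hδ' : δ ≤ 1 / 2)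

lemma network_jump (e : Edge G) (α : Fin (D ^ 2 - 1)) :
    (P.network hδ hδ').jump e α = P.jump e α := by
  have h : ∀ x : Fin N → Matrix (Fin d) (Fin d) ℂ, (P.network hδ hδ').prod x (ends e)
      = physHom N d e.1.1 (x e.1.1) * physHom N d e.1.2 (x e.1.2) := by
    intro x
    rw [ends, DressedNetwork.prod_insert _ (by simpa using e.fst_ne_snd)]
    congr 1
    exact Finset.noncommProd_singleton _ _
  rw [P.jump_eq, DressedNetwork.jump]
  change (P.network hδ hδ').prod _ (ends e) * P.bareJump e α *
    (P.network hδ hδ').prod _ (ends e) = _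
  rw [h, h]
  rfl

lemma rank_eq (i : Fin N) : (P.A i).rank = Fintype.card (Legs D G i) := by
  rw [Matrix.rank, LinearMap.finrank_range_of_inj (f := (P.A i).mulVecLin) (P.A_injective i)]
  simp

lemma siteLindbladian_eq (i : Fin N) :
    P.siteLindbladian i = ∑ x, dissipator ((P.network hδ hδ').sitePump i x) := by
  have hK : krausDual ((P.network hδ hδ').sitePump i) 1 = physHom N d i (1 - P.proj i) := by
    rw [DressedNetwork.krausDual_sitePump, proj_eq]; rfl
  set q := physHom N d i (1 - P.iso i * (P.iso i)ᴴ) with hq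
  have hp := P.isPolar i
  have hr : (0 : ℝ) ≤ Fintype.card (Legs D G i) := Nat.cast_nonneg _
  have hcc : ((Real.sqrt (Fintype.card (Legs D G i)))⁻¹ : ℂ)
      * ((Real.sqrt (Fintype.card (Legs D G i)))⁻¹ : ℂ)
      = ((Fintype.card (Legs D G i) : ℂ))⁻¹ := by
    rw [← mul_inv, ← Complex.ofReal_mul, Real.mul_self_sqrt hr, Complex.ofReal_natCast]
  have hcs : star ((Real.sqrt (Fintype.card (Legs D G i)))⁻¹ : ℂ)
      = ((Real.sqrt (Fintype.card (Legs D G i)))⁻¹ : ℂ) := by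
    rw [star_inv₀, Complex.star_def, Complex.conj_ofReal]
  refine LinearMap.ext fun X => ?_
  have hqq : q * q = q := by rw [hq, ← map_mul, hp.complement_mul_self]
  have hX : krausDual (fun x => star ((P.network hδ hδ').sitePump i x)) X
      = ((P.A i).rank : ℂ)⁻¹ • replaceSite i (P.proj i) (q * X) := by
    -- the pumps act on `q X q`, which has the same partial trace at the site `i` as `q X`
    have h1 : replaceSite i (P.proj i) (q * X)
        = replaceSite i (P.iso i * (P.iso i)ᴴ * (P.iso i * (P.iso i)ᴴ)) (q * X * q) := by
      rw [hp.proj_mul_proj, ← proj_eq, hq, replaceSite_mul_comm, ← mul_assoc, ← hq, hqq]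
    rw [h1, ← sum_single_conj, rank_eq, ← hcc, krausDual, Finset.smul_sum]
    refine Finset.sum_congr rfl fun x _ => ?_
    have hQs : star (P.iso i * (P.iso i)ᴴ) = P.iso i * (P.iso i)ᴴ := by
      rw [Matrix.star_eq_conjTranspose, Matrix.conjTranspose_mul,
        Matrix.conjTranspose_conjTranspose]
    have h2 : star (Matrix.single x.1 x.2 (1 : ℂ)) = Matrix.single x.2 x.1 (1 : ℂ) := by
      rw [Matrix.star_eq_conjTranspose, Matrix.conjTranspose_single, star_one]
    change star (star (physHom N d i (P.pump i x))) * X * star (physHom N d i (P.pump i x)) = _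
    rw [star_star, pump, ← map_star, star_smul, hcs, map_smul, map_smul, star_mul, star_mul,
      star_sub, star_one, hQs, h2, smul_mul_assoc, smul_mul_smul_comm, map_mul, map_mul,
      map_mul (physHom N d i) (1 - P.iso i * (P.iso i)ᴴ), ← hq]
    simp only [mul_assoc]
  rw [siteLindbladian, sum_dissipator_apply, hX, hK, siteOp_eq]
  simp only [LinearMap.sub_apply, LinearMap.smul_apply, LinearMap.comp_apply,
    LinearMap.mulLeft_apply, halfAnticomm, LinearMap.coe_mk, AddHom.coe_mk]
  rw [hq, proj_eq]

lemma lindbladian_eq :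
    P.lindbladian = ∑ k, dissipator ((P.network hδ hδ').jumps k) := by
  have h : ∀ (L : Edge G → Fin (D ^ 2 - 1) → Matrix (Config N d) (Config N d) ℂ)
      (K : Fin N → Fin d × Fin d → Matrix (Config N d) (Config N d) ℂ),
      ∑ k, dissipator (joinJumps L K k)
        = ∑ e, ∑ α, dissipator (L e α) + ∑ i, ∑ x, dissipator (K i x) := fun L K => by
    simp only [joinJumps, Fintype.sum_sum_type, Fintype.sum_prod_type, Sum.elim_inl, Sum.elim_inr]
  rw [DressedNetwork.jumps, h, lindbladian]
  simp only [P.network_jump hδ hδ', ← P.siteLindbladian_eq hδ hδ', edgeLindbladian]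

lemma card_filter_ends_le (i : Fin N) :
    (Finset.univ.filter fun e : Edge G => i ∈ ends e).card ≤ G.degree i := by
  rw [← SimpleGraph.card_neighborFinset_eq_degree]
  refine Finset.card_le_card_of_injOn (fun e => if e.1.1 = i then e.1.2 else e.1.1) ?_ ?_
  · intro e he
    have he' : i ∈ ends e := by simpa using he
    simp only [ends, Finset.mem_insert, Finset.mem_singleton] at he'
    simp only [Finset.mem_coe, SimpleGraph.mem_neighborFinset]
    split_ifs with h
    · exact h ▸ e.2.2
    · rcases he' with h' | h'
      · exact absurd h'.symm h
      · exact h' ▸ e.2.2.symm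
  · intro e he f hf hef
    have he' : i ∈ ends e := by simpa using he
    have hf' : i ∈ ends f := by simpa using hf
    simp only [ends, Finset.mem_insert, Finset.mem_singleton] at he' hf'
    have h1 := e.2.1
    have h2 := f.2.1
    refine Subtype.ext (Prod.ext ?_ ?_) <;> dsimp only at hef <;> split_ifs at hef <;> grind

end InjectivePEPS

end PEPSNetwork


/-! ### The stationary vectors of the parent Lindbladian -/

section Kernel
open Matrix
open scoped Kronecker Matrix.Norms.L2Operator MatrixOrder ComplexOrder

lemma mulVec_eq_zero_of_krausDual_le {n κ : Type*} [Fintype n] [DecidableEq n] [Fintype κ]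
    {J : κ → Matrix n n ℂ} {H : Matrix n n ℂ} (hK : krausDual J 1 ≤ H) {v : n → ℂ}
    (hv : H *ᵥ v = 0) (k : κ) : J k *ᵥ v = 0 := by
  have h1 := (Matrix.le_iff.1 hK).dotProduct_mulVec_nonneg v
  have h2 : star v ⬝ᵥ (krausDual J 1 *ᵥ v) = ∑ k, star (J k *ᵥ v) ⬝ᵥ (J k *ᵥ v) := by
    rw [krausDual, Matrix.sum_mulVec, dotProduct_sum]
    refine Finset.sum_congr rfl fun k _ => ?_
    rw [mul_one, star_mulVec, ← dotProduct_mulVec, mulVec_mulVec, Matrix.star_eq_conjTranspose]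
  rw [Matrix.sub_mulVec, hv, zero_sub, dotProduct_neg, h2, neg_nonneg] at h1
  have h3 : ∀ k ∈ Finset.univ, 0 ≤ star (J k *ᵥ v) ⬝ᵥ (J k *ᵥ v) :=
    fun k _ => dotProduct_star_self_nonneg _
  have h4 := (Finset.sum_eq_zero_iff_of_nonneg h3).1 (le_antisymm h1 (Finset.sum_nonneg h3)) k
    (Finset.mem_univ k)
  exact dotProduct_star_self_eq_zero.1 h4

/-- A vector fixed by a local operator at every factor is fixed by their tensor product. -/
lemma tensor_mulVec_eq_self {K : Type*} {β : K → Type*} [Fintype K] [DecidableEq K]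
    [∀ k, Fintype (β k)] [∀ k, DecidableEq (β k)] {M : ∀ k, Matrix (β k) (β k) ℂ}
    {v : (∀ k, β k) → ℂ} (h : ∀ k, locHom k (M k) *ᵥ v = v) : tensor M *ᵥ v = v := by
  have key : ∀ T : Finset K, tensor (fun k => if k ∈ T then M k else 1) *ᵥ v = v := by
    intro T
    induction T using Finset.induction_on with
    | empty => simp [tensor_one]
    | insert k T hk ih =>
      have h1 : tensor (fun l => if l ∈ insert k T then M l else 1)
          = locHom k (M k) * tensor (fun l => if l ∈ T then M l else 1) := by
        ext s t
        rw [locHom_eq, locOp_mul_apply, Finset.sum_eq_single (t k)]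
        · simp only [tensor, Matrix.of_apply]
          rw [← Finset.mul_prod_erase _ _ (Finset.mem_univ k),
            ← Finset.mul_prod_erase _ _ (Finset.mem_univ k)]
          simp only [Finset.mem_insert_self, if_true, Function.update_self, hk, if_false,
            Matrix.one_apply_eq, one_mul]
          congr 1
          refine Finset.prod_congr rfl fun l hl => ?_
          have hlk := Finset.ne_of_mem_erase hl
          rw [Function.update_of_ne hlk]
          simp [Finset.mem_insert, hlk]
        · intro b _ hb
          rw [mul_eq_zero]
          right
          exact Finset.prod_eq_zero (Finset.mem_univ k) (by simp [hk, hb])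
        · simp
      rw [h1, ← mulVec_mulVec, ih, h]
  simpa using key Finset.univ

variable {N d D : ℕ} {G : SimpleGraph (Fin N)} [DecidableRel G.Adj]

section Bonds

omit [DecidableRel G.Adj]

/-- The two indices of a virtual configuration that belong to an edge. -/
def getBond (e : Edge G) (y : ∀ i, Legs D G i) : Fin D × Fin D :=
  (y e.1.1 e.legFst, y e.1.2 e.legSnd)

/-- The virtual configuration `y` with the two indices of the edge `e` replaced. -/
def setBond (e : Edge G) (q : Fin D × Fin D) (y : ∀ i, Legs D G i) : ∀ i, Legs D G i :=
  fun i k => if i = e.1.1 ∧ k.1 = e.1.2 then q.1 else if i = e.1.2 ∧ k.1 = e.1.1 then q.2 else y i k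

lemma bond_ext {y y' : ∀ i, Legs D G i} (h : ∀ e, getBond e y = getBond e y') : y = y' := by
  funext i k
  rcases lt_trichotomy i k.1 with hik | hik | hik
  · exact congrArg Prod.fst (h ⟨(i, k.1), hik, k.2⟩)
  · exact absurd hik (SimpleGraph.Adj.ne k.2)
  · exact congrArg Prod.snd (h ⟨(k.1, i), hik, SimpleGraph.Adj.symm k.2⟩)

lemma getBond_setBond (e : Edge G) (q : Fin D × Fin D) (y : ∀ i, Legs D G i) :
    getBond e (setBond e q y) = q := by
  have h := e.fst_ne_snd.symm
  simp [getBond, setBond, Edge.legFst, Edge.legSnd, h]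

lemma getBond_setBond_of_ne {e f : Edge G} (h : f ≠ e) (q : Fin D × Fin D)
    (y : ∀ i, Legs D G i) : getBond f (setBond e q y) = getBond f y := by
  have h1 : ¬ (f.1.1 = e.1.1 ∧ f.1.2 = e.1.2) := fun h' => h (Subtype.ext (Prod.ext h'.1 h'.2))
  have h2 : ¬ (f.1.1 = e.1.2 ∧ f.1.2 = e.1.1) := fun h' => by
    have h3 := f.2.1
    rw [h'.1, h'.2] at h3
    exact absurd e.2.1 h3.asymm
  have h3 : ¬ (f.1.2 = e.1.1 ∧ f.1.1 = e.1.2) := fun h' => h2 h'.symm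
  have h4 : ¬ (f.1.2 = e.1.2 ∧ f.1.1 = e.1.1) := fun h' => h1 h'.symm
  simp [getBond, setBond, Edge.legFst, Edge.legSnd, h1, h2, h3, h4]

lemma setBond_setBond (e : Edge G) (q q' : Fin D × Fin D) (y : ∀ i, Legs D G i) :
    setBond e q' (setBond e q y) = setBond e q' y := by
  refine bond_ext fun f => ?_
  rcases eq_or_ne f e with rfl | hf
  · rw [getBond_setBond, getBond_setBond]
  · rw [getBond_setBond_of_ne hf, getBond_setBond_of_ne hf, getBond_setBond_of_ne hf]

lemma setBond_getBond (e : Edge G) (y : ∀ i, Legs D G i) : setBond e (getBond e y) y = y := by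
  refine bond_ext fun f => ?_
  rcases eq_or_ne f e with rfl | hf
  · rw [getBond_setBond]
  · rw [getBond_setBond_of_ne hf]

lemma update_update_eq_setBond (e : Edge G) (q : Fin D × Fin D) (y : ∀ i, Legs D G i)
    [∀ i, DecidableEq (G.neighborSet i)] :
    Function.update (Function.update y e.1.1 (Function.update (y e.1.1) e.legFst q.1)) e.1.2
      (Function.update (y e.1.2) e.legSnd q.2) = setBond e q y := by
  have hne := e.fst_ne_snd
  funext i k
  by_cases h2 : i = e.1.2
  · subst h2
    rw [Function.update_self]
    by_cases hk : k = e.legSnd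
    · subst hk
      rw [Function.update_self]
      simp [setBond, hne.symm, Edge.legSnd]
    · have : k.1 ≠ e.1.1 := fun h => hk (Subtype.ext h)
      rw [Function.update_of_ne hk]
      simp [setBond, hne.symm, this]
  · rw [Function.update_of_ne h2]
    by_cases h1 : i = e.1.1
    · subst h1
      rw [Function.update_self]
      by_cases hk : k = e.legFst
      · subst hk
        rw [Function.update_self]
        simp [setBond, Edge.legFst]
      · have : k.1 ≠ e.1.2 := fun h => hk (Subtype.ext h)
        rw [Function.update_of_ne hk]
        simp [setBond, hne, this]
    · rw [Function.update_of_ne h1]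
      simp [setBond, h1, h2]

/-- An amplitude which is proportional to `a e` in the indices of every edge `e` is proportional
to the product of the `a e`. -/
lemma exists_eq_smul_prod [Fintype (Edge G)] [Nonempty (∀ i, Legs D G i)]
    {a : Edge G → Fin D × Fin D → ℂ} (ha : ∀ e, ∃ p, a e p ≠ 0) {x : (∀ i, Legs D G i) → ℂ}
    (hx : ∀ e y q, x (setBond e q y) * a e (getBond e y) = x y * a e q) :
    ∃ c : ℂ, ∀ y, x y = c * ∏ e, a e (getBond e y) := by
  classical
  have hex : ∀ T : Finset (Edge G), ∃ y : ∀ i, Legs D G i, ∀ e ∈ T, a e (getBond e y) ≠ 0 := by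
    intro T
    induction T using Finset.induction_on with
    | empty => exact ⟨Classical.arbitrary _, by simp⟩
    | insert e T he ih =>
      obtain ⟨y, hy⟩ := ih
      obtain ⟨p, hp⟩ := ha e
      refine ⟨setBond e p y, fun f hf => ?_⟩
      rcases eq_or_ne f e with rfl | hfe
      · rwa [getBond_setBond]
      · rw [getBond_setBond_of_ne hfe]
        exact hy f (Finset.mem_of_mem_insert_of_ne hf hfe)
  have key : ∀ (T : Finset (Edge G)) (y y' : ∀ i, Legs D G i),
      (∀ e, e ∉ T → getBond e y = getBond e y') →
      x y * ∏ e ∈ T, a e (getBond e y') = x y' * ∏ e ∈ T, a e (getBond e y) := by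
    intro T
    induction T using Finset.induction_on with
    | empty =>
      intro y y' h
      rw [bond_ext fun e => h e (Finset.notMem_empty e)]
    | insert e T he ih =>
      intro y y' h
      have h1 := ih (setBond e (getBond e y') y) y' fun f hf => by
        rcases eq_or_ne f e with rfl | hfe
        · rw [getBond_setBond]
        · rw [getBond_setBond_of_ne hfe]
          exact h f (by simp [hfe, hf])
      have h2 : ∏ f ∈ T, a f (getBond f (setBond e (getBond e y') y))
          = ∏ f ∈ T, a f (getBond f y) := Finset.prod_congr rfl fun f hf => by
        rw [getBond_setBond_of_ne (by rintro rfl; exact he hf)]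
      rw [h2] at h1
      rw [Finset.prod_insert he, Finset.prod_insert he, ← mul_assoc, ← hx, mul_right_comm, h1]
      ring
  obtain ⟨y₀, hy₀⟩ := hex Finset.univ
  have h0 : ∏ e, a e (getBond e y₀) ≠ 0 := Finset.prod_ne_zero_iff.2 hy₀
  refine ⟨x y₀ / ∏ e, a e (getBond e y₀), fun y => ?_⟩
  have h := key Finset.univ y y₀ fun e he => absurd (Finset.mem_univ e) he
  rw [div_mul_eq_mul_div, eq_div_iff h0, h]

end Bonds

namespace InjectivePEPS

variable (P : InjectivePEPS d D G)

lemma exists_phi₀_ne_zero (e : Edge G) : ∃ p, P.phi₀ e p ≠ 0 := by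
  by_contra! h
  have h1 := P.phi₀_dotProduct e
  simp [dotProduct, h] at h1

/-- The states `φ₀`, `φ_α` span the two virtual qudits of an edge. -/
lemma exists_eq_smul_phi₀ (e : Edge G) {u : Fin D × Fin D → ℂ}
    (h : ∀ α, star (P.phi e α : Fin D × Fin D → ℂ) ⬝ᵥ u = 0) :
    ∃ c : ℂ, ∀ q, u q = c * P.phi₀ e q := by
  let b : Option (Fin (D ^ 2 - 1)) → EuclideanSpace ℂ (Fin D × Fin D) :=
    fun o => o.elim (P.phi₀ e) (P.phi e)
  have hb : Orthonormal ℂ b := by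
    rw [orthonormal_iff_ite]
    rintro (_ | α) (_ | β)
    · simp [b, P.phi₀_norm e]
    · simpa [b] using P.phi_orthogonal e β
    · simpa [b] using inner_eq_zero_symm.1 (P.phi_orthogonal e α)
    · simpa [b] using orthonormal_iff_ite.1 (P.phi_orthonormal e) α β
  have hD : 0 < D := by
    obtain ⟨p, -⟩ := P.exists_phi₀_ne_zero e
    exact p.1.pos
  have hcard : Fintype.card (Option (Fin (D ^ 2 - 1)))
      = Module.finrank ℂ (EuclideanSpace ℂ (Fin D × Fin D)) := by
    have : 1 ≤ D ^ 2 := Nat.one_le_pow _ _ hD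
    simp only [Fintype.card_option, Fintype.card_fin, finrank_euclideanSpace, Fintype.card_prod]
    rw [← sq]
    omega
  let B := (basisOfOrthonormalOfCardEqFinrank hb hcard).toOrthonormalBasis (by
    rw [coe_basisOfOrthonormalOfCardEqFinrank]; exact hb)
  have hB : ∀ o, B o = b o := fun o => by simp [B]
  have hsum := B.sum_repr' (WithLp.toLp 2 u)
  rw [Fintype.sum_option] at hsum
  refine ⟨inner ℂ (P.phi₀ e) (WithLp.toLp 2 u), fun q => ?_⟩
  have hz : ∀ α, inner ℂ (P.phi e α) (WithLp.toLp 2 u) = 0 := fun α => by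
    rw [EuclideanSpace.inner_eq_star_dotProduct, dotProduct_comm]
    exact h α
  have h1 : ∀ α, inner ℂ (B (some α)) (WithLp.toLp 2 u) • B (some α) = 0 := fun α => by
    rw [hB]
    exact (congrArg (· • b (some α)) (hz α)).trans (zero_smul _ _)
  rw [Finset.sum_eq_zero fun α _ => h1 α, add_zero, hB] at hsum
  exact (congrArg (fun w : EuclideanSpace ℂ (Fin D × Fin D) => w q) hsum).symm

lemma pinv_mul (i : Fin N) : P.pinv i * P.A i = 1 := by
  have h := P.isPolar i
  rw [P.pinv_eq, h.eq_mul, Matrix.mul_assoc, ← Matrix.mul_assoc _ (P.iso i), h.isometry,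
    Matrix.one_mul, Matrix.nonsing_inv_mul _ h.isUnit_det]

/-- The maps `A_i` intertwine the jumps with the undressed jumps `|φ₀⟩⟨φ_α|` on the virtual
space. -/
lemma jump_mul_tensor (e : Edge G) (α : Fin (D ^ 2 - 1)) :
    P.jump e α * tensor P.A = tensor P.A * ∑ p : Fin D × Fin D, ∑ q : Fin D × Fin D,
      (P.phi₀ e p * star (P.phi e α q)) •
        (locHom (β := Legs D G) e.1.1
            (locHom (β := fun _ => Fin D) e.legFst (Matrix.single p.1 q.1 1)) *
          locHom (β := Legs D G) e.1.2
            (locHom (β := fun _ => Fin D) e.legSnd (Matrix.single p.2 q.2 1))) := by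
  have h : ∀ i (X : Matrix (Legs D G i) (Legs D G i) ℂ),
      physHom N d i (P.A i * X * P.pinv i) * tensor P.A = tensor P.A * locHom i X := by
    intro i X
    refine locOp_mul_tensor ?_
    rw [Matrix.mul_assoc, P.pinv_mul, Matrix.mul_one]
  rw [jump_eq_sum, Matrix.sum_mul, Matrix.mul_sum]
  refine Finset.sum_congr rfl fun p _ => ?_
  rw [Matrix.sum_mul, Matrix.mul_sum]
  refine Finset.sum_congr rfl fun q _ => ?_
  rw [Matrix.smul_mul, Matrix.mul_smul, Matrix.mul_assoc, h, ← Matrix.mul_assoc, h,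
    Matrix.mul_assoc]

lemma locHom_locHom_mulVec (i : Fin N) (k : G.neighborSet i) (a b : Fin D)
    (x : (∀ i, Legs D G i) → ℂ) (y : ∀ i, Legs D G i) :
    (locHom (β := Legs D G) i (locHom (β := fun _ => Fin D) k (Matrix.single a b 1)) *ᵥ x) y
      = if a = y i k then x (Function.update y i (Function.update (y i) k b)) else 0 := by
  have h1 := locOp_mulVec (β := Legs D G) i
    (locHom (β := fun _ => Fin D) k (Matrix.single a b 1)) x y
  have h2 := locOp_mulVec (β := fun _ : G.neighborSet i => Fin D) k (Matrix.single a b 1)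
    (fun w => x (Function.update y i w)) (y i)
  rw [locHom_eq, h1]
  refine h2.trans ?_
  split_ifs with h
  · subst h
    rw [Finset.sum_eq_single b]
    · simp
    · intro c _ hc
      simp [hc.symm]
    · simp
  · exact Finset.sum_eq_zero fun c _ => by simp [h]

/-- A vector annihilated by all jumps is a multiple of the PEPS. -/
theorem exists_eq_smul_psi {v : Config N d → ℂ} (hj : ∀ e α, P.jump e α *ᵥ v = 0)
    (hs : ∀ i, physHom N d i (1 - P.proj i) *ᵥ v = 0) : ∃ c : ℂ, v = c • P.psi := by
  have := P.nonempty_legs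
  set x := tensor P.pinv *ᵥ v with hx
  have hv : tensor P.A *ᵥ x = v := by
    rw [hx, mulVec_mulVec, tensor_mul]
    refine tensor_mulVec_eq_self (β := fun _ : Fin N => Fin d) fun i => ?_
    have h := hs i
    rw [map_sub, map_one, Matrix.sub_mulVec, Matrix.one_mulVec, sub_eq_zero] at h
    exact h.symm
  have hbond : ∀ e α y, ∑ q, star (P.phi e α q) * x (setBond e q y) = 0 := by
    intro e α y
    obtain ⟨p, hp⟩ := P.exists_phi₀_ne_zero e
    have h0 := hj e α
    rw [← hv, mulVec_mulVec, P.jump_mul_tensor, ← mulVec_mulVec] at h0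
    -- the bare jump produces the factor `φ₀ p` at an entry whose bond index at `e` is `p`
    have h1 := congrArg (fun w => (tensor P.pinv *ᵥ w) (setBond e p y)) h0
    simp only [mulVec_mulVec, ← Matrix.mul_assoc, tensor_mul, P.pinv_mul] at h1
    rw [tensor_one, Matrix.one_mul, mulVec_zero, Pi.zero_apply, Matrix.sum_mulVec,
      Finset.sum_apply] at h1
    have hne := e.fst_ne_snd
    have h2 : ∀ p' q : Fin D × Fin D,
        ((locHom (β := Legs D G) e.1.1
            (locHom (β := fun _ => Fin D) e.legFst (Matrix.single p'.1 q.1 1)) *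
          locHom (β := Legs D G) e.1.2
            (locHom (β := fun _ => Fin D) e.legSnd (Matrix.single p'.2 q.2 1))) *ᵥ x)
              (setBond e p y) = if p' = p then x (setBond e q y) else 0 := by
      intro p' q
      rw [← mulVec_mulVec, locHom_locHom_mulVec, locHom_locHom_mulVec,
        Function.update_of_ne hne.symm, update_update_eq_setBond, setBond_setBond]
      have h3 : (setBond e p y) e.1.1 e.legFst = p.1 := congrArg Prod.fst (getBond_setBond e p y)
      have h4 : (setBond e p y) e.1.2 e.legSnd = p.2 := congrArg Prod.snd (getBond_setBond e p y)
      rw [h3, h4, ← ite_and]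
      simp only [Prod.ext_iff]
    simp only [Matrix.sum_mulVec, Finset.sum_apply, Matrix.smul_mulVec, Pi.smul_apply, h2,
      smul_eq_mul, mul_ite, mul_zero] at h1
    rw [Finset.sum_comm] at h1
    simp only [Finset.sum_ite_eq', Finset.mem_univ, if_true, mul_assoc, ← Finset.mul_sum] at h1
    exact (mul_eq_zero.1 h1).resolve_left hp
  obtain ⟨c, hc⟩ := exists_eq_smul_prod (a := fun e => P.phi₀ e) P.exists_phi₀_ne_zero (x := x)
    fun e y q => by
      obtain ⟨c, hc⟩ := P.exists_eq_smul_phi₀ e (u := fun q => x (setBond e q y))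
        fun α => hbond e α y
      have h := hc (getBond e y)
      rw [setBond_getBond] at h
      rw [hc, h]
      ring
  refine ⟨c, ?_⟩
  rw [← hv]
  funext s
  simp only [mulVec, dotProduct, tensor, Matrix.of_apply, hc, Pi.smul_apply, smul_eq_mul, psi,
    Finset.mul_sum, getBond]
  exact Finset.sum_congr rfl fun y _ => by ring

end InjectivePEPS

end Kernel

/-! ### Convergence of the parent Lindbladian -/

section Main
open Matrix
open scoped Matrix.Norms.L2Operator MatrixOrder ComplexOrder

lemma isTheta_const_div_add_one {c : ℝ} (hc : 0 < c) :
    Asymptotics.IsTheta Filter.atTop (fun n : ℕ => 1 / (c * (n + 1 : ℝ)))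
      (fun n : ℕ => 1 / (n : ℝ)) := by
  constructor
  · refine Asymptotics.IsBigO.of_bound (1 / c) ?_
    filter_upwards [Filter.eventually_ge_atTop 1] with n hn
    have hn' : (1 : ℝ) ≤ n := by exact_mod_cast hn
    rw [Real.norm_of_nonneg (by positivity), Real.norm_of_nonneg (by positivity), div_mul_div_comm,
      one_mul]
    gcongr
    linarith
  · refine Asymptotics.IsBigO.of_bound (2 * c) ?_
    filter_upwards [Filter.eventually_ge_atTop 1] with n hn
    have hn' : (1 : ℝ) ≤ n := by exact_mod_cast hn
    rw [Real.norm_of_nonneg (by positivity), Real.norm_of_nonneg (by positivity)]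
    have hn0 : (0 : ℝ) < n := by linarith
    rw [← sub_nonneg]
    have : 2 * c * (1 / (c * (n + 1))) - 1 / (n : ℝ) = (n - 1) / (n * (n + 1)) := by
      field_simp
      ring
    rw [this]
    exact div_nonneg (by linarith) (by positivity)

lemma sqrt_natCast_le (n : ℕ) : Real.sqrt n ≤ n := by
  rw [Real.sqrt_le_left (Nat.cast_nonneg n)]
  exact_mod_cast Nat.le_self_pow two_ne_zero n

/-- Convergence to the PEPS, for `δ` small compared to the inverse of the degree `m`. -/
theorem InjectivePEPS.traceNorm_expSuperop_sub_le {N d D : ℕ}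
    {G : SimpleGraph (Fin N)} [DecidableRel G.Adj] (P : InjectivePEPS d D G) {m : ℕ} (hm : 1 ≤ m)
    (hdeg : ∀ i, G.degree i ≤ m) {δ : ℝ} (h0 : 0 ≤ δ)
    (hδ : ∀ i, opNorm ((P.A i)ᴴ * P.A i - 1) ≤ δ) (hδm : 400 * δ * m ≤ 1) {t : ℝ} (ht : 0 ≤ t)
    (X : Matrix (Config N d) (Config N d) ℂ) :
    traceNorm ((expSuperop P.lindbladian t - P.resetToTarget) X)
      ≤ 192 * (N * m * Real.exp (-(1 / 4 * t))) * traceNorm X := by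
  have hm' : (1 : ℝ) ≤ m := by exact_mod_cast hm
  have hδ1 : 400 * δ ≤ 1 := by nlinarith
  have hδ' : δ ≤ 1 / 2 := by linarith
  let W := P.network hδ hδ'
  have hε : (1 + 2 * δ) ^ 4 - 1 ≤ 9 * δ := by
    have h2 : δ ^ 2 ≤ δ * (1 / 400) := by nlinarith
    have h3 : δ ^ 3 ≤ δ * (1 / 400) := by nlinarith [mul_nonneg h0 h0]
    have h4 : δ ^ 4 ≤ δ * (1 / 400) := by
      nlinarith [mul_nonneg h0 h0, mul_nonneg (mul_nonneg h0 h0) h0]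
    nlinarith
  have hεm : 42 * (9 * δ) * m ≤ 1 := by nlinarith [mul_nonneg h0 (Nat.cast_nonneg (α := ℝ) m)]
  have hdeg' : ∀ i, (Finset.univ.filter fun e => i ∈ W.ends e).card ≤ m := fun i =>
    (InjectivePEPS.card_filter_ends_le i).trans (hdeg i)
  have hne : ∀ e, (W.ends e).Nonempty := fun e => ⟨e.1.1, Finset.mem_insert_self _ _⟩
  have h0' : 0 ≤ 2 * δ := by linarith
  have hK := W.krausDual_jumps_le hm
  have hdecay := W.dualGenerator_energy_le h0' hε hm hdeg' hεm
  have hM := W.energy_le h0' hε hm hdeg' hεm hne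
  rw [Fintype.card_fin] at hM
  have hker : ∀ v, W.energy m *ᵥ v = 0 → ∃ c : ℂ, v = c • P.psi := by
    intro v hv
    have hJ := mulVec_eq_zero_of_krausDual_le hK hv
    refine P.exists_eq_smul_psi (fun e α => ?_) fun i => ?_
    · rw [← P.network_jump hδ hδ']
      exact hJ (Sum.inl (e, α))
    · have hs : W.siteEnergy i *ᵥ v = 0 := by
        rw [← W.krausDual_sitePump, krausDual, Matrix.sum_mulVec]
        refine Finset.sum_eq_zero fun x _ => ?_
        rw [← mulVec_mulVec, show W.sitePump i x *ᵥ v = 0 from hJ (Sum.inr (i, x)), mulVec_zero]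
      rw [P.proj_eq]
      exact hs
  have h := ParentLindblad.traceNorm_expSuperop_sub_le W.jumps one_half_pos hK hdecay hM P.psi hker
    ht X
  rw [← P.lindbladian_eq hδ hδ'] at h
  refine h.trans (mul_le_mul_of_nonneg_right ?_ (Finset.sum_nonneg fun k _ => Real.sqrt_nonneg _))
  have hsq : Real.sqrt (6 * (N * m) / (1 / 2)) ≤ 12 * (N * m) := by
    have := sqrt_natCast_le (12 * (N * m))
    push_cast at this
    convert this using 2
    ring
  calc 16 * (Real.sqrt (6 * (N * m) / (1 / 2)) * Real.exp (-(1 / 2 / 2 * t)))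
      ≤ 16 * (12 * (N * m) * Real.exp (-(1 / 2 / 2 * t))) := by gcongr
    _ = _ := by norm_num; ring

end Main

end ParentLindblad

end

theorem theorem2 :
    ∃ (δth : ℕ → ℝ) (C κ : ℝ),
      (∀ n, 0 < δth n) ∧
      Asymptotics.IsTheta Filter.atTop δth (fun n : ℕ => 1 / (n : ℝ)) ∧
      0 < C ∧ 0 < κ ∧
      ∀ (𝔡₀ : ℕ), 1 ≤ 𝔡₀ →
      ∀ (N d D : ℕ) (G : SimpleGraph (Fin N)) [DecidableRel G.Adj],
        (∀ i, G.degree i ≤ 𝔡₀) →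
        ∀ (P : ParentLindblad.InjectivePEPS d D G) (δ : ℝ),
          (∀ i, ParentLindblad.opNorm ((P.A i).conjTranspose * P.A i - 1) ≤ δ) →
          δ ≤ δth 𝔡₀ →
          ∀ t : ℝ, 0 ≤ t →
            ParentLindblad.oneOneNorm
                (ParentLindblad.expSuperop P.lindbladian t - P.resetToTarget)
              ≤ ENNReal.ofReal (C * (N * 𝔡₀ * Real.exp (-(κ * t)))) := by
  refine ⟨fun n => 1 / (400 * (n + 1)), 192, 1 / 4, fun n => by positivity,
    ParentLindblad.isTheta_const_div_add_one (by norm_num), by norm_num, by norm_num, ?_⟩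
  intro m hm N d D G _ hdeg P δ hδ hδth t ht
  refine iSup₂_le fun X hX => ENNReal.ofReal_le_ofReal ?_
  -- the threshold, unlike `δ`, is nonnegative even for a graph without vertices
  have h := P.traceNorm_expSuperop_sub_le hm hdeg (δ := 1 / (400 * (m + 1))) (by positivity)
    (fun i => (hδ i).trans hδth) (by rw [← sub_nonneg]; field_simp; linarith) ht X
  rwa [hX, mul_one] at h
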